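/- **Setting.** Let $d\in\{2,3\}$, let $\Omega\subset\mathbb R^d$ be a bounded polytopal domain, and let $\Gamma=\bigcup_{i}\Gamma_i$ be a finite union of pairwise disjoint planar fractures $\Gamma_i\subset\Omega$, each one an open, simply connected polygonal domain (a segment if $d=2$) with angles smaller than $2\pi$; the boundary of each connected component of $\Omega\setminus\overline\Gamma$ meets $\partial\Omega$ in a set of nonzero surface measure. Let $T>0$ and let $d_0:\Gamma\to(0,\infty)$ be continuous. Let $\gamma$ be the trace on $\Gamma$, $\nabla_\tau$ the tangential gradient, and $V_0=\{v\in H^1_0(\Omega):\gamma v\in H^1_{d_0}(\Gamma)\}$, where $H^1_{d_0}(\Gamma)$ is the set of $g\in L^2(\Gamma)$ with $d_0^{3/2}\nabla_\tau g\in L^2(\Gamma)^{d-1}$ whose traces agree at fracture intersections $\partial\Gamma_i\cap\partial\Gamma_j$ and vanish on $\partial\Gamma_i\cap\partial\Omega$. **Data.** For each phase $\alpha\in\{\mathrm{nw},\mathrm w\}$ and $\mathrm{rt}\in\{m,f\}$: the mobility $\eta^\alpha_{\rm rt}$ is continuous and non-decreasing on $[0,1]$ and lies between two positive constants there; $S^{\rm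 nw}_{\rm rt}:\mathbb R\to[0,1]$ is non-decreasing and Lipschitz, $S^{\rm w}_{\rm rt}=1-S^{\rm nw}_{\rm rt}$, $U_{\rm rt}(q)=\int_0^q z\,(S^{\rm nw}_{\rm rt})'(z)\,dz$; $b\in[0,1]$ and $M,\lambda,\mu>0$; $\bar p^\alpha_0\in V_0\cap L^\infty(\Omega)$ with $\gamma\bar p_0^\alpha\in L^\infty(\Gamma)$, $\bar\phi^0_m\in L^\infty(\Omega)$; $\mathbf f\in L^2(\Omega)^d$, $h^\alpha_m\in L^2((0,T)\times\Omega)$, $h^\alpha_f\in L^2((0,T)\times\Gamma)$; $\mathbb K_m$ is a symmetric, uniformly elliptic (bounded) tensor field on $\Omega$. **Discretizations.** A (space-time) flow discretization $\mathcal D_p$ consists of a finite-dimensional space $X^0_{\mathcal D_p}$ with a canonical basis $(\mathbf e_i)_i$; linear maps $\nabla^m_{\mathcal D_p}:X^0_{\mathcal D_p}\to L^\infty(\Omega)^d$, $\nabla^f_{\mathcal D_p}:X^0_{\mathcal D_p}\to L^\infty(\Gamma)^{d-1}$; piecewise constant reconstructions $\Pi^m_{\mathcal D_p}v=\sum_i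 v_i\mathbf 1_{\omega^m_i}$, $\Pi^f_{\mathcal D_p}v=\sum_iv_i\mathbf 1_{\omega_i^f}$ with pairwise disjoint measurable $\omega_i^m\subset\Omega$, pairwise disjoint measurable $\omega_i^f\subset\Gamma$ (possibly empty, not necessarily covering); a grid $0=t_0<\dots<t_N=T$; and interpolators $I_{\mathcal D_p}:V_0\to X^0_{\mathcal D_p}$, $I^m_{\mathcal D_p}:L^2(\Omega)\to X^0_{\mathcal D_p}$. It is assumed that $\|v\|_{\mathcal D_p}=\|\nabla^m_{\mathcal D_p}v\|_{L^2(\Omega)}+\|d_0^{3/2}\nabla^f_{\mathcal D_p}v\|_{L^2(\Gamma)}$ is a norm. Functions and products of elements of $X^0_{\mathcal D_p}$ are taken coordinatewise, and $|v|_\infty=\max_i|v_i|$. A mechanical discretization $\mathcal D_{\mathbf u}$ consists of a finite-dimensional space $X^0_{\mathcal D_{\mathbf u}}$ and linear maps $\epsilon_{\mathcal D_{\mathbf u}}:X^0_{\mathcal D_{\mathbf u}}\to L^2(\Omega,\mathcal S_d(\mathbb R))$, $\Pi_{\mathcal D_{\mathbf u}}:X^0_{\mathcal D_{\mathbf u}}\to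 L^2(\Omega)^d$, $[\![\cdot]\!]_{\mathcal D_{\mathbf u}}:X^0_{\mathcal D_{\mathbf u}}\to L^4(\Gamma)$ such that $\|\mathbf v\|_{\mathcal D_{\mathbf u}}=\|\epsilon_{\mathcal D_{\mathbf u}}(\mathbf v)\|_{L^2}$ is a norm; ${\rm div}_{\mathcal D_{\mathbf u}}={\rm tr}\,\epsilon_{\mathcal D_{\mathbf u}}$ and $\sigma_{\mathcal D_{\mathbf u}}=2\mu\,\epsilon_{\mathcal D_{\mathbf u}}+\lambda\,{\rm div}_{\mathcal D_{\mathbf u}}\,\mathbb I$. A family $(w_n)_{n=0}^N$ is extended to $[0,T]$ by $w(0)=w_0$, $w(t)=w_{n+1}$ for $t\in(t_n,t_{n+1}]$, and $\delta_tw=(w_{n+1}-w_n)/(t_{n+1}-t_n)$ on $(t_n,t_{n+1}]$. **Scheme.** A solution consists of $p^\alpha\in(X^0_{\mathcal D_p})^{N+1}$ and $\mathbf u\in(X^0_{\mathcal D_{\mathbf u}})^{N+1}$ such that, with $p_c=p^{\rm nw}-p^{\rm w}$, $s^\alpha_{\rm rt}=S^\alpha_{\rm rt}(p_c)$, $p^E_{\rm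 rt}=\sum_\alpha p^\alpha s^\alpha_{\rm rt}-U_{\rm rt}(p_c)$, $d_{f,\mathcal D_{\mathbf u}}=-[\![\mathbf u]\!]_{\mathcal D_{\mathbf u}}$ and $\phi_{\mathcal D}=\Pi^m_{\mathcal D_p}I^m_{\mathcal D_p}\bar\phi^0_m+b\,{\rm div}_{\mathcal D_{\mathbf u}}(\mathbf u-\mathbf u_0)+\frac1M\Pi^m_{\mathcal D_p}(p^E_m-p^{E}_{m,0})$, for all $\alpha$, all $\varphi\in(X^0_{\mathcal D_p})^{N+1}$ and all $\mathbf v\in(X^0_{\mathcal D_{\mathbf u}})^{N+1}$, $$\int_0^T\!\!\int_\Omega\Big(\delta_t(\phi_{\mathcal D}\Pi^m_{\mathcal D_p}s^\alpha_m)\Pi^m_{\mathcal D_p}\varphi+\eta^\alpha_m(\Pi^m_{\mathcal D_p}s^\alpha_m)\mathbb K_m\nabla^m_{\mathcal D_p}p^\alpha\cdot\nabla^m_{\mathcal D_p}\varphi\Big)+\int_0^T\!\!\int_\Gamma\delta_t(d_{f,\mathcal D_{\mathbf u}}\Pi^f_{\mathcal D_p}s^\alpha_f)\Pi^f_{\mathcal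 D_p}\varphi+\int_0^T\!\!\int_\Gamma\eta^\alpha_f(\Pi^f_{\mathcal D_p}s^\alpha_f)\tfrac{d_{f,\mathcal D_{\mathbf u}}^3}{12}\nabla^f_{\mathcal D_p}p^\alpha\cdot\nabla^f_{\mathcal D_p}\varphi=\int_0^T\!\!\int_\Omega h^\alpha_m\Pi^m_{\mathcal D_p}\varphi+\int_0^T\!\!\int_\Gamma h^\alpha_f\Pi^f_{\mathcal D_p}\varphi,$$ $$\int_0^T\!\!\int_\Omega\Big(\sigma_{\mathcal D_{\mathbf u}}(\mathbf u):\epsilon_{\mathcal D_{\mathbf u}}(\mathbf v)-b\,\Pi^m_{\mathcal D_p}p^E_m\,{\rm div}_{\mathcal D_{\mathbf u}}(\mathbf v)\Big)+\int_0^T\!\!\int_\Gamma\Pi^f_{\mathcal D_p}p^E_f\,[\![\mathbf v]\!]_{\mathcal D_{\mathbf u}}=\int_0^T\!\!\int_\Omega\mathbf f\cdot\Pi_{\mathcal D_{\mathbf u}}\mathbf v,$$ with $p^\alpha_0=I_{\mathcal D_p}\bar p^\alpha_0$, and $\mathbf u_0$ solving the second equation without the time variable, with the equivalent pressures built from $(p^\alpha_0)_\alpha$.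 **Proposition.** Let $(\mathcal D_p^l)_{l\in\mathbb N}$ and $(\mathcal D_{\mathbf u}^l)_{l\in\mathbb N}$ be sequences of such discretizations with the following properties. * Coercivity: there is $C$ with $\|\Pi^m_{\mathcal D_p^l}v\|_{L^2(\Omega)}+\|\Pi^f_{\mathcal D_p^l}v\|_{L^2(\Gamma)}\le C\|v\|_{\mathcal D_p^l}$ and $\|\Pi_{\mathcal D_{\mathbf u}^l}\mathbf v\|_{L^2(\Omega)}+\|[\![\mathbf v]\!]_{\mathcal D_{\mathbf u}^l}\|_{L^4(\Gamma)}\le C\|\mathbf v\|_{\mathcal D_{\mathbf u}^l}$ for all $l$, $v$, $\mathbf v$. * Consistency of time steps and interpolators: $\Delta t^l=\max_n(t^l_{n+1}-t^l_n)\to0$; $\|\Pi^m_{\mathcal D_p^l}I_{\mathcal D_p^l}w-w\|_{L^2(\Omega)}+\|\Pi^f_{\mathcal D_p^l}I_{\mathcal D_p^l}w-\gamma w\|_{L^2(\Gamma)}\to0$ for all $w\in V_0$; $\|\Pi^m_{\mathcal D_p^l}I^m_{\mathcal D_p^l}\psi-\psi\|_{L^2(\Omega)}\to0$ for all $\psi\in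 L^2(\Omega)$. * Local compactness: if $\sup_l\|v^l\|_{\mathcal D_p^l}<\infty$, then $(\Pi^m_{\mathcal D_p^l}v^l)_l$ is relatively compact in $L^2(K_m)$ for each compact $K_m\subset\Omega$, and $(\Pi^f_{\mathcal D_p^l}v^l)_l$ is relatively compact in $L^2(K_f)$ for each compact $K_f\subset\Gamma$ disjoint from all $\overline\Gamma_i\cap\overline\Gamma_j$, $i\ne j$. * Chain rule: for each Lipschitz $F:\mathbb R\to\mathbb R$ with $F(0)=0$ there is $C_F\ge 0$ with $\|\nabla^m_{\mathcal D_p^l}F(v)\|_{L^2(\Omega)}\le C_F\|\nabla^m_{\mathcal D_p^l}v\|_{L^2(\Omega)}$ for all $l$, $v$. * Product rule: there is $C_P$ with $\|\nabla^m_{\mathcal D_p^l}(vw)\|_{L^2(\Omega)}\le C_P(|v|_\infty\|\nabla^m_{\mathcal D_p^l}w\|_{L^2(\Omega)}+|w|_\infty\|\nabla^m_{\mathcal D_p^l}v\|_{L^2(\Omega)})$ for all $l$, $v$, $w$. * Cut-off: for each compact $K\subset\Omega\setminus\overline\Gamma$ there are $C_K\ge 0$ and $\psi^l\in X^0_{\mathcal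 D_p^l}$ with $\sup_l|\psi^l|_\infty<\infty$ such that, for all large $l$, $\Pi^m_{\mathcal D_p^l}\psi^l\ge0$ on $\Omega$, $\Pi^m_{\mathcal D_p^l}\psi^l=1$ on $K$, $\|\nabla^m_{\mathcal D_p^l}\psi^l\|_{L^2(\Omega)}\le C_K$, and $\Pi^f_{\mathcal D_p^l}(v\psi^l)=0$, $\nabla^f_{\mathcal D_p^l}(v\psi^l)=0$ for all $v\in X^0_{\mathcal D_p^l}$. Let $\phi_{m,\min}>0$ and, for each $l$, let $(p^\alpha_l)_\alpha,\mathbf u^l$ be a solution of the scheme such that 1. $d_{f,\mathcal D^l_{\mathbf u}}(t,\mathbf x)\ge d_0(\mathbf x)$ for a.e. $(t,\mathbf x)\in(0,T)\times\Gamma$, and $d_{f,\mathcal D^l_{\mathbf u}}(0,\cdot)\ge0$ a.e. on $\Gamma$; 2. $\phi_{\mathcal D^l}(t,\mathbf x)\ge\phi_{m,\min}$ for a.e. $(t,\mathbf x)\in(0,T)\times\Omega$, and $\phi_{\mathcal D^l}(0,\cdot)\ge0$ a.e. on $\Omega$. Then, for each phase $\alpha$, the sequence $(\Pi^m_{\mathcal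 D_p^l}S^\alpha_m(p^l_c))_{l\in\mathbb N}$, with $p_c^l=p^{\rm nw}_l-p^{\rm w}_l$, is relatively compact in $L^2((0,T)\times\Omega)$. -/

import Mathlib

open MeasureTheory Filter Topology Set
open scoped ENNReal NNReal ContDiff

noncomputable section

namespace PoroGDM

/-- Points and vectors of `ℝⁿ`, with the Euclidean norm. -/
abbrev Vec (n : ℕ) := EuclideanSpace ℝ (Fin n)

/-- Real `n × n` matrices with the Frobenius inner product `A : B` and norm. -/
abbrev Tens (n : ℕ) := EuclideanSpace ℝ (Fin n × Fin n)

/-- The trace of a matrix. -/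
def tr {n : ℕ} (A : Tens n) : ℝ := ∑ i, A (i, i)

/-- The identity matrix. -/
def idTens (n : ℕ) : Tens n := WithLp.toLp 2 fun ij => if ij.1 = ij.2 then 1 else 0

/-- The `L²(μ)` norm (used only for members of `L²(μ)`). -/
def l2 {X V : Type*} [MeasurableSpace X] [NormedAddCommGroup V] (μ : Measure X) (f : X → V) : ℝ :=
  (eLpNorm f 2 μ).toReal

/-- The functions `f l` all belong to `L²(μ)`, and the sequence of their classes is relatively
compact there. -/
def RelCompactL2 {X V : Type*} [MeasurableSpace X] [NormedAddCommGroup V] (μ : Measure X)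
    (f : ℕ → X → V) : Prop :=
  ∃ h : ∀ l, MemLp (f l) 2 μ, IsCompact (closure (range fun l => (h l).toLp (f l)))

/-! ### Geometry -/

/-- A bounded domain whose boundary is made of finitely many pieces of affine hyperplanes. -/
def IsPolytopalDomain {n : ℕ} (U : Set (Vec n)) : Prop :=
  IsOpen U ∧ IsConnected U ∧ Bornology.IsBounded U ∧
    ∃ H : Finset (AffineSubspace ℝ (Vec n)),
      (∀ A ∈ H, Module.finrank ℝ A.direction + 1 = n) ∧ frontier U ⊆ ⋃ A ∈ H, (A : Set (Vec n))

/-- A polytopal domain `Ω ⊆ ℝᵈ` with a network of planar fractures. The `i`-th fracture is the image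
of a polygonal domain `shape i ⊆ ℝᵈ⁻¹` under an isometric affine map `chart i : ℝᵈ⁻¹ → ℝᵈ`. -/
structure FracturedDomain (d : ℕ) where
  Ω : Set (Vec d)
  polytopal : IsPolytopalDomain Ω
  num : ℕ
  shape : Fin num → Set (Vec (d - 1))
  chart : Fin num → (Vec (d - 1) →ᵃⁱ[ℝ] Vec d)
  shape_polytopal : ∀ i, IsPolytopalDomain (shape i)
  shape_simply_connected : ∀ i, IsSimplyConnected (shape i)
  /-- no slits: the angles are smaller than `2π` -/
  shape_angles : ∀ i, interior (closure (shape i)) = shape i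
  fracture_subset : ∀ i, chart i '' shape i ⊆ Ω
  fracture_disjoint : ∀ i j, i ≠ j → Disjoint (chart i '' shape i) (chart j '' shape j)
  /-- the boundary of each connected component of `Ω` minus the closed network meets `∂Ω` in a set
  of nonzero surface measure -/
  component : ∀ x ∈ Ω \ closure (⋃ i, chart i '' shape i),
    0 < μHE[d - 1] (frontier (connectedComponentIn (Ω \ closure (⋃ i, chart i '' shape i)) x) ∩
      frontier Ω)

namespace FracturedDomain

variable {d : ℕ} (G : FracturedDomain d)

/-- The `i`-th fracture. -/
def fracture (i : Fin G.num) : Set (Vec d) := G.chart i '' G.shape i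

/-- The relative boundary of the `i`-th fracture. -/
def fractureBdry (i : Fin G.num) : Set (Vec d) := G.chart i '' frontier (G.shape i)

/-- The fracture network. -/
def Γ : Set (Vec d) := ⋃ i, G.fracture i

/-- Lebesgue measure on the matrix domain. -/
def vol : Measure (Vec d) := volume.restrict G.Ω

/-- Surface measure on the fracture network. -/
def surf : Measure (Vec d) := (μHE[d - 1] : Measure (Vec d)).restrict G.Γ

/-- `w ∈ H¹₀(Ω)`, and `g` is the trace of `w` on the fracture network: test functions converge to
`w` in `H¹(Ω)`, and their restrictions to the network converge to `g` in `L²`. -/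
def InH10WithTrace (w g : Vec d → ℝ) : Prop :=
  MemLp w 2 G.vol ∧ MemLp g 2 G.surf ∧
    ∃ D : Vec d → Vec d, MemLp D 2 G.vol ∧
      ∃ φ : ℕ → Vec d → ℝ,
        (∀ n, ContDiff ℝ ∞ (φ n) ∧ HasCompactSupport (φ n) ∧ tsupport (φ n) ⊆ G.Ω) ∧
        Tendsto (fun n => eLpNorm (φ n - w) 2 G.vol) atTop (𝓝 0) ∧
        Tendsto (fun n => eLpNorm (gradient (φ n) - D) 2 G.vol) atTop (𝓝 0) ∧
        Tendsto (fun n => eLpNorm (φ n - g) 2 G.surf) atTop (𝓝 0)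

/-- `D` is the weak tangential gradient of `g` on every fracture, in the coordinates of its chart. -/
def HasWeakTangentialGradient (g : Vec d → ℝ) (D : Vec d → Vec (d - 1)) : Prop :=
  ∀ i, LocallyIntegrableOn (fun y => g (G.chart i y)) (G.shape i) ∧
    LocallyIntegrableOn (fun y => D (G.chart i y)) (G.shape i) ∧
    ∀ φ : Vec (d - 1) → ℝ, ContDiff ℝ ∞ φ → HasCompactSupport φ → tsupport φ ⊆ G.shape i →
      ∫ y in G.shape i, g (G.chart i y) • gradient φ y = -∫ y in G.shape i, φ y • D (G.chart i y)

/-- The trace of `g`, taken from the `i`-th fracture, at a point `x` of its boundary is `c`: the mean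
values of `g` on the parts of the fracture near `x` tend to `c`. -/
def HasFractureTrace (i : Fin G.num) (g : Vec d → ℝ) (x : Vec d) (c : ℝ) : Prop :=
  Tendsto (fun r : ℝ => ⨍ y in G.shape i ∩ G.chart i ⁻¹' Metric.ball x r, g (G.chart i y))
    (𝓝[>] 0) (𝓝 c)

/-- The weighted space `H¹_{d₀}(Γ)`: square integrable functions with square integrable weighted
tangential gradient, whose traces agree at fracture intersections and vanish on `∂Ω`. -/
def InWeightedH1 (d₀ g : Vec d → ℝ) : Prop :=
  MemLp g 2 G.surf ∧
    (∃ D, G.HasWeakTangentialGradient g D ∧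
      MemLp (fun x => d₀ x ^ (3 / 2 : ℝ) • D x) 2 G.surf) ∧
    (∀ i j, i ≠ j →
      ∀ᵐ x ∂(μHE[d - 2] : Measure (Vec d)).restrict (G.fractureBdry i ∩ G.fractureBdry j),
        ∃ c, G.HasFractureTrace i g x c ∧ G.HasFractureTrace j g x c) ∧
    ∀ i, ∀ᵐ x ∂(μHE[d - 2] : Measure (Vec d)).restrict (G.fractureBdry i ∩ frontier G.Ω),
      G.HasFractureTrace i g x 0

/-- `w ∈ V₀`, with trace `g = γ w`. -/
def InV0 (d₀ w g : Vec d → ℝ) : Prop := G.InH10WithTrace w g ∧ G.InWeightedH1 d₀ g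

end FracturedDomain

/-! ### Physical data -/

/-- The non-wetting and wetting phases. -/
inductive Phase where
  | nw
  | w

/-- Phase saturations, from the non-wetting one. -/
def sat (S : ℝ → ℝ) : Phase → ℝ → ℝ
  | Phase.nw => S
  | Phase.w => fun q => 1 - S q

/-- Capillary energy density of a rock type with non-wetting saturation `S`. -/
def capEnergy (S : ℝ → ℝ) (q : ℝ) : ℝ := ∫ z in (0 : ℝ)..q, z * deriv S z

/-- Assumptions on a mobility function of the saturation. -/
def IsMobility (η : ℝ → ℝ) : Prop :=
  ContinuousOn η (Icc 0 1) ∧ MonotoneOn η (Icc 0 1) ∧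
    ∃ lo hi : ℝ, 0 < lo ∧ ∀ s ∈ Icc (0 : ℝ) 1, lo ≤ η s ∧ η s ≤ hi

/-- Assumptions on a non-wetting saturation function of the capillary pressure. -/
def IsSaturation (S : ℝ → ℝ) : Prop :=
  Monotone S ∧ (∃ L : ℝ≥0, LipschitzWith L S) ∧ ∀ q, S q ∈ Icc (0 : ℝ) 1

/-- The data of the coupled model, with the standing assumptions on them. -/
structure Model (d : ℕ) extends FracturedDomain d where
  /-- final time -/
  T : ℝ
  T_pos : 0 < T
  /-- lower bound on the fracture aperture, continuous and positive on the fractures -/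
  d₀ : Vec d → ℝ
  d₀_cont : ContinuousOn d₀ toFracturedDomain.Γ
  d₀_pos : ∀ x ∈ toFracturedDomain.Γ, 0 < d₀ x
  /-- mobilities in the matrix and in the fractures -/
  ηm : Phase → ℝ → ℝ
  ηf : Phase → ℝ → ℝ
  ηm_mob : ∀ α, IsMobility (ηm α)
  ηf_mob : ∀ α, IsMobility (ηf α)
  /-- non-wetting saturations in the matrix and in the fractures -/
  Sm : ℝ → ℝ
  Sf : ℝ → ℝ
  Sm_sat : IsSaturation Sm
  Sf_sat : IsSaturation Sf
  /-- Biot coefficient, Biot modulus, Lamé coefficients -/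
  b : ℝ
  M : ℝ
  lam : ℝ
  mu : ℝ
  b_mem : b ∈ Icc (0 : ℝ) 1
  M_pos : 0 < M
  lam_pos : 0 < lam
  mu_pos : 0 < mu
  /-- initial pressures and their traces on the fracture network; initial porosity -/
  pInit : Phase → Vec d → ℝ
  γpInit : Phase → Vec d → ℝ
  pInit_V0 : ∀ α, toFracturedDomain.InV0 d₀ (pInit α) (γpInit α)
  pInit_bdd : ∀ α, MemLp (pInit α) ∞ toFracturedDomain.vol
  γpInit_bdd : ∀ α, MemLp (γpInit α) ∞ toFracturedDomain.surf
  φInit : Vec d → ℝ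
  φInit_bdd : MemLp φInit ∞ toFracturedDomain.vol
  /-- body force and source terms -/
  f : Vec d → Vec d
  f_mem : MemLp f 2 toFracturedDomain.vol
  hm : Phase → ℝ × Vec d → ℝ
  hf : Phase → ℝ × Vec d → ℝ
  hm_mem : ∀ α, MemLp (hm α) 2 ((volume.restrict (Ioo 0 T)).prod toFracturedDomain.vol)
  hf_mem : ∀ α, MemLp (hf α) 2 ((volume.restrict (Ioo 0 T)).prod toFracturedDomain.surf)
  /-- matrix permeability: a symmetric uniformly elliptic tensor field -/
  K : Vec d → (Vec d →L[ℝ] Vec d)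
  K_meas : AEStronglyMeasurable K toFracturedDomain.vol
  K_symm : ∀ᵐ x ∂toFracturedDomain.vol, ∀ ξ ζ, inner ℝ (K x ξ) ζ = inner ℝ ξ (K x ζ)
  K_elliptic : ∃ lo hi : ℝ, 0 < lo ∧ ∀ᵐ x ∂toFracturedDomain.vol, ∀ ξ,
    lo * ‖ξ‖ ^ 2 ≤ inner ℝ (K x ξ) ξ ∧ inner ℝ (K x ξ) ξ ≤ hi * ‖ξ‖ ^ 2

namespace Model

variable {d : ℕ} (Q : Model d)

/-- Lebesgue measure on `(0,T)`. -/
def time : Measure ℝ := volume.restrict (Ioo 0 Q.T)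

end Model

/-! ### Time discretization -/

/-- A discretization `0 = t₀ < t₁ < ⋯ < t_N = T` of `[0,T]`. -/
structure TimeGrid (T : ℝ) where
  N : ℕ
  t : Fin (N + 1) → ℝ
  t_zero : t 0 = 0
  t_last : t (Fin.last N) = T
  t_strictMono : StrictMono t

namespace TimeGrid

variable {T : ℝ} (τ : TimeGrid T)

/-- The index of the discrete value taken at time `s`: it is `0` at `s = 0` and `n + 1` for
`s ∈ (tₙ, tₙ₊₁]`. -/
def idx (s : ℝ) : Fin (τ.N + 1) := sInf {k | s ≤ τ.t k}

/-- The maximal time step. -/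
def maxStep : ℝ := ⨆ n : Fin τ.N, (τ.t n.succ - τ.t n.castSucc)

/-- The discrete time derivative; its value of index `n + 1` is `(fₙ₊₁ - fₙ) / (tₙ₊₁ - tₙ)`. The value
of index `0` is not used. -/
def δ {V : Type*} [AddCommGroup V] [Module ℝ V] (f : Fin (τ.N + 1) → V) : Fin (τ.N + 1) → V :=
  Fin.cases 0 fun n => (τ.t n.succ - τ.t n.castSucc)⁻¹ • (f n.succ - f n.castSucc)

theorem idx_zero : τ.idx 0 = 0 := by
  have h : (0 : Fin (τ.N + 1)) ∈ {k | (0 : ℝ) ≤ τ.t k} := by simp [τ.t_zero]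
  exact le_antisymm (sInf_le h) (Fin.zero_le _)

theorem idx_of_mem (n : Fin τ.N) {s : ℝ} (hs : s ∈ Ioc (τ.t n.castSucc) (τ.t n.succ)) :
    τ.idx s = n.succ := by
  refine le_antisymm (sInf_le hs.2) (le_sInf fun k hk => ?_)
  by_contra hlt
  have h1 : k ≤ n.castSucc := by
    rw [Fin.le_iff_val_le_val]
    have := Fin.lt_def.1 (not_le.1 hlt)
    simp at this ⊢
    omega
  exact absurd (hk.trans (τ.t_strictMono.monotone h1)) (not_le.2 hs.1)

end TimeGrid

/-! ### Gradient discretizations -/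

variable {d : ℕ}

/-- A space-time gradient discretization for the flow. The space of unknowns is identified with
`ℝⁿ` through its canonical basis. The reconstructions are piecewise constant: there are disjoint
cells of `Ω` (resp. of the network), indexed by the canonical basis, on which the reconstructed
function takes the value of the corresponding coordinate; it is `0` outside of the cells. -/
structure FlowGD (Q : Model d) where
  n : ℕ
  cellM : Fin n → Set (Vec d)
  cellF : Fin n → Set (Vec d)
  cellM_meas : ∀ i, MeasurableSet (cellM i)
  cellF_meas : ∀ i, MeasurableSet (cellF i)
  cellM_subset : ∀ i, cellM i ⊆ Q.Ω
  cellF_subset : ∀ i, cellF i ⊆ Q.Γ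
  cellM_disjoint : Pairwise fun i j => Disjoint (cellM i) (cellM j)
  cellF_disjoint : Pairwise fun i j => Disjoint (cellF i) (cellF j)
  /-- discrete gradients in the matrix and, in chart coordinates, on the fractures -/
  gradM : (Fin n → ℝ) →ₗ[ℝ] (Vec d → Vec d)
  gradF : (Fin n → ℝ) →ₗ[ℝ] (Vec d → Vec (d - 1))
  gradM_mem : ∀ v, MemLp (gradM v) ∞ Q.vol
  gradF_mem : ∀ v, MemLp (gradF v) ∞ Q.surf
  /-- the discrete energy norm is a norm -/
  weighted_mem : ∀ v, MemLp (fun x => Q.d₀ x ^ (3 / 2 : ℝ) • gradF v x) 2 Q.surf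
  definite : ∀ v, l2 Q.vol (gradM v) + l2 Q.surf (fun x => Q.d₀ x ^ (3 / 2 : ℝ) • gradF v x) = 0 →
    v = 0
  grid : TimeGrid Q.T
  /-- interpolators of initial conditions, on `V₀` and on `L²(Ω)` -/
  interpP : (Vec d → ℝ) → (Fin n → ℝ)
  interpM : (Vec d → ℝ) → (Fin n → ℝ)

namespace FlowGD

variable {Q : Model d} (D : FlowGD Q)

/-- The discrete unknowns. Products and functions of them are taken coordinate by coordinate, and the
norm of this type is the maximum of the absolute values of the coordinates. -/
abbrev X := Fin D.n → ℝ

/-- Function reconstruction in the matrix. -/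
def recM (v : D.X) (x : Vec d) : ℝ := ∑ i, (D.cellM i).indicator (fun _ => v i) x

/-- Function reconstruction in the fractures. -/
def recF (v : D.X) (x : Vec d) : ℝ := ∑ i, (D.cellF i).indicator (fun _ => v i) x

/-- The discrete energy norm. -/
def nrm (v : D.X) : ℝ :=
  l2 Q.vol (D.gradM v) + l2 Q.surf (fun x => Q.d₀ x ^ (3 / 2 : ℝ) • D.gradF v x)

end FlowGD

/-- A gradient discretization for the mechanics; the space of unknowns is identified with `ℝⁿ` through
some basis. -/
structure MechGD (Q : Model d) where
  n : ℕ
  /-- discrete symmetric gradient, displacement reconstruction, normal jump reconstruction -/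
  ε : (Fin n → ℝ) →ₗ[ℝ] (Vec d → Tens d)
  recon : (Fin n → ℝ) →ₗ[ℝ] (Vec d → Vec d)
  jump : (Fin n → ℝ) →ₗ[ℝ] (Vec d → ℝ)
  ε_symm : ∀ v, ∀ᵐ x ∂Q.vol, ∀ i j, ε v x (i, j) = ε v x (j, i)
  ε_mem : ∀ v, MemLp (ε v) 2 Q.vol
  recon_mem : ∀ v, MemLp (recon v) 2 Q.vol
  jump_mem : ∀ v, MemLp (jump v) 4 Q.surf
  /-- the discrete energy norm is a norm -/
  definite : ∀ v, l2 Q.vol (ε v) = 0 → v = 0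

namespace MechGD

variable {Q : Model d} (D : MechGD Q)

/-- The discrete unknowns. -/
abbrev X := Fin D.n → ℝ

/-- The discrete energy norm. -/
def nrm (v : D.X) : ℝ := l2 Q.vol (D.ε v)

/-- Discrete divergence. -/
def div (v : D.X) (x : Vec d) : ℝ := tr (D.ε v x)

/-- Discrete stress tensor. -/
def σ (v : D.X) (x : Vec d) : Tens d :=
  (2 * Q.mu) • D.ε v x + (Q.lam * D.div v x) • idTens d

end MechGD

/-! ### The gradient scheme -/

section Scheme

variable {Q : Model d} (D : FlowGD Q) (E : MechGD Q)

/-- Space-time unknowns of the flow: one discrete unknown per phase and time. -/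
abbrev FlowUnknown := Phase → Fin (D.grid.N + 1) → D.X

/-- Space-time unknowns of the mechanics. -/
abbrev MechUnknown := Fin (D.grid.N + 1) → E.X

variable {D E} (p : FlowUnknown D) (u : MechUnknown D E)

/-- Discrete capillary pressure. -/
def pc (k : Fin (D.grid.N + 1)) : D.X := p Phase.nw k - p Phase.w k

/-- Discrete matrix saturation. -/
def sM (α : Phase) (k : Fin (D.grid.N + 1)) : D.X := fun i => sat Q.Sm α (pc p k i)

/-- Discrete fracture saturation. -/
def sF (α : Phase) (k : Fin (D.grid.N + 1)) : D.X := fun i => sat Q.Sf α (pc p k i)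

/-- Discrete matrix equivalent pressure. -/
def pEM (k : Fin (D.grid.N + 1)) : D.X := fun i =>
  p Phase.nw k i * sM p Phase.nw k i + p Phase.w k i * sM p Phase.w k i
    - capEnergy Q.Sm (pc p k i)

/-- Discrete fracture equivalent pressure. -/
def pEF (k : Fin (D.grid.N + 1)) : D.X := fun i =>
  p Phase.nw k i * sF p Phase.nw k i + p Phase.w k i * sF p Phase.w k i
    - capEnergy Q.Sf (pc p k i)

/-- Discrete porosity. -/
def porosity (k : Fin (D.grid.N + 1)) (x : Vec d) : ℝ :=
  D.recM (D.interpM Q.φInit) x + Q.b * E.div (u k - u 0) x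
    + 1 / Q.M * D.recM (pEM p k - pEM p 0) x

/-- Discrete fracture aperture. -/
def aperture (k : Fin (D.grid.N + 1)) (x : Vec d) : ℝ := -E.jump (u k) x

/-- The discrete flow equation of the phase `α`, for all discrete test functions. -/
def FlowEquation (α : Phase) : Prop :=
  ∀ φ : Fin (D.grid.N + 1) → D.X,
    (∫ s, ∫ x,
        (D.grid.δ (fun k x => porosity p u k x * D.recM (sM p α k) x) (D.grid.idx s) x
            * D.recM (φ (D.grid.idx s)) x
          + Q.ηm α (D.recM (sM p α (D.grid.idx s)) x)
            * inner ℝ (Q.K x (D.gradM (p α (D.grid.idx s)) x)) (D.gradM (φ (D.grid.idx s)) x))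
        ∂Q.vol ∂Q.time)
      + (∫ s, ∫ x,
          D.grid.δ (fun k x => aperture u k x * D.recF (sF p α k) x) (D.grid.idx s) x
            * D.recF (φ (D.grid.idx s)) x ∂Q.surf ∂Q.time)
      + (∫ s, ∫ x,
          Q.ηf α (D.recF (sF p α (D.grid.idx s)) x) * (aperture u (D.grid.idx s) x ^ 3 / 12)
            * inner ℝ (D.gradF (p α (D.grid.idx s)) x) (D.gradF (φ (D.grid.idx s)) x)
          ∂Q.surf ∂Q.time)
    = (∫ s, ∫ x, Q.hm α (s, x) * D.recM (φ (D.grid.idx s)) x ∂Q.vol ∂Q.time)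
      + ∫ s, ∫ x, Q.hf α (s, x) * D.recF (φ (D.grid.idx s)) x ∂Q.surf ∂Q.time

/-- The discrete mechanical equation, for all discrete test functions. -/
def MechEquation : Prop :=
  ∀ v : Fin (D.grid.N + 1) → E.X,
    (∫ s, ∫ x,
        (inner ℝ (E.σ (u (D.grid.idx s)) x) (E.ε (v (D.grid.idx s)) x)
          - Q.b * D.recM (pEM p (D.grid.idx s)) x * E.div (v (D.grid.idx s)) x) ∂Q.vol ∂Q.time)
      + (∫ s, ∫ x,
          D.recF (pEF p (D.grid.idx s)) x * E.jump (v (D.grid.idx s)) x ∂Q.surf ∂Q.time)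
    = ∫ s, ∫ x, inner ℝ (Q.f x) (E.recon (v (D.grid.idx s)) x) ∂Q.vol ∂Q.time

/-- The stationary mechanical equation satisfied by the initial displacement. -/
def InitialMechEquation : Prop :=
  ∀ v : E.X,
    (∫ x, (inner ℝ (E.σ (u 0) x) (E.ε v x) - Q.b * D.recM (pEM p 0) x * E.div v x) ∂Q.vol)
      + (∫ x, D.recF (pEF p 0) x * E.jump v x ∂Q.surf)
    = ∫ x, inner ℝ (Q.f x) (E.recon v x) ∂Q.vol

/-- `(p, u)` is a solution of the gradient scheme, with its initial conditions. -/
structure IsSolution : Prop where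
  flow : ∀ α, FlowEquation p u α
  mech : MechEquation p u
  init_pressure : ∀ α, p α 0 = D.interpP (Q.pInit α)
  init_mech : InitialMechEquation p u

/-- The reconstructed matrix saturation of the phase `α`, as a function on `(0,T) × Ω`. -/
def satRecon (α : Phase) (z : ℝ × Vec d) : ℝ := D.recM (sM p α (D.grid.idx z.1)) z.2

end Scheme

/-! ### Properties of sequences of gradient discretizations -/

section Properties

variable {Q : Model d} (D : ℕ → FlowGD Q) (E : ℕ → MechGD Q)

/-- Coercivity for the flow. -/
def FlowCoercive : Prop :=
  ∃ C : ℝ, 0 < C ∧ ∀ l (v : (D l).X),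
    l2 Q.vol ((D l).recM v) + l2 Q.surf ((D l).recF v) ≤ C * (D l).nrm v

/-- Consistency of the time steps and of the interpolators of the initial conditions. -/
def SpaceTimeConsistent : Prop :=
  Tendsto (fun l => (D l).grid.maxStep) atTop (𝓝 0) ∧
    (∀ w g : Vec d → ℝ, Q.InV0 Q.d₀ w g →
      Tendsto (fun l => l2 Q.vol ((D l).recM ((D l).interpP w) - w)
        + l2 Q.surf ((D l).recF ((D l).interpP w) - g)) atTop (𝓝 0)) ∧
    ∀ ψ : Vec d → ℝ, MemLp ψ 2 Q.vol →
      Tendsto (fun l => l2 Q.vol ((D l).recM ((D l).interpM ψ) - ψ)) atTop (𝓝 0)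

/-- Local compactness for the flow. -/
def LocallyCompact : Prop :=
  ∀ v : ∀ l, (D l).X, (∃ C : ℝ, ∀ l, (D l).nrm (v l) ≤ C) →
    (∀ K : Set (Vec d), IsCompact K → K ⊆ Q.Ω →
      RelCompactL2 (volume.restrict K) fun l => (D l).recM (v l)) ∧
    ∀ K : Set (Vec d), IsCompact K → K ⊆ Q.Γ →
      (∀ i j, i ≠ j → Disjoint K (closure (Q.fracture i) ∩ closure (Q.fracture j))) →
      RelCompactL2 ((μHE[d - 1] : Measure (Vec d)).restrict K) fun l => (D l).recF (v l)

/-- Chain rule estimate. -/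
def ChainRule : Prop :=
  ∀ F : ℝ → ℝ, (∃ L : ℝ≥0, LipschitzWith L F) → F 0 = 0 →
    ∃ C : ℝ, 0 ≤ C ∧ ∀ l (v : (D l).X),
      l2 Q.vol ((D l).gradM fun i => F (v i)) ≤ C * l2 Q.vol ((D l).gradM v)

/-- Product rule estimate. -/
def ProductRule : Prop :=
  ∃ C : ℝ, ∀ l (v w : (D l).X),
    l2 Q.vol ((D l).gradM (v * w)) ≤
      C * (‖v‖ * l2 Q.vol ((D l).gradM w) + ‖w‖ * l2 Q.vol ((D l).gradM v))

/-- Cut-off property. -/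
def CutOff : Prop :=
  ∀ K : Set (Vec d), IsCompact K → K ⊆ Q.Ω \ closure Q.Γ →
    ∃ C : ℝ, 0 ≤ C ∧ ∃ ψ : ∀ l, (D l).X, (∃ B : ℝ, ∀ l, ‖ψ l‖ ≤ B) ∧
      ∀ᶠ l in atTop,
        (∀ᵐ x ∂Q.vol, 0 ≤ (D l).recM (ψ l) x) ∧
        (∀ᵐ x ∂volume.restrict K, (D l).recM (ψ l) x = 1) ∧
        l2 Q.vol ((D l).gradM (ψ l)) ≤ C ∧
        ∀ v : (D l).X,
          (∀ᵐ x ∂Q.surf, (D l).recF (v * ψ l) x = 0) ∧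
          ∀ᵐ x ∂Q.surf, (D l).gradF (v * ψ l) x = 0

/-- Coercivity for the mechanics. -/
def MechCoercive : Prop :=
  ∃ C : ℝ, 0 < C ∧ ∀ l (v : (E l).X),
    l2 Q.vol ((E l).recon v) + (eLpNorm ((E l).jump v) 4 Q.surf).toReal ≤ C * (E l).nrm v

end Properties

end PoroGDM

end

open PoroGDM

noncomputable section

namespace PoroGDM

/-! ### The `L²` norm -/

section L2

variable {X V W : Type*} [MeasurableSpace X] [NormedAddCommGroup V] [NormedAddCommGroup W]
  {μ : Measure X}

/-! The saturation has to be controlled in space and in time, locally away from the fractures. Two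
estimates that are uniform in the discretization do this.

Energy. Test both flow equations with their pressures and the mechanical equation with the
displacement increment. The terms that couple the equivalent pressures to the divergence and to the
jump then cancel. What remains bounds the growth of the energy ∫_Ω (φ U_m(p_c) + (p^E_m)²/(2M) + ½
σ:ε − f·u) + ∫_Γ d_f U_f(p_c) by sources minus dissipation. The reason is U(q) − U(r) ≤ q (S(q) −
S(r)), multiplied by the old porosity or aperture, whose nonnegativity is needed here
(`capEnergy_sub_le`, `energy_step`). The energy is bounded below, its initial value is bounded
above, and d_f ≥ d₀, so the pressures are bounded in L² in time for the discrete energy norm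
(`energy_estimate`).

Oscillation in time. The scheme has an equation for φs, not for s. But the two saturations sum to 1,
so φ_k − φ_j is the sum over both phases of φ_k s_k − φ_j s_j, while φ_k (s_k − s_j) = (φ_k s_k −
φ_j s_j) − s_j (φ_k − φ_j). Multiply this by (s_k − s_j)ψ, with a cut-off ψ that kills the fracture
terms: the right side is a combination of flow equations tested with (s_k − s_j)ψ and s_j (s_k −
s_j)ψ, whose gradients are bounded by the chain and product rules. Since φ_k ≥ φ_min, this bounds
‖s_k − s_j‖² on a compact set by the pressure gradients at the two times, multiplied by the data and
gradients accumulated between them (`weighted_difference_le`, `exists_oscillation_bound`).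

Compactness. The energy norm of sψ is bounded by the pressure gradients, so at times where these are
moderate s lies near a finite set independent of the discretization (`LocallyCompact.exists_net`).
On each short time interval, s is replaced by its value at a time where the gradients do not exceed
their mean (`exists_spacetime_net`). Finally the closed network is a null set and saturations lie in
[0,1], so compact subsets of its complement suffice (`relCompactL2_of_local_nets`). -/

theorem l2_nonneg (f : X → V) : 0 ≤ l2 μ f := ENNReal.toReal_nonneg

theorem l2_eq_norm {f : X → V} (hf : MemLp f 2 μ) : l2 μ f = ‖hf.toLp f‖ := by
  rw [Lp.norm_toLp, l2]

theorem l2_sq {f : X → V} (hf : MemLp f 2 μ) : l2 μ f ^ 2 = ∫ x, ‖f x‖ ^ 2 ∂μ := by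
  have h := hf.eLpNorm_eq_integral_rpow_norm (by norm_num) (by norm_num)
  have h0 : 0 ≤ ∫ x, ‖f x‖ ^ 2 ∂μ := integral_nonneg fun x => by positivity
  rw [l2, h]
  simp only [ENNReal.toReal_ofNat, Real.rpow_ofNat]
  rw [ENNReal.toReal_ofReal (by positivity), ← Real.rpow_natCast, ← Real.rpow_mul h0]
  norm_num

theorem l2_add_le {f g : X → V} (hf : MemLp f 2 μ) (hg : MemLp g 2 μ) :
    l2 μ (f + g) ≤ l2 μ f + l2 μ g := by
  rw [l2_eq_norm hf, l2_eq_norm hg, l2_eq_norm (hf.add hg), MemLp.toLp_add hf hg]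
  exact norm_add_le _ _

theorem l2_sub_le {f g : X → V} (hf : MemLp f 2 μ) (hg : MemLp g 2 μ) :
    l2 μ (f - g) ≤ l2 μ f + l2 μ g := by
  rw [l2_eq_norm hf, l2_eq_norm hg, l2_eq_norm (hf.sub hg), MemLp.toLp_sub hf hg]
  exact norm_sub_le _ _

theorem l2_smul [NormedSpace ℝ V] (c : ℝ) (f : X → V) : l2 μ (c • f) = |c| * l2 μ f := by
  rw [l2, eLpNorm_const_smul, ENNReal.toReal_mul, l2]
  simp

theorem l2_le_of_ae_le {f : X → V} {g : X → W} (hg : MemLp g 2 μ)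
    (h : ∀ᵐ x ∂μ, ‖f x‖ ≤ ‖g x‖) : l2 μ f ≤ l2 μ g :=
  ENNReal.toReal_mono hg.2.ne (eLpNorm_mono_ae h)

theorem integral_norm_mul_norm_le {f : X → V} {g : X → W} (hf : MemLp f 2 μ) (hg : MemLp g 2 μ) :
    ∫ x, ‖f x‖ * ‖g x‖ ∂μ ≤ l2 μ f * l2 μ g := by
  have h := integral_mul_norm_le_Lp_mul_Lq (μ := μ) (f := fun x => ‖f x‖) (g := fun x => ‖g x‖)
    Real.HolderConjugate.two_two (by simpa using hf.norm) (by simpa using hg.norm)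
  simp only [norm_norm] at h
  refine h.trans (le_of_eq ?_)
  simp only [Real.rpow_ofNat, ← Real.sqrt_eq_rpow]
  rw [← l2_sq hf, ← l2_sq hg, Real.sqrt_sq (l2_nonneg _), Real.sqrt_sq (l2_nonneg _)]

theorem integrable_norm_mul_norm {f : X → V} {g : X → W} (hf : MemLp f 2 μ) (hg : MemLp g 2 μ) :
    Integrable (fun x => ‖f x‖ * ‖g x‖) μ := hf.norm.integrable_mul hg.norm

theorem integral_le_of_ae_le_norm_mul {f : X → V} {g : X → W} {F : X → ℝ} {C : ℝ} (hC : 0 ≤ C)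
    (hf : MemLp f 2 μ) (hg : MemLp g 2 μ) (h : ∀ᵐ x ∂μ, |F x| ≤ C * (‖f x‖ * ‖g x‖)) :
    |∫ x, F x ∂μ| ≤ C * (l2 μ f * l2 μ g) := by
  calc |∫ x, F x ∂μ| ≤ ∫ x, C * (‖f x‖ * ‖g x‖) ∂μ :=
        (Real.norm_eq_abs _).symm.trans_le
          (norm_integral_le_of_norm_le ((integrable_norm_mul_norm hf hg).const_mul C) h)
    _ = C * ∫ x, ‖f x‖ * ‖g x‖ ∂μ := integral_const_mul _ _
    _ ≤ _ := mul_le_mul_of_nonneg_left (integral_norm_mul_norm_le hf hg) hC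

theorem abs_integral_mul_le {f g : X → ℝ} (hf : MemLp f 2 μ) (hg : MemLp g 2 μ) :
    |∫ x, f x * g x ∂μ| ≤ l2 μ f * l2 μ g := by
  simpa using integral_le_of_ae_le_norm_mul zero_le_one hf hg
    (F := fun x => f x * g x) (ae_of_all _ fun x => by simp [abs_mul])

theorem abs_integral_inner_le [InnerProductSpace ℝ V] {f g : X → V} (hf : MemLp f 2 μ)
    (hg : MemLp g 2 μ) : |∫ x, inner ℝ (f x) (g x) ∂μ| ≤ l2 μ f * l2 μ g := by
  simpa using integral_le_of_ae_le_norm_mul zero_le_one hf hg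
    (F := fun x => inner ℝ (f x) (g x)) (ae_of_all _ fun x => by
      simpa using abs_real_inner_le_norm (f x) (g x))

theorem integrable_inner [InnerProductSpace ℝ V] {f g : X → V} (hf : MemLp f 2 μ)
    (hg : MemLp g 2 μ) : Integrable (fun x => inner ℝ (f x) (g x)) μ :=
  (integrable_norm_mul_norm hf hg).mono' (hf.1.inner hg.1)
    (ae_of_all _ fun _ => norm_inner_le_norm _ _)

theorem l2_le_of_bound [IsFiniteMeasure μ] {f : X → V} {C : ℝ} (hC : 0 ≤ C)
    (h : ∀ᵐ x ∂μ, ‖f x‖ ≤ C) : l2 μ f ≤ C * Real.sqrt (μ.real univ) := by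
  have h1 := l2_le_of_ae_le (μ := μ) (f := f) (g := fun _ => C) (memLp_const C)
    (by filter_upwards [h] with x hx; rwa [Real.norm_of_nonneg hC])
  refine h1.trans (le_of_eq ?_)
  have h2 := l2_sq (μ := μ) (memLp_const C)
  rw [← Real.sqrt_sq (l2_nonneg (μ := μ) (fun _ : X => C)), h2]
  simp [mul_comm, Real.sqrt_mul, hC]

/-- Hölder on a finite measure space, the exponent being 1/2 − 1/4. Mechanical coercivity controls
the jump in L⁴, whereas the energy argument uses its L² norm. -/
theorem l2_le_sqrt_mul_rpow_four [IsFiniteMeasure μ] {f : X → V} (hf : MemLp f 4 μ) :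
    l2 μ f ≤ (μ univ ^ (1 / 4 : ℝ)).toReal * (eLpNorm f 4 μ).toReal := by
  have h := eLpNorm_le_eLpNorm_mul_rpow_measure_univ (μ := μ) (p := 2) (q := 4) (by norm_num) hf.1
  rw [l2, mul_comm, ← ENNReal.toReal_mul]
  refine ENNReal.toReal_mono (ENNReal.mul_ne_top hf.2.ne
    (ENNReal.rpow_ne_top_of_nonneg (by norm_num) (measure_ne_top _ _))) ?_
  convert h using 3
  norm_num

end L2

/-! ### Capillary energy -/

/-- Both sides are integrals from r to q, of z S'(z) and of q S'(z). As S' ≥ 0, the integrands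
compare according to whether z lies below or above q, and the orientation of the integral corrects
the sign. A Lipschitz S is absolutely continuous, so the almost everywhere derivative integrates
back to S. -/
theorem capEnergy_sub_le {S : ℝ → ℝ} (hS : IsSaturation S) (q r : ℝ) :
    capEnergy S q - capEnergy S r ≤ q * (S q - S r) := by
  obtain ⟨hmono, ⟨L, hL⟩, -⟩ := hS
  have hac : ∀ a b, AbsolutelyContinuousOnInterval S a b := fun a b =>
    (hL.lipschitzOnWith (s := uIcc a b)).absolutelyContinuousOnInterval
  have hint : ∀ a b, IntervalIntegrable (deriv S) volume a b := fun a b =>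
    (hac a b).intervalIntegrable_deriv
  have hint2 : ∀ a b, IntervalIntegrable (fun z => z * deriv S z) volume a b := fun a b =>
    (hint a b).continuousOn_mul continuousOn_id
  have h1 : capEnergy S q - capEnergy S r = ∫ z in r..q, z * deriv S z :=
    intervalIntegral.integral_interval_sub_left (hint2 _ _) (hint2 _ _)
  have h2 : q * (S q - S r) = ∫ z in r..q, q * deriv S z := by
    rw [intervalIntegral.integral_const_mul, (hac r q).integral_deriv_eq_sub]
  rw [h1, h2]
  have hd : ∀ z, 0 ≤ deriv S z := fun z => hmono.deriv_nonneg
  rcases le_total r q with h | h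
  · exact intervalIntegral.integral_mono_on h (hint2 _ _) ((hint _ _).const_mul _)
      fun z hz => mul_le_mul_of_nonneg_right hz.2 (hd z)
  · rw [intervalIntegral.integral_symm q r, intervalIntegral.integral_symm q r]
    exact neg_le_neg <| intervalIntegral.integral_mono_on h ((hint _ _).const_mul _) (hint2 _ _)
      fun z hz => mul_le_mul_of_nonneg_right hz.1 (hd z)

theorem capEnergy_nonneg {S : ℝ → ℝ} (hS : IsSaturation S) (q : ℝ) : 0 ≤ capEnergy S q := by
  have h := capEnergy_sub_le hS 0 q
  simp only [zero_mul] at h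
  have h0 : capEnergy S 0 = 0 := by simp [capEnergy]
  linarith

/-- Comparison with r = 0, since S varies by at most 1. This linear growth lets L² bounds on the
pressures control the capillary energy. -/
theorem capEnergy_le {S : ℝ → ℝ} (hS : IsSaturation S) (q : ℝ) : capEnergy S q ≤ |q| := by
  have h := capEnergy_sub_le hS q 0
  have h0 : capEnergy S 0 = 0 := by simp [capEnergy]
  have h1 : |S q - S 0| ≤ 1 := by
    have := hS.2.2 q; have := hS.2.2 0
    simp only [mem_Icc] at *
    rw [abs_le]; constructor <;> linarith
  have h2 : q * (S q - S 0) ≤ |q| * 1 :=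
    (le_abs_self _).trans (by rw [abs_mul]; exact mul_le_mul_of_nonneg_left h1 (abs_nonneg _))
  linarith

theorem sat_mem {S : ℝ → ℝ} (hS : IsSaturation S) (α : Phase) (q : ℝ) :
    sat S α q ∈ Icc (0 : ℝ) 1 := by
  have h := hS.2.2 q
  simp only [mem_Icc] at *
  cases α <;> simp only [sat] <;> constructor <;> linarith

theorem lipschitz_sat {S : ℝ → ℝ} (hS : IsSaturation S) (α : Phase) :
    ∃ L : ℝ≥0, LipschitzWith L (sat S α) := by
  obtain ⟨L, hL⟩ := hS.2.1
  refine ⟨L, ?_⟩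
  cases α
  · exact hL
  · refine LipschitzWith.of_dist_le_mul fun x y => ?_
    have := hL.dist_le_mul y x
    simp only [sat, Real.dist_eq] at *
    rw [show 1 - S x - (1 - S y) = S y - S x by ring, abs_sub_comm x y]
    exact this

/-! ### Geometry -/

section Geometry

variable {d : ℕ} (G : FracturedDomain d)

instance isFiniteMeasure_vol : IsFiniteMeasure G.vol :=
  ⟨by rw [FracturedDomain.vol, Measure.restrict_apply_univ]; exact G.polytopal.2.2.1.measure_lt_top⟩

theorem measurableSet_fracture (i : Fin G.num) : MeasurableSet (G.fracture i) :=
  ((G.chart i).isometry.isClosedEmbedding.measurableEmbedding).measurableSet_image.2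
    (G.shape_polytopal i).1.measurableSet

theorem measurableSet_Gamma : MeasurableSet G.Γ :=
  MeasurableSet.iUnion fun i => measurableSet_fracture G i

instance isFiniteMeasure_surf : IsFiniteMeasure G.surf := by
  refine ⟨?_⟩
  rw [FracturedDomain.surf, Measure.restrict_apply_univ, FracturedDomain.Γ]
  refine (measure_iUnion_le _).trans_lt ?_
  rw [tsum_fintype]
  refine ENNReal.sum_lt_top.2 fun i _ => ?_
  rw [FracturedDomain.fracture, (G.chart i).isometry.euclideanHausdorffMeasure_image,
    EuclideanSpace.euclideanHausdorffMeasure_eq_volume]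
  exact (G.shape_polytopal i).2.2.1.measure_lt_top

/-- The closed network lies in the finitely many ranges of the charts, which are closed affine
subspaces. None is the whole space: a chart onto ℝᵈ would have a surjective linear part starting
from dimension d − 1. -/
theorem volume_closure_Gamma (hd : 0 < d) : volume (closure G.Γ) = 0 := by
  have hsub : closure G.Γ ⊆ ⋃ i, range (G.chart i) := by
    refine closure_minimal ?_ ?_
    · exact iUnion_mono fun i => image_subset_range _ _
    · exact isClosed_iUnion_of_finite fun i => (G.chart i).isometry.isClosedEmbedding.isClosed_range
  refine measure_mono_null hsub (measure_iUnion_null fun i => ?_)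
  have h : range (G.chart i) =
      ((AffineSubspace.map (G.chart i).toAffineMap ⊤ : AffineSubspace ℝ (Vec d)) : Set (Vec d)) := by
    ext; simp
  rw [h]
  refine Measure.addHaar_affineSubspace _ _ fun htop => ?_
  have h1 : Function.Surjective (G.chart i).toAffineMap := by
    intro y
    have : y ∈ AffineSubspace.map (G.chart i).toAffineMap ⊤ := by rw [htop]; trivial
    simpa using this
  have h2 := (AffineMap.linear_surjective_iff _).2 h1
  have h3 := LinearMap.finrank_le_finrank_of_surjective h2
  simp at h3
  omega

end Geometry

/-! ### Piecewise constant functions -/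

section Reconstruction

variable {d : ℕ} {Q : Model d} (D : FlowGD Q)

theorem recM_of_mem {i : Fin D.n} {x : Vec d} (hx : x ∈ D.cellM i) (v : D.X) :
    D.recM v x = v i := by
  rw [FlowGD.recM, Finset.sum_eq_single i]
  · simp [hx]
  · intro j _ hj
    exact indicator_of_notMem (fun h => disjoint_left.1 (D.cellM_disjoint hj) h hx) _
  · simp

theorem recF_of_mem {i : Fin D.n} {x : Vec d} (hx : x ∈ D.cellF i) (v : D.X) :
    D.recF v x = v i := by
  rw [FlowGD.recF, Finset.sum_eq_single i]
  · simp [hx]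
  · intro j _ hj
    exact indicator_of_notMem (fun h => disjoint_left.1 (D.cellF_disjoint hj) h hx) _
  · simp

/-- At each point, either all reconstructions vanish, or there is a coordinate whose value they all
take. -/
theorem recM_cases (x : Vec d) : (∀ v, D.recM v x = 0) ∨ ∃ i, ∀ v, D.recM v x = v i := by
  by_cases h : ∃ i, x ∈ D.cellM i
  · obtain ⟨i, hi⟩ := h
    exact Or.inr ⟨i, recM_of_mem D hi⟩
  · refine Or.inl fun v => Finset.sum_eq_zero fun i _ => indicator_of_notMem (fun hi => h ⟨i, hi⟩) _

theorem recF_cases (x : Vec d) : (∀ v, D.recF v x = 0) ∨ ∃ i, ∀ v, D.recF v x = v i := by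
  by_cases h : ∃ i, x ∈ D.cellF i
  · obtain ⟨i, hi⟩ := h
    exact Or.inr ⟨i, recF_of_mem D hi⟩
  · refine Or.inl fun v => Finset.sum_eq_zero fun i _ => indicator_of_notMem (fun hi => h ⟨i, hi⟩) _

theorem recM_zero : D.recM 0 = 0 := by
  ext x; rcases recM_cases D x with h | ⟨i, h⟩ <;> simp [h]

theorem recF_zero : D.recF 0 = 0 := by
  ext x; rcases recF_cases D x with h | ⟨i, h⟩ <;> simp [h]

theorem recM_sub (v w : D.X) : D.recM (v - w) = D.recM v - D.recM w := by
  ext x; rcases recM_cases D x with h | ⟨i, h⟩ <;> simp [h]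

theorem measurable_recM (v : D.X) : Measurable (D.recM v) := by
  unfold FlowGD.recM
  exact Finset.measurable_sum _ fun i _ => measurable_const.indicator (D.cellM_meas i)

theorem measurable_recF (v : D.X) : Measurable (D.recF v) := by
  unfold FlowGD.recF
  exact Finset.measurable_sum _ fun i _ => measurable_const.indicator (D.cellF_meas i)

theorem abs_recM_le (v : D.X) (x : Vec d) : |D.recM v x| ≤ ‖v‖ := by
  rcases recM_cases D x with h | ⟨i, h⟩
  · simp [h]
  · rw [h]; exact norm_le_pi_norm v i

theorem abs_recF_le (v : D.X) (x : Vec d) : |D.recF v x| ≤ ‖v‖ := by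
  rcases recF_cases D x with h | ⟨i, h⟩
  · simp [h]
  · rw [h]; exact norm_le_pi_norm v i

theorem memLp_recM (v : D.X) (q : ℝ≥0∞) (μ : Measure (Vec d)) [IsFiniteMeasure μ] :
    MemLp (D.recM v) q μ :=
  MemLp.of_bound (measurable_recM D v).aestronglyMeasurable ‖v‖ (ae_of_all _ (abs_recM_le D v))

theorem memLp_recF (v : D.X) (q : ℝ≥0∞) (μ : Measure (Vec d)) [IsFiniteMeasure μ] :
    MemLp (D.recF v) q μ :=
  MemLp.of_bound (measurable_recF D v).aestronglyMeasurable ‖v‖ (ae_of_all _ (abs_recF_le D v))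

theorem memLp_gradM (v : D.X) : MemLp (D.gradM v) 2 Q.vol :=
  (D.gradM_mem v).mono_exponent le_top

end Reconstruction

/-! ### Time discretization -/

section Time

variable {T : ℝ} (τ : TimeGrid T)

theorem le_t_idx {s : ℝ} (hs : s ≤ T) : s ≤ τ.t (τ.idx s) := by
  have hne : {k | s ≤ τ.t k}.Nonempty := ⟨Fin.last _, by simpa [τ.t_last] using hs⟩
  exact hne.csInf_mem (toFinite _)

theorem t_lt_of_lt_idx {s : ℝ} {k : Fin (τ.N + 1)} (hk : k < τ.idx s) : τ.t k < s := by
  by_contra h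
  have hk' : k ∈ {k | s ≤ τ.t k} := not_lt.1 h
  have h1 : τ.idx s ≤ k := sInf_le hk'
  exact h1.not_gt hk

theorem idx_mono : Monotone τ.idx := fun _ _ h => sInf_le_sInf fun _ hk => h.trans hk

theorem measurable_idx : Measurable τ.idx := by
  refine measurable_to_countable' fun k => ?_
  refine OrdConnected.measurableSet ?_
  rw [show τ.idx ⁻¹' {k} = τ.idx ⁻¹' Icc k k by simp]
  exact ordConnected_Icc.preimage_mono (idx_mono τ)

theorem idx_eq_succ_iff {s : ℝ} (hs : s ∈ Ioo 0 T) (n : Fin τ.N) :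
    τ.idx s = n.succ ↔ s ∈ Ioc (τ.t n.castSucc) (τ.t n.succ) := by
  refine ⟨fun h => ⟨t_lt_of_lt_idx τ (h ▸ Fin.castSucc_lt_succ), h ▸ le_t_idx τ hs.2.le⟩,
    τ.idx_of_mem n⟩

theorem idx_ne_zero {s : ℝ} (hs : s ∈ Ioo 0 T) : τ.idx s ≠ 0 := fun h => by
  have := le_t_idx τ hs.2.le
  rw [h, τ.t_zero] at this
  exact hs.1.not_ge this

/-- The length of a time step. -/
def step (n : Fin τ.N) : ℝ := τ.t n.succ - τ.t n.castSucc

theorem step_pos (n : Fin τ.N) : 0 < step τ n := sub_pos.2 (τ.t_strictMono Fin.castSucc_lt_succ)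

theorem Ioc_subset (n : Fin τ.N) : Ioc (τ.t n.castSucc) (τ.t n.succ) ⊆ Ioc 0 T := by
  intro s hs
  refine ⟨lt_of_le_of_lt ?_ hs.1, hs.2.trans ?_⟩
  · exact τ.t_zero.symm.trans_le (τ.t_strictMono.monotone (Fin.zero_le _))
  · exact (τ.t_strictMono.monotone (Fin.le_last _)).trans_eq τ.t_last

theorem measureReal_idx_succ (n : Fin τ.N) :
    (volume.restrict (Ioo 0 T)).real (τ.idx ⁻¹' {n.succ}) = step τ n := by
  rw [measureReal_restrict_apply (measurable_idx τ (measurableSet_singleton _))]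
  have h : τ.idx ⁻¹' {n.succ} ∩ Ioo 0 T = Ioc (τ.t n.castSucc) (τ.t n.succ) ∩ Ioo 0 T := by
    ext s
    constructor
    · rintro ⟨h1, h2⟩; exact ⟨(idx_eq_succ_iff τ h2 n).1 h1, h2⟩
    · rintro ⟨h1, h2⟩; exact ⟨(idx_eq_succ_iff τ h2 n).2 h1, h2⟩
  rw [h, measureReal_congr (ae_eq_set_inter (ae_eq_refl (Ioc (τ.t n.castSucc) (τ.t n.succ)))
    (Ioo_ae_eq_Ioc (a := (0 : ℝ)) (b := T))),
    inter_eq_left.2 (Ioc_subset τ n), Real.volume_real_Ioc_of_le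
      (τ.t_strictMono.monotone Fin.castSucc_lt_succ.le), step]

/-- On (0,T) the index is never 0, so the conventional value of `TimeGrid.δ` at index 0 never enters
an integral. -/
theorem measureReal_idx_zero : (volume.restrict (Ioo 0 T)).real (τ.idx ⁻¹' {0}) = 0 := by
  rw [measureReal_restrict_apply (measurable_idx τ (measurableSet_singleton _))]
  have h : τ.idx ⁻¹' {0} ∩ Ioo 0 T = ∅ := by
    ext s
    simp only [mem_inter_iff, mem_preimage, mem_singleton_iff, mem_empty_iff_false, iff_false,
      not_and]
    exact fun h1 h2 => idx_ne_zero τ h2 h1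
  simp [h]

/-- The image of Lebesgue measure under `idx` is atomic: the index n + 1 has the mass of the n-th
step, and the index 0 has none. -/
theorem integral_idx (F : Fin (τ.N + 1) → ℝ) :
    ∫ s in Ioo 0 T, F (τ.idx s) = ∑ n, step τ n * F n.succ := by
  have h1 := integral_map (μ := volume.restrict (Ioo 0 T)) (measurable_idx τ).aemeasurable
    (f := F) (measurable_of_finite F).aestronglyMeasurable
  rw [← h1, integral_fintype .of_finite, Fin.sum_univ_succ]
  simp only [map_measureReal_apply (measurable_idx τ) (measurableSet_singleton _),
    measureReal_idx_succ, measureReal_idx_zero, smul_eq_mul, zero_mul, zero_add]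

/-- Every time step has positive length, so it cannot lie in a null set. This converts bounds valid
almost everywhere in space-time into bounds at each positive index. -/
theorem exists_idx_eq_succ_of_ae {P : ℝ → Prop} (h : ∀ᵐ s ∂volume.restrict (Ioo 0 T), P s)
    (n : Fin τ.N) : ∃ s, τ.idx s = n.succ ∧ P s := by
  by_contra hcon
  push Not at hcon
  have h0 : (volume.restrict (Ioo 0 T)) (τ.idx ⁻¹' {n.succ}) = 0 :=
    measure_mono_null (fun s hs => hcon s hs) h
  have := measureReal_idx_succ τ n
  rw [measureReal_def, h0] at this
  exact (step_pos τ n).ne this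

theorem ae_of_ae_prod_idx {X : Type*} [MeasurableSpace X] {ν : Measure X} [SFinite ν]
    {P : Fin (τ.N + 1) → X → Prop}
    (h : ∀ᵐ z ∂(volume.restrict (Ioo 0 T)).prod ν, P (τ.idx z.1) z.2) (n : Fin τ.N) :
    ∀ᵐ x ∂ν, P n.succ x := by
  obtain ⟨s, hs, h'⟩ := exists_idx_eq_succ_of_ae τ (Measure.ae_ae_of_ae_prod h) n
  simpa [hs] using h'

end Time

/-! ### Bounds on the data -/

section Data

variable {d : ℕ} (Q : Model d)

/-- Ellipticity only bounds the quadratic form. The bilinear bound is Cauchy–Schwarz for a symmetric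
nonnegative form, read off from the discriminant of r ↦ K(ξ + rζ)·(ξ + rζ). -/
theorem exists_permeability_bounds : ∃ lo hi : ℝ, 0 < lo ∧ 0 ≤ hi ∧ ∀ᵐ x ∂Q.vol,
    (∀ ξ, lo * ‖ξ‖ ^ 2 ≤ inner ℝ (Q.K x ξ) ξ) ∧
      ∀ ξ ζ, |inner ℝ (Q.K x ξ) ζ| ≤ hi * (‖ξ‖ * ‖ζ‖) := by
  obtain ⟨lo, hi, hlo, h⟩ := Q.K_elliptic
  refine ⟨lo, |hi|, hlo, abs_nonneg _, ?_⟩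
  filter_upwards [h, Q.K_symm] with x hx hs
  refine ⟨fun ξ => (hx ξ).1, fun ξ ζ => ?_⟩
  have key : ∀ ξ ζ, inner ℝ (Q.K x ξ) ζ ^ 2 ≤ inner ℝ (Q.K x ξ) ξ * inner ℝ (Q.K x ζ) ζ := by
    intro ξ ζ
    have hq : ∀ r : ℝ, 0 ≤ inner ℝ (Q.K x ζ) ζ * (r * r) + (2 * inner ℝ (Q.K x ξ) ζ) * r
        + inner ℝ (Q.K x ξ) ξ := by
      intro r
      have h0 : 0 ≤ inner ℝ (Q.K x (ξ + r • ζ)) (ξ + r • ζ) :=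
        (by positivity : 0 ≤ lo * ‖ξ + r • ζ‖ ^ 2).trans (hx _).1
      have hsym : inner ℝ (Q.K x ζ) ξ = inner ℝ (Q.K x ξ) ζ := by
        rw [hs, real_inner_comm]
      simp only [map_add, map_smul, inner_add_left, inner_add_right, inner_smul_left,
        inner_smul_right, hsym, conj_trivial] at h0
      linarith
    have := discrim_le_zero hq
    rw [discrim] at this
    linarith
  have hup : ∀ ξ, inner ℝ (Q.K x ξ) ξ ≤ |hi| * ‖ξ‖ ^ 2 := fun ξ =>
    (hx ξ).2.trans (mul_le_mul_of_nonneg_right (le_abs_self _) (by positivity))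
  have hlow : ∀ ξ, 0 ≤ inner ℝ (Q.K x ξ) ξ := fun ξ =>
    (by positivity : 0 ≤ lo * ‖ξ‖ ^ 2).trans (hx _).1
  refine abs_le_of_sq_le_sq ?_ (by positivity)
  calc _ ≤ inner ℝ (Q.K x ξ) ξ * inner ℝ (Q.K x ζ) ζ := key ξ ζ
    _ ≤ (|hi| * ‖ξ‖ ^ 2) * (|hi| * ‖ζ‖ ^ 2) :=
      mul_le_mul (hup _) (hup _) (hlow _) (by positivity)
    _ = _ := by ring

theorem aestronglyMeasurable_permeability {g : Vec d → Vec d} (hg : AEStronglyMeasurable g Q.vol) :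
    AEStronglyMeasurable (fun x => Q.K x (g x)) Q.vol :=
  isBoundedBilinearMap_apply.continuous.comp_aestronglyMeasurable (Q.K_meas.prodMk hg)

/-- The mobility is continuous on [0,1] only, so it is replaced by its extension by constants, which
agrees with it on the range of g. -/
theorem measurable_mobility {X : Type*} [MeasurableSpace X] {η : ℝ → ℝ} (hη : IsMobility η)
    {g : X → ℝ} (hg : Measurable g) (h01 : ∀ x, g x ∈ Icc (0 : ℝ) 1) :
    Measurable fun x => η (g x) := by
  have hc : Continuous (IccExtend (zero_le_one (α := ℝ)) ((Icc (0 : ℝ) 1).domRestrict η)) :=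
    hη.1.domRestrict.Icc_extend'
  have h := hc.measurable.comp hg
  convert h using 2 with x
  exact (IccExtend_of_mem zero_le_one ((Icc (0 : ℝ) 1).domRestrict η) (h01 x)).symm

end Data

/-! ### Integrability of the terms of the scheme -/

section Integrability

variable {d : ℕ} {Q : Model d} {D : FlowGD Q} {E : MechGD Q}
  (p : FlowUnknown D) (u : MechUnknown D E)

theorem sM_mem (α : Phase) (k) (i : Fin D.n) : sM p α k i ∈ Icc (0 : ℝ) 1 := sat_mem Q.Sm_sat _ _

theorem sF_mem (α : Phase) (k) (i : Fin D.n) : sF p α k i ∈ Icc (0 : ℝ) 1 := sat_mem Q.Sf_sat _ _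

theorem recM_sM_mem (α : Phase) (k) (x : Vec d) : D.recM (sM p α k) x ∈ Icc (0 : ℝ) 1 := by
  rcases recM_cases D x with h | ⟨i, h⟩
  · simp [h]
  · rw [h]; exact sM_mem p α k i

theorem recF_sF_mem (α : Phase) (k) (x : Vec d) : D.recF (sF p α k) x ∈ Icc (0 : ℝ) 1 := by
  rcases recF_cases D x with h | ⟨i, h⟩
  · simp [h]
  · rw [h]; exact sF_mem p α k i

theorem tr_eq_inner {n : ℕ} (A : Tens n) : tr A = inner ℝ (idTens n) A := by
  simp only [tr, idTens, PiLp.inner_apply, Fintype.sum_prod_type]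
  refine Finset.sum_congr rfl fun i _ => ?_
  rw [Finset.sum_eq_single i]
  · simp
  · intro j _ hj; simp [hj.symm]
  · simp

theorem memLp_div (v : E.X) : MemLp (E.div v) 2 Q.vol := by
  have h := (innerSL ℝ (idTens d)).comp_memLp' (E.ε_mem v)
  refine h.ae_eq (ae_of_all _ fun x => ?_)
  simp [MechGD.div, tr_eq_inner]

theorem l2_div_le (v : E.X) : l2 Q.vol (E.div v) ≤ ‖idTens d‖ * E.nrm v := by
  have h := l2_le_of_ae_le (μ := Q.vol) (f := E.div v) ((E.ε_mem v).const_smul ‖idTens d‖)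
    (ae_of_all _ fun x => by
      rw [MechGD.div, tr_eq_inner]
      refine (norm_inner_le_norm _ _).trans ?_
      simp [norm_smul])
  rwa [l2_smul, abs_of_nonneg (norm_nonneg _)] at h

theorem memLp_σ (v : E.X) : MemLp (E.σ v) 2 Q.vol := by
  have h1 := (E.ε_mem v).const_smul (2 * Q.mu)
  have h2 := (ContinuousLinearMap.smulRight (1 : ℝ →L[ℝ] ℝ) (idTens d)).comp_memLp'
    ((memLp_div v).const_smul Q.lam)
  refine (h1.add h2).ae_eq (ae_of_all _ fun x => ?_)
  simp [MechGD.σ]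

theorem inner_σ (v w : E.X) (x : Vec d) : inner ℝ (E.σ v x) (E.ε w x) =
    2 * Q.mu * inner ℝ (E.ε v x) (E.ε w x) + Q.lam * (E.div v x * E.div w x) := by
  rw [MechGD.σ, inner_add_left, inner_smul_left, inner_smul_left, ← tr_eq_inner]
  simp [MechGD.div]
  ring

theorem memLp_porosity (k) : MemLp (porosity p u k) 2 Q.vol :=
  ((memLp_recM D _ 2 Q.vol).add ((memLp_div (E := E) (u k - u 0)).const_mul Q.b)).add
    ((memLp_recM D (pEM p k - pEM p 0) 2 Q.vol).const_mul (1 / Q.M))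

theorem memLp_porosity_mul (k) (v : D.X) :
    MemLp (fun x => porosity p u k x * D.recM v x) 2 Q.vol :=
  (memLp_recM D v ∞ Q.vol).mul' (memLp_porosity p u k)

theorem memLp_jump (v : E.X) : MemLp (E.jump v) 2 Q.surf := (E.jump_mem v).mono_exponent (by norm_num)

theorem memLp_aperture (k) : MemLp (aperture u k) 2 Q.surf := (memLp_jump (u k)).neg

theorem memLp_aperture_mul (k) (v : D.X) :
    MemLp (fun x => aperture u k x * D.recF v x) 2 Q.surf :=
  (memLp_recF D v ∞ Q.surf).mul' (memLp_aperture u k)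

theorem integrable_aperture_pow (k) : Integrable (fun x => aperture u k x ^ 3) Q.surf := by
  have h4 : MemLp (aperture u k) 3 Q.surf :=
    MemLp.mono_exponent (q := 4) (E.jump_mem (u k)).neg (by norm_num)
  have h := h4.integrable_norm_pow (by norm_num)
  exact h.mono (h4.1.pow 3) (ae_of_all _ fun x => by simp)

theorem integrable_matrix_flux {η : ℝ → ℝ} (hη : IsMobility η) (α : Phase) (k) (v w : D.X) :
    Integrable (fun x => η (D.recM (sM p α k) x) * inner ℝ (Q.K x (D.gradM v x)) (D.gradM w x))
      Q.vol := by
  obtain ⟨lo, hi, -, hhi, hK⟩ := exists_permeability_bounds Q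
  obtain ⟨-, -, a, b, ha, hab⟩ := id hη
  have hm := measurable_mobility hη (measurable_recM D (sM p α k)) (recM_sM_mem p α k)
  have hint : Integrable (fun x => inner ℝ (Q.K x (D.gradM v x)) (D.gradM w x)) Q.vol := by
    refine ((integrable_norm_mul_norm (memLp_gradM D v) (memLp_gradM D w)).const_mul hi).mono'
      ((aestronglyMeasurable_permeability Q (memLp_gradM D v).1).inner (memLp_gradM D w).1) ?_
    filter_upwards [hK] with x hx using hx.2 _ _
  refine hint.bdd_mul hm.aestronglyMeasurable (c := b) (ae_of_all _ fun x => ?_)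
  have h1 := hab _ (recM_sM_mem p α k x)
  rw [Real.norm_of_nonneg (ha.le.trans h1.1)]
  exact h1.2

/-- The cubed aperture enters as an integrable function (the jump is in L⁴), so the discrete
fracture gradients are used through their L^∞ bounds. -/
theorem integrable_fracture_flux {η : ℝ → ℝ} (hη : IsMobility η) (α : Phase) (k) (v w : D.X) :
    Integrable (fun x => η (D.recF (sF p α k) x) * (aperture u k x ^ 3 / 12)
      * inner ℝ (D.gradF v x) (D.gradF w x)) Q.surf := by
  obtain ⟨-, -, a, b, ha, hab⟩ := id hη
  have hm := measurable_mobility hη (measurable_recF D (sF p α k)) (recF_sF_mem p α k)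
  have h1 : Integrable (fun x => η (D.recF (sF p α k) x) * (aperture u k x ^ 3 / 12)) Q.surf := by
    refine ((integrable_aperture_pow u k).div_const 12).bdd_mul hm.aestronglyMeasurable (c := b)
      (ae_of_all _ fun x => ?_)
    have h1 := hab _ (recF_sF_mem p α k x)
    rw [Real.norm_of_nonneg (ha.le.trans h1.1)]
    exact h1.2
  have hv := D.gradF_mem v
  have hw := D.gradF_mem w
  have h2 : ∀ᵐ x ∂Q.surf, ‖inner ℝ (D.gradF v x) (D.gradF w x)‖ ≤
      (eLpNorm (D.gradF v) ∞ Q.surf).toReal * (eLpNorm (D.gradF w) ∞ Q.surf).toReal := by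
    filter_upwards [ae_le_eLpNormEssSup (f := D.gradF v) (μ := Q.surf),
      ae_le_eLpNormEssSup (f := D.gradF w) (μ := Q.surf)] with x h1 h2
    refine (norm_inner_le_norm _ _).trans (mul_le_mul ?_ ?_ (norm_nonneg _) ENNReal.toReal_nonneg)
    · rw [← toReal_enorm]
      exact ENNReal.toReal_mono hv.2.ne (by rwa [eLpNorm_exponent_top])
    · rw [← toReal_enorm]
      exact ENNReal.toReal_mono hw.2.ne (by rwa [eLpNorm_exponent_top])
  exact h1.mul_bdd (hv.1.inner hw.1) h2

end Integrability

/-! ### The scheme at one time step -/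

section Source

variable {X : Type*} [MeasurableSpace X] {τ : Measure ℝ} [IsFiniteMeasure τ] {ν : Measure X}
  [IsFiniteMeasure ν]

theorem memLp_comp_snd {g : X → ℝ} (hg : MemLp g 2 ν) :
    MemLp (fun z : ℝ × X => g z.2) 2 (τ.prod ν) := hg.comp_snd τ

theorem l2_comp_snd {g : X → ℝ} (hg : MemLp g 2 ν) :
    l2 (τ.prod ν) (fun z : ℝ × X => g z.2) = Real.sqrt (τ.real univ) * l2 ν g := by
  have h := l2_sq (memLp_comp_snd (τ := τ) hg)
  have h1 : ∫ z, ‖g z.2‖ ^ 2 ∂(τ.prod ν) = τ.real univ * ∫ x, ‖g x‖ ^ 2 ∂ν := by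
    have := integral_prod_mul (μ := τ) (ν := ν) (fun _ : ℝ => (1 : ℝ)) (fun x => ‖g x‖ ^ 2)
    simpa using this
  rw [h1, ← l2_sq hg] at h
  rw [← Real.sqrt_sq (l2_nonneg _), h, Real.sqrt_mul measureReal_nonneg, Real.sqrt_sq (l2_nonneg _)]

theorem abs_iterated_integral_le {h : ℝ × X → ℝ} (hh : MemLp h 2 (τ.prod ν)) {g : X → ℝ}
    (hg : MemLp g 2 ν) :
    |∫ s, ∫ x, h (s, x) * g x ∂ν ∂τ| ≤
      Real.sqrt (τ.real univ) * l2 (τ.prod ν) h * l2 ν g := by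
  have h2 := memLp_comp_snd (τ := τ) hg
  have h1 := integral_prod (μ := τ) (ν := ν) (fun z => h z * g z.2) (hh.integrable_mul h2)
  simp only at h1
  rw [← h1]
  refine (abs_integral_mul_le hh h2).trans (le_of_eq ?_)
  rw [l2_comp_snd hg]
  ring

/-- Squared L² norms add over disjoint slabs. This makes the source contributions of the time steps
square summable, uniformly in the grid. -/
theorem sum_sq_l2_restrict_le {ι : Type*} [Fintype ι] {A : ι → Set ℝ}
    (hA : ∀ i, MeasurableSet (A i)) (hdisj : Pairwise (Function.onFun Disjoint A))
    {h : ℝ × X → ℝ} (hh : MemLp h 2 (τ.prod ν)) :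
    ∑ i, l2 ((τ.restrict (A i)).prod ν) h ^ 2 ≤ l2 (τ.prod ν) h ^ 2 := by
  have hr : ∀ i, (τ.restrict (A i)).prod ν = (τ.prod ν).restrict (A i ×ˢ univ) := fun i => by
    rw [← Measure.prod_restrict, Measure.restrict_univ]
  have hint : Integrable (fun z => ‖h z‖ ^ 2) (τ.prod ν) := hh.integrable_norm_pow (by norm_num)
  simp only [hr]
  simp_rw [fun i => l2_sq (hh.restrict (A i ×ˢ univ)), l2_sq hh]
  rw [← integral_iUnion_fintype (fun i => (hA i).prod MeasurableSet.univ)]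
  · exact setIntegral_le_integral hint (ae_of_all _ fun _ => by positivity)
  · intro i j hij
    exact Disjoint.set_prod_left (hdisj hij) _ _
  · exact fun i => hint.integrableOn

end Source

/-! ### Testing the scheme on a single time step -/

section Step

variable {d : ℕ} {Q : Model d} {D : FlowGD Q} {E : MechGD Q}
  (p : FlowUnknown D) (u : MechUnknown D E)

/-- The preimage of a time step under the time index. -/
def slab (τ : TimeGrid Q.T) (n : Fin τ.N) : Set ℝ := τ.idx ⁻¹' {n.succ}

theorem measurableSet_slab (τ : TimeGrid Q.T) (n : Fin τ.N) : MeasurableSet (slab τ n) :=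
  measurable_idx τ (measurableSet_singleton _)

/-- The source terms of the flow equation, tested on one time step with `v`. -/
def source (D : FlowGD Q) (α : Phase) (n : Fin D.grid.N) (v : D.X) : ℝ :=
  (∫ s in slab D.grid n, ∫ x, Q.hm α (s, x) * D.recM v x ∂Q.vol ∂Q.time)
    + ∫ s in slab D.grid n, ∫ x, Q.hf α (s, x) * D.recF v x ∂Q.surf ∂Q.time

instance isFiniteMeasure_time : IsFiniteMeasure Q.time := by
  unfold Model.time; infer_instance

theorem measureReal_time_slab (τ : TimeGrid Q.T) (n : Fin τ.N) :
    (Q.time.restrict (slab τ n)).real univ = step τ n := by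
  rw [measureReal_restrict_apply_univ]
  exact measureReal_idx_succ τ n

/-- The size of the source terms on one time step. -/
def sourceNormM (D : FlowGD Q) (α : Phase) (n : Fin D.grid.N) : ℝ :=
  l2 ((Q.time.restrict (slab D.grid n)).prod Q.vol) (Q.hm α)

/-- The size of the fracture source terms on one time step. -/
def sourceNormF (D : FlowGD Q) (α : Phase) (n : Fin D.grid.N) : ℝ :=
  l2 ((Q.time.restrict (slab D.grid n)).prod Q.surf) (Q.hf α)

theorem pairwise_disjoint_slab (τ : TimeGrid Q.T) :
    Pairwise (Function.onFun Disjoint (slab τ)) := by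
  intro i j hij
  refine Disjoint.preimage _ ?_
  simpa using hij

theorem sum_sq_sourceNormM_le (D : FlowGD Q) (α : Phase) :
    ∑ n, sourceNormM D α n ^ 2 ≤ l2 (Q.time.prod Q.vol) (Q.hm α) ^ 2 :=
  sum_sq_l2_restrict_le (measurableSet_slab D.grid) (pairwise_disjoint_slab D.grid) (Q.hm_mem α)

theorem sum_sq_sourceNormF_le (D : FlowGD Q) (α : Phase) :
    ∑ n, sourceNormF D α n ^ 2 ≤ l2 (Q.time.prod Q.surf) (Q.hf α) ^ 2 :=
  sum_sq_l2_restrict_le (measurableSet_slab D.grid) (pairwise_disjoint_slab D.grid) (Q.hf_mem α)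

/-- Cauchy–Schwarz on the slab. As v does not depend on time, its space-time norm is its spatial
norm times the square root of the step. -/
theorem abs_source_le (α : Phase) (n : Fin D.grid.N) (v : D.X) :
    |source D α n v| ≤ √(step D.grid n) * sourceNormM D α n * l2 Q.vol (D.recM v)
      + √(step D.grid n) * sourceNormF D α n * l2 Q.surf (D.recF v) := by
  have hr : ∀ ν : Measure (Vec d), IsFiniteMeasure ν →
      (Q.time.restrict (slab D.grid n)).prod ν ≤ Q.time.prod ν := by
    intro ν _
    conv_lhs => rw [← Measure.restrict_univ (μ := ν), Measure.prod_restrict]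
    exact Measure.restrict_le_self
  refine (abs_add_le _ _).trans (add_le_add ?_ ?_)
  · have h := abs_iterated_integral_le (τ := Q.time.restrict (slab D.grid n)) (ν := Q.vol)
      ((Q.hm_mem α).mono_measure (hr _ inferInstance)) (memLp_recM D v 2 Q.vol)
    rwa [measureReal_time_slab] at h
  · have h := abs_iterated_integral_le (τ := Q.time.restrict (slab D.grid n)) (ν := Q.surf)
      ((Q.hf_mem α).mono_measure (hr _ inferInstance)) (memLp_recF D v 2 Q.surf)
    rwa [measureReal_time_slab] at h

variable {p u}

/-- The test function is v at index n + 1 and 0 elsewhere. The length of the slab cancels the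
quotient in the discrete time derivative and remains as a factor of the fluxes. -/
theorem flow_step {α : Phase} (h : FlowEquation p u α) (n : Fin D.grid.N) (v : D.X) :
    (∫ x, (porosity p u n.succ x * D.recM (sM p α n.succ) x
        - porosity p u n.castSucc x * D.recM (sM p α n.castSucc) x) * D.recM v x ∂Q.vol)
      + step D.grid n * (∫ x, Q.ηm α (D.recM (sM p α n.succ) x)
          * inner ℝ (Q.K x (D.gradM (p α n.succ) x)) (D.gradM v x) ∂Q.vol)
      + (∫ x, (aperture u n.succ x * D.recF (sF p α n.succ) x
        - aperture u n.castSucc x * D.recF (sF p α n.castSucc) x) * D.recF v x ∂Q.surf)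
      + step D.grid n * (∫ x, Q.ηf α (D.recF (sF p α n.succ) x) * (aperture u n.succ x ^ 3 / 12)
          * inner ℝ (D.gradF (p α n.succ) x) (D.gradF v x) ∂Q.surf)
      = source D α n v := by
  classical
  set φ : Fin (D.grid.N + 1) → D.X := fun k => if k = n.succ then v else 0 with hφ
  have hφn : φ n.succ = v := by simp [hφ]
  have hφ0 : ∀ m : Fin D.grid.N, m ≠ n → φ m.succ = 0 := fun m hm => by simp [hφ, hm]
  let G1 : Fin (D.grid.N + 1) → ℝ := fun k => ∫ x,
        (D.grid.δ (fun k x => porosity p u k x * D.recM (sM p α k) x) k x * D.recM (φ k) x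
          + Q.ηm α (D.recM (sM p α k) x)
            * inner ℝ (Q.K x (D.gradM (p α k) x)) (D.gradM (φ k) x)) ∂Q.vol
  let G2 : Fin (D.grid.N + 1) → ℝ := fun k => ∫ x,
      D.grid.δ (fun k x => aperture u k x * D.recF (sF p α k) x) k x * D.recF (φ k) x ∂Q.surf
  let G3 : Fin (D.grid.N + 1) → ℝ := fun k => ∫ x,
      Q.ηf α (D.recF (sF p α k) x) * (aperture u k x ^ 3 / 12)
        * inner ℝ (D.gradF (p α k) x) (D.gradF (φ k) x) ∂Q.surf
  have key : (∫ s in Ioo 0 Q.T, G1 (D.grid.idx s)) + (∫ s in Ioo 0 Q.T, G2 (D.grid.idx s))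
      + (∫ s in Ioo 0 Q.T, G3 (D.grid.idx s)) =
      (∫ s, ∫ x, Q.hm α (s, x) * D.recM (φ (D.grid.idx s)) x ∂Q.vol ∂Q.time)
      + ∫ s, ∫ x, Q.hf α (s, x) * D.recF (φ (D.grid.idx s)) x ∂Q.surf ∂Q.time := h φ
  have hsrcM : ∫ s, ∫ x, Q.hm α (s, x) * D.recM (φ (D.grid.idx s)) x ∂Q.vol ∂Q.time =
      ∫ s in slab D.grid n, ∫ x, Q.hm α (s, x) * D.recM v x ∂Q.vol ∂Q.time := by
    rw [← integral_indicator (measurableSet_slab D.grid n)]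
    congr 1 with s
    by_cases hs : D.grid.idx s = n.succ
    · rw [indicator_of_mem (show s ∈ slab D.grid n from hs), hs, hφn]
    · rw [indicator_of_notMem (show s ∉ slab D.grid n from hs)]
      simp [hφ, hs, recM_zero]
  have hsrcF : ∫ s, ∫ x, Q.hf α (s, x) * D.recF (φ (D.grid.idx s)) x ∂Q.surf ∂Q.time =
      ∫ s in slab D.grid n, ∫ x, Q.hf α (s, x) * D.recF v x ∂Q.surf ∂Q.time := by
    rw [← integral_indicator (measurableSet_slab D.grid n)]
    congr 1 with s
    by_cases hs : D.grid.idx s = n.succ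
    · rw [indicator_of_mem (show s ∈ slab D.grid n from hs), hs, hφn]
    · rw [indicator_of_notMem (show s ∉ slab D.grid n from hs)]
      simp [hφ, hs, recF_zero]
  have hδ : ∀ {V : Type} [AddCommGroup V] [Module ℝ V] (f : Fin (D.grid.N + 1) → V),
      D.grid.δ f n.succ = (step D.grid n)⁻¹ • (f n.succ - f n.castSucc) := fun f => rfl
  have hstep := step_pos D.grid n
  rw [hsrcM, hsrcF, integral_idx, integral_idx, integral_idx, Finset.sum_eq_single n,
    Finset.sum_eq_single n, Finset.sum_eq_single n] at key
  rotate_left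
  · intro m _ hm; simp [G3, hφ0 m hm]
  · simp
  · intro m _ hm; simp [G2, hφ0 m hm, recF_zero]
  · simp
  · intro m _ hm; simp [G1, hφ0 m hm, recM_zero]
  · simp
  have e1 : G1 n.succ = (step D.grid n)⁻¹ * (∫ x,
      (porosity p u n.succ x * D.recM (sM p α n.succ) x
        - porosity p u n.castSucc x * D.recM (sM p α n.castSucc) x) * D.recM v x ∂Q.vol)
      + ∫ x, Q.ηm α (D.recM (sM p α n.succ) x)
          * inner ℝ (Q.K x (D.gradM (p α n.succ) x)) (D.gradM v x) ∂Q.vol := by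
    rw [← integral_const_mul, ← integral_add]
    · simp only [G1, hδ, hφn, Pi.smul_apply, Pi.sub_apply, smul_eq_mul, mul_assoc]
    · exact (((memLp_porosity_mul p u _ _).sub (memLp_porosity_mul p u _ _)).integrable_mul
        (memLp_recM D v 2 Q.vol)).const_mul _
    · exact integrable_matrix_flux p (Q.ηm_mob α) _ _ _ _
  have e2 : G2 n.succ = (step D.grid n)⁻¹ * (∫ x,
      (aperture u n.succ x * D.recF (sF p α n.succ) x
        - aperture u n.castSucc x * D.recF (sF p α n.castSucc) x) * D.recF v x ∂Q.surf) := by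
    rw [← integral_const_mul]
    simp only [G2, hδ, hφn, Pi.smul_apply, Pi.sub_apply, smul_eq_mul, mul_assoc]
  have e3 : G3 n.succ = ∫ x, Q.ηf α (D.recF (sF p α n.succ) x) * (aperture u n.succ x ^ 3 / 12)
          * inner ℝ (D.gradF (p α n.succ) x) (D.gradF v x) ∂Q.surf := by
    simp only [G3, hφn]
  rw [e1, e2, e3] at key
  rw [source, ← key]
  field_simp

theorem mech_step (h : MechEquation p u) (n : Fin D.grid.N) (v : E.X) :
    (∫ x, (inner ℝ (E.σ (u n.succ) x) (E.ε v x)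
        - Q.b * D.recM (pEM p n.succ) x * E.div v x) ∂Q.vol)
      + (∫ x, D.recF (pEF p n.succ) x * E.jump v x ∂Q.surf)
    = ∫ x, inner ℝ (Q.f x) (E.recon v x) ∂Q.vol := by
  classical
  set φ : Fin (D.grid.N + 1) → E.X := fun k => if k = n.succ then v else 0 with hφ
  have hφn : φ n.succ = v := by simp [hφ]
  have hφ0 : ∀ m : Fin D.grid.N, m ≠ n → φ m.succ = 0 := fun m hm => by simp [hφ, hm]
  let G1 : Fin (D.grid.N + 1) → ℝ := fun k => ∫ x,
        (inner ℝ (E.σ (u k) x) (E.ε (φ k) x)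
          - Q.b * D.recM (pEM p k) x * E.div (φ k) x) ∂Q.vol
  let G2 : Fin (D.grid.N + 1) → ℝ := fun k => ∫ x,
      D.recF (pEF p k) x * E.jump (φ k) x ∂Q.surf
  let G3 : Fin (D.grid.N + 1) → ℝ := fun k => ∫ x, inner ℝ (Q.f x) (E.recon (φ k) x) ∂Q.vol
  have key : (∫ s in Ioo 0 Q.T, G1 (D.grid.idx s)) + (∫ s in Ioo 0 Q.T, G2 (D.grid.idx s))
      = ∫ s in Ioo 0 Q.T, G3 (D.grid.idx s) := h φ
  rw [integral_idx, integral_idx, integral_idx, Finset.sum_eq_single n,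
    Finset.sum_eq_single n, Finset.sum_eq_single n, ← mul_add] at key
  · have := mul_left_cancel₀ (step_pos D.grid n).ne' key
    simpa only [G1, G2, G3, hφn] using this
  · intro m _ hm; simp [G3, hφ0 m hm]
  · simp
  · intro m _ hm; simp [G2, hφ0 m hm]
  · simp
  · intro m _ hm; simp [G1, hφ0 m hm, MechGD.div, tr]
  · simp

end Step

/-! ### The energy of a discrete solution -/

theorem sum_succ_sub_castSucc {m : ℕ} (f : Fin (m + 1) → ℝ) :
    ∑ n : Fin m, (f n.succ - f n.castSucc) = f (Fin.last m) - f 0 := by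
  induction m with
  | zero => simp
  | succ m ih =>
    rw [Fin.sum_univ_castSucc]
    have := ih fun k => f k.castSucc
    simp only [Fin.succ_castSucc, Fin.succ_last, Fin.castSucc_zero] at this ⊢
    rw [this]; ring

section Energy

variable {d : ℕ} {Q : Model d} {D : FlowGD Q} {E : MechGD Q}
  (p : FlowUnknown D) (u : MechUnknown D E)

/-- Capillary energy density of the matrix, as a discrete unknown. -/
def capM (k : Fin (D.grid.N + 1)) : D.X := fun i => capEnergy Q.Sm (pc p k i)

/-- Capillary energy density of the fractures, as a discrete unknown. -/
def capF (k : Fin (D.grid.N + 1)) : D.X := fun i => capEnergy Q.Sf (pc p k i)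

/-- Energy density in the matrix. -/
def densM (k : Fin (D.grid.N + 1)) (x : Vec d) : ℝ :=
  porosity p u k x * D.recM (capM p k) x + 1 / (2 * Q.M) * (D.recM (pEM p k) x * D.recM (pEM p k) x)
    + 1 / 2 * inner ℝ (E.σ (u k) x) (E.ε (u k) x) - inner ℝ (Q.f x) (E.recon (u k) x)

/-- Energy density in the fractures. -/
def densF (k : Fin (D.grid.N + 1)) (x : Vec d) : ℝ := aperture u k x * D.recF (capF p k) x

/-- Total energy. -/
def energy (k : Fin (D.grid.N + 1)) : ℝ := ∫ x, densM p u k x ∂Q.vol + ∫ x, densF p u k x ∂Q.surf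

theorem porosity_sub (k j) (x : Vec d) : porosity p u k x - porosity p u j x =
    Q.b * E.div (u k - u j) x + 1 / Q.M * (D.recM (pEM p k) x - D.recM (pEM p j) x) := by
  simp only [porosity, recM_sub, MechGD.div, tr, map_sub, Pi.sub_apply, PiLp.sub_apply,
    Finset.sum_sub_distrib]
  ring

theorem aperture_sub (k j) (x : Vec d) :
    aperture u k x - aperture u j x = -E.jump (u k - u j) x := by
  simp only [aperture, map_sub, Pi.sub_apply]; ring

/-- The difference of the two sides is φ' times the gap in `capEnergy_sub_le` at a − c and a' − c'.
It is a discrete product rule: the factor of φ − φ' is the equivalent pressure, which is how that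
pressure enters the energy balance. -/
theorem saturation_product_le {S : ℝ → ℝ} (hS : IsSaturation S) {a c a' c' φ φ' : ℝ}
    (hφ' : 0 ≤ φ') :
    φ * capEnergy S (a - c) - φ' * capEnergy S (a' - c')
      + (φ - φ') * (a * S (a - c) + c * (1 - S (a - c)) - capEnergy S (a - c)) ≤
    (φ * S (a - c) - φ' * S (a' - c')) * a
      + (φ * (1 - S (a - c)) - φ' * (1 - S (a' - c'))) * c := by
  have h := mul_le_mul_of_nonneg_left (capEnergy_sub_le hS (a - c) (a' - c')) hφ'
  linarith

/-- The porosity increment is b times the divergence increment plus 1/M times the pressure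
increment. Multiplied by p^E, the first part is the coupling term of the mechanical equation and the
second dominates the increment of (p^E)²/(2M). -/
theorem densM_sub_le (k j) {x : Vec d} (hx : 0 ≤ porosity p u j x) :
    densM p u k x - densM p u j x ≤
      (porosity p u k x * D.recM (sM p Phase.nw k) x
        - porosity p u j x * D.recM (sM p Phase.nw j) x) * D.recM (p Phase.nw k) x
      + (porosity p u k x * D.recM (sM p Phase.w k) x
        - porosity p u j x * D.recM (sM p Phase.w j) x) * D.recM (p Phase.w k) x
      + (inner ℝ (E.σ (u k) x) (E.ε (u k - u j) x)
        - Q.b * D.recM (pEM p k) x * E.div (u k - u j) x)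
      - inner ℝ (Q.f x) (E.recon (u k - u j) x) := by
  have hM := Q.M_pos
  -- For a nonnegative symmetric form a, ½a(u,u) − ½a(v,v) ≤ a(u,u − v), because the difference is
  -- ½a(u − v,u − v).
  have hσ : 1 / 2 * inner ℝ (E.σ (u k) x) (E.ε (u k) x)
      - 1 / 2 * inner ℝ (E.σ (u j) x) (E.ε (u j) x) ≤
      inner ℝ (E.σ (u k) x) (E.ε (u k - u j) x) := by
    have hd : E.div (u k - u j) x = E.div (u k) x - E.div (u j) x := by
      simp [MechGD.div, tr]
    rw [inner_σ, inner_σ, inner_σ, hd, map_sub, Pi.sub_apply, inner_sub_right]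
    have h1 : 0 ≤ inner ℝ (E.ε (u k) x - E.ε (u j) x) (E.ε (u k) x - E.ε (u j) x) :=
      real_inner_self_nonneg
    rw [real_inner_sub_sub_self] at h1
    have h2 := mul_nonneg Q.mu_pos.le h1
    have h3 := mul_nonneg Q.lam_pos.le (sq_nonneg (E.div (u k) x - E.div (u j) x))
    linarith
  have hf : inner ℝ (Q.f x) (E.recon (u k - u j) x) =
      inner ℝ (Q.f x) (E.recon (u k) x) - inner ℝ (Q.f x) (E.recon (u j) x) := by
    rw [map_sub, Pi.sub_apply, inner_sub_right]
  have hdiff := porosity_sub p u k j x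
  rw [hf]
  simp only [densM]
  rcases recM_cases D x with h | ⟨i, h⟩
  · simp only [h]; linarith
  · simp only [h] at hdiff ⊢
    have h1 := saturation_product_le Q.Sm_sat (a := p Phase.nw k i) (c := p Phase.w k i)
      (a' := p Phase.nw j i) (c' := p Phase.w j i) (φ := porosity p u k x) hx
    have h2 : (p Phase.nw k i * Q.Sm (p Phase.nw k i - p Phase.w k i)
        + p Phase.w k i * (1 - Q.Sm (p Phase.nw k i - p Phase.w k i))
        - capEnergy Q.Sm (p Phase.nw k i - p Phase.w k i)) = pEM p k i := rfl
    have hq : 1 / (2 * Q.M) * (pEM p k i * pEM p k i) - 1 / (2 * Q.M) * (pEM p j i * pEM p j i) ≤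
        1 / Q.M * (pEM p k i - pEM p j i) * pEM p k i := by
      have : 0 ≤ 1 / (2 * Q.M) * (pEM p k i - pEM p j i) ^ 2 := by positivity
      have e : 1 / Q.M = 2 * (1 / (2 * Q.M)) := by field_simp
      rw [e]
      linarith
    rw [h2, hdiff] at h1
    simp only [capM, sM, sat, pc, Pi.sub_apply]
    linarith

/-- Here the increment of the weight is minus the jump of the displacement increment, so the
coupling term appears with the sign that it has in the mechanical equation. -/
theorem densF_sub_le (k j) {x : Vec d} (hx : 0 ≤ aperture u j x) :
    densF p u k x - densF p u j x ≤
      (aperture u k x * D.recF (sF p Phase.nw k) x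
        - aperture u j x * D.recF (sF p Phase.nw j) x) * D.recF (p Phase.nw k) x
      + (aperture u k x * D.recF (sF p Phase.w k) x
        - aperture u j x * D.recF (sF p Phase.w j) x) * D.recF (p Phase.w k) x
      + D.recF (pEF p k) x * E.jump (u k - u j) x := by
  have hdiff := aperture_sub u k j x
  simp only [densF]
  rcases recF_cases D x with h | ⟨i, h⟩
  · simp [h]
  · simp only [h]
    have h1 := saturation_product_le Q.Sf_sat (a := p Phase.nw k i) (c := p Phase.w k i)
      (a' := p Phase.nw j i) (c' := p Phase.w j i) (φ := aperture u k x) hx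
    have h2 : (p Phase.nw k i * Q.Sf (p Phase.nw k i - p Phase.w k i)
        + p Phase.w k i * (1 - Q.Sf (p Phase.nw k i - p Phase.w k i))
        - capEnergy Q.Sf (p Phase.nw k i - p Phase.w k i)) = pEF p k i := rfl
    rw [h2, hdiff] at h1
    simp only [capF, sF, sat, pc, Pi.sub_apply]
    linarith

theorem integrable_densM (k) : Integrable (densM p u k) Q.vol :=
  ((((memLp_porosity_mul p u k (capM p k)).integrable one_le_two).add
    (((memLp_recM D (pEM p k) 2 Q.vol).integrable_mul (memLp_recM D (pEM p k) 2 Q.vol)).const_mul _)).add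
    ((integrable_inner (memLp_σ _) (E.ε_mem _)).const_mul _)).sub
    (integrable_inner Q.f_mem (E.recon_mem _))

theorem integrable_densF (k) : Integrable (densF p u k) Q.surf :=
  (memLp_aperture_mul u k (capF p k)).integrable one_le_two

theorem integrable_porosity_test (α : Phase) (k j) (v : D.X) :
    Integrable (fun x => (porosity p u k x * D.recM (sM p α k) x
        - porosity p u j x * D.recM (sM p α j) x) * D.recM v x) Q.vol :=
  ((memLp_porosity_mul p u k _).sub (memLp_porosity_mul p u j _)).integrable_mul
    (memLp_recM D v 2 Q.vol)

theorem integrable_aperture_test (α : Phase) (k j) (v : D.X) :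
    Integrable (fun x => (aperture u k x * D.recF (sF p α k) x
        - aperture u j x * D.recF (sF p α j) x) * D.recF v x) Q.surf :=
  ((memLp_aperture_mul u k _).sub (memLp_aperture_mul u j _)).integrable_mul
    (memLp_recF D v 2 Q.surf)

theorem integrable_mech_test (k) (v : E.X) :
    Integrable (fun x => inner ℝ (E.σ (u k) x) (E.ε v x)
      - Q.b * D.recM (pEM p k) x * E.div v x) Q.vol :=
  (integrable_inner (memLp_σ _) (E.ε_mem _)).sub
    (((memLp_recM D (pEM p k) 2 Q.vol).const_mul Q.b).integrable_mul (memLp_div v))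

/-- Dissipation of the phase `α` in the matrix and in the fractures. -/
def dissipation (α : Phase) (k : Fin (D.grid.N + 1)) : ℝ :=
  (∫ x, Q.ηm α (D.recM (sM p α k) x)
      * inner ℝ (Q.K x (D.gradM (p α k) x)) (D.gradM (p α k) x) ∂Q.vol)
    + ∫ x, Q.ηf α (D.recF (sF p α k) x) * (aperture u k x ^ 3 / 12)
      * inner ℝ (D.gradF (p α k) x) (D.gradF (p α k) x) ∂Q.surf

variable {p u}

/-- The flow equations tested with the new pressures and the mechanical equation tested with the
displacement increment evaluate the integrals of the pointwise bounds; the load and coupling terms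
cancel. Nonnegativity is asked at the old index because the old weights multiply the convexity
inequality. -/
theorem energy_step (hsol : IsSolution p u) (n : Fin D.grid.N)
    (hpor : ∀ᵐ x ∂Q.vol, 0 ≤ porosity p u n.castSucc x)
    (hap : ∀ᵐ x ∂Q.surf, 0 ≤ aperture u n.castSucc x) :
    energy p u n.succ - energy p u n.castSucc
      + step D.grid n * (dissipation p u Phase.nw n.succ + dissipation p u Phase.w n.succ) ≤
      source D Phase.nw n (p Phase.nw n.succ) + source D Phase.w n (p Phase.w n.succ) := by
  have h1 := flow_step (hsol.flow Phase.nw) n (p Phase.nw n.succ)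
  have h2 := flow_step (hsol.flow Phase.w) n (p Phase.w n.succ)
  have h3 := mech_step hsol.mech n (u n.succ - u n.castSucc)
  have hM := integral_mono_ae
    ((integrable_densM p u n.succ).sub (integrable_densM p u n.castSucc))
    ((((integrable_porosity_test p u Phase.nw n.succ n.castSucc (p Phase.nw n.succ)).add
      (integrable_porosity_test p u Phase.w n.succ n.castSucc (p Phase.w n.succ))).add
      (integrable_mech_test p u n.succ (u n.succ - u n.castSucc))).sub
      (integrable_inner Q.f_mem (E.recon_mem (u n.succ - u n.castSucc))))
    (hpor.mono fun x hx => densM_sub_le p u n.succ n.castSucc hx)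
  have hF := integral_mono_ae
    ((integrable_densF p u n.succ).sub (integrable_densF p u n.castSucc))
    (((integrable_aperture_test p u Phase.nw n.succ n.castSucc (p Phase.nw n.succ)).add
      (integrable_aperture_test p u Phase.w n.succ n.castSucc (p Phase.w n.succ))).add
      ((memLp_recF D (pEF p n.succ) 2 Q.surf).integrable_mul
        (memLp_jump (u n.succ - u n.castSucc))))
    (hap.mono fun x hx => densF_sub_le p u n.succ n.castSucc hx)
  rw [integral_sub' (integrable_densM p u _) (integrable_densM p u _), integral_sub', integral_add',
    integral_add'] at hM
  rotate_left
  · exact integrable_porosity_test p u _ _ _ _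
  · exact integrable_porosity_test p u _ _ _ _
  · exact (integrable_porosity_test p u _ _ _ _).add (integrable_porosity_test p u _ _ _ _)
  · exact integrable_mech_test p u _ _
  · exact ((integrable_porosity_test p u _ _ _ _).add
      (integrable_porosity_test p u _ _ _ _)).add (integrable_mech_test p u _ _)
  · exact integrable_inner Q.f_mem (E.recon_mem _)
  rw [integral_sub' (integrable_densF p u _) (integrable_densF p u _), integral_add',
    integral_add'] at hF
  rotate_left
  · exact integrable_aperture_test p u _ _ _ _
  · exact integrable_aperture_test p u _ _ _ _
  · exact (integrable_aperture_test p u _ _ _ _).add (integrable_aperture_test p u _ _ _ _)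
  · exact (memLp_recF D (pEF p n.succ) 2 Q.surf).integrable_mul (memLp_jump _)
  simp only [Pi.mul_apply] at hF
  simp only [energy, dissipation]
  linarith

end Energy

/-! ### Coercivity of the dissipation -/

section Dissipation

variable {d : ℕ} (Q : Model d)

/-- Since d_f ≥ d₀ > 0, the weight d_f³ is at least d₀³, the square of the weight d₀^{3/2} of the
energy norm. Mobilities and permeability are bounded below, and c depends on the model only. -/
theorem exists_dissipation_le : ∃ c : ℝ, 0 < c ∧ ∀ (D : FlowGD Q) (E : MechGD Q)
    (p : FlowUnknown D) (u : MechUnknown D E) (α : Phase) (k : Fin (D.grid.N + 1)),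
    (∀ᵐ x ∂Q.surf, Q.d₀ x ≤ aperture u k x) → c * D.nrm (p α k) ^ 2 ≤ dissipation p u α k := by
  obtain ⟨lo, hi, hlo, -, hK⟩ := exists_permeability_bounds Q
  have hη : ∃ c : ℝ, 0 < c ∧ ∀ α, ∀ s ∈ Icc (0 : ℝ) 1, c ≤ Q.ηm α s ∧ c ≤ Q.ηf α s := by
    obtain ⟨-, -, a1, _, ha1, h1⟩ := Q.ηm_mob Phase.nw
    obtain ⟨-, -, a2, _, ha2, h2⟩ := Q.ηm_mob Phase.w
    obtain ⟨-, -, a3, _, ha3, h3⟩ := Q.ηf_mob Phase.nw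
    obtain ⟨-, -, a4, _, ha4, h4⟩ := Q.ηf_mob Phase.w
    refine ⟨min (min a1 a2) (min a3 a4), by positivity, fun α s hs => ?_⟩
    have hm1 : min (min a1 a2) (min a3 a4) ≤ a1 := (min_le_left _ _).trans (min_le_left _ _)
    have hm2 : min (min a1 a2) (min a3 a4) ≤ a2 := (min_le_left _ _).trans (min_le_right _ _)
    have hm3 : min (min a1 a2) (min a3 a4) ≤ a3 := (min_le_right _ _).trans (min_le_left _ _)
    have hm4 : min (min a1 a2) (min a3 a4) ≤ a4 := (min_le_right _ _).trans (min_le_right _ _)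
    cases α
    · exact ⟨hm1.trans (h1 s hs).1, hm3.trans (h3 s hs).1⟩
    · exact ⟨hm2.trans (h2 s hs).1, hm4.trans (h4 s hs).1⟩
  obtain ⟨c, hc, hη⟩ := hη
  -- The energy norm is a sum of two L² norms, and the final division by 2 pays for (a + b)² ≤ 2a² +
  -- 2b².
  refine ⟨min (c * lo) (c / 12) / 2, by positivity, fun D E p u α k hap => ?_⟩
  have hA : c * lo * l2 Q.vol (D.gradM (p α k)) ^ 2 ≤ ∫ x, Q.ηm α (D.recM (sM p α k) x)
      * inner ℝ (Q.K x (D.gradM (p α k) x)) (D.gradM (p α k) x) ∂Q.vol := by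
    rw [l2_sq (memLp_gradM D _), ← integral_const_mul]
    refine integral_mono_ae (((memLp_gradM D _).integrable_norm_pow (by norm_num)).const_mul _)
      (integrable_matrix_flux p (Q.ηm_mob α) _ _ _ _) ?_
    filter_upwards [hK] with x hx
    have h1 := hx.1 (D.gradM (p α k) x)
    have h2 := (hη α _ (recM_sM_mem p α k x)).1
    have h3 : 0 ≤ lo * ‖D.gradM (p α k) x‖ ^ 2 := by positivity
    calc c * lo * ‖D.gradM (p α k) x‖ ^ 2 = c * (lo * ‖D.gradM (p α k) x‖ ^ 2) := by ring
      _ ≤ _ := mul_le_mul h2 h1 h3 (hc.le.trans h2)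
  have hB : c / 12 * l2 Q.surf (fun x => Q.d₀ x ^ (3 / 2 : ℝ) • D.gradF (p α k) x) ^ 2 ≤
      ∫ x, Q.ηf α (D.recF (sF p α k) x) * (aperture u k x ^ 3 / 12)
        * inner ℝ (D.gradF (p α k) x) (D.gradF (p α k) x) ∂Q.surf := by
    rw [l2_sq (D.weighted_mem _), ← integral_const_mul]
    refine integral_mono_ae (((D.weighted_mem _).integrable_norm_pow (by norm_num)).const_mul _)
      (integrable_fracture_flux p u (Q.ηf_mob α) _ _ _ _) ?_
    have hΓ : ∀ᵐ x ∂Q.surf, x ∈ Q.Γ := ae_restrict_mem (measurableSet_Gamma Q.toFracturedDomain)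
    filter_upwards [hap, hΓ] with x hx hxΓ
    have hd := (Q.d₀_pos x hxΓ).le
    have h2 := (hη α _ (recF_sF_mem p α k x)).2
    rw [norm_smul, mul_pow, Real.norm_eq_abs, sq_abs, ← Real.rpow_natCast, ← Real.rpow_mul hd,
      real_inner_self_eq_norm_sq]
    norm_num
    have h3 := pow_le_pow_left₀ hd hx 3
    have h4 : 0 ≤ Q.d₀ x ^ 3 := by positivity
    calc c / 12 * (Q.d₀ x ^ 3 * ‖D.gradF (p α k) x‖ ^ 2)
        = c * (Q.d₀ x ^ 3 / 12) * ‖D.gradF (p α k) x‖ ^ 2 := by ring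
      _ ≤ _ := by
        refine mul_le_mul_of_nonneg_right (mul_le_mul h2 ?_ ?_ (hc.le.trans h2)) (by positivity)
        · linarith
        · positivity
  set a := l2 Q.vol (D.gradM (p α k))
  set b := l2 Q.surf (fun x => Q.d₀ x ^ (3 / 2 : ℝ) • D.gradF (p α k) x)
  have hm : 0 ≤ min (c * lo) (c / 12) := by positivity
  have h1 := mul_le_mul_of_nonneg_right (min_le_left (c * lo) (c / 12)) (sq_nonneg a)
  have h2 := mul_le_mul_of_nonneg_right (min_le_right (c * lo) (c / 12)) (sq_nonneg b)
  have h3 : D.nrm (p α k) = a + b := rfl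
  rw [h3]
  simp only [dissipation]
  have h4 := mul_nonneg hm (sq_nonneg (a - b))
  linarith

end Dissipation

/-! ### Uniform energy estimate -/

theorem sum_step {T : ℝ} (τ : TimeGrid T) : ∑ n, step τ n = T := by
  have h := sum_succ_sub_castSucc τ.t
  rw [τ.t_last, τ.t_zero, sub_zero] at h
  exact h

/-! ### Lower bound of the energy and bound of its initial value -/

section Bounds

variable {d : ℕ} {Q : Model d} {D : FlowGD Q} {E : MechGD Q}
  (p : FlowUnknown D) (u : MechUnknown D E)

/-- The phase pressures are weighted by saturations in [0,1], and the capillary energy is at most |a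
− c|; hence the factor 2. -/
theorem abs_pressure_le {S : ℝ → ℝ} (hS : IsSaturation S) (a c : ℝ) :
    |a * S (a - c) + c * (1 - S (a - c)) - capEnergy S (a - c)| ≤ 2 * (|a| + |c|) := by
  have h1 := hS.2.2 (a - c)
  have h2 := capEnergy_nonneg hS (a - c)
  have h3 := (capEnergy_le hS (a - c)).trans (abs_sub a c)
  have h4 : |a * S (a - c)| ≤ |a| := by
    rw [abs_mul, abs_of_nonneg h1.1]
    exact mul_le_of_le_one_right (abs_nonneg _) h1.2
  have h5 : |c * (1 - S (a - c))| ≤ |c| := by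
    rw [abs_mul, abs_of_nonneg (sub_nonneg.2 h1.2)]
    exact mul_le_of_le_one_right (abs_nonneg _) (by linarith [h1.1])
  rw [abs_le] at *
  constructor <;> linarith

/-- A function dominated by twice the sum of two others. -/
theorem l2_le_two_mul {X : Type*} [MeasurableSpace X] {μ : Measure X} {f g h : X → ℝ}
    (hg : MemLp g 2 μ) (hh : MemLp h 2 μ) (H : ∀ x, |f x| ≤ 2 * (|g x| + |h x|)) :
    l2 μ f ≤ 2 * (l2 μ g + l2 μ h) := by
  have hs := (hg.norm.add hh.norm).const_smul (2 : ℝ)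
  have h1 := l2_le_of_ae_le (f := f) hs (ae_of_all _ fun x => by
    rw [Real.norm_eq_abs, Real.norm_eq_abs]
    exact (H x).trans (le_abs_self _))
  rw [l2_smul] at h1
  have h2 := l2_add_le hg.norm hh.norm
  have e1 : l2 μ (fun x => ‖g x‖) = l2 μ g := by rw [l2, eLpNorm_norm, l2]
  have e2 : l2 μ (fun x => ‖h x‖) = l2 μ h := by rw [l2, eLpNorm_norm, l2]
  rw [e1, e2] at h2
  rw [abs_of_pos two_pos] at h1
  linarith

theorem l2_pEM_le (k) : l2 Q.vol (D.recM (pEM p k)) ≤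
    2 * (l2 Q.vol (D.recM (p Phase.nw k)) + l2 Q.vol (D.recM (p Phase.w k))) := by
  refine l2_le_two_mul (memLp_recM D _ 2 _) (memLp_recM D _ 2 _) fun x => ?_
  rcases recM_cases D x with h | ⟨i, h⟩
  · simp [h]
  · simp only [h]; exact abs_pressure_le Q.Sm_sat _ _

theorem l2_pEF_le (k) : l2 Q.surf (D.recF (pEF p k)) ≤
    2 * (l2 Q.surf (D.recF (p Phase.nw k)) + l2 Q.surf (D.recF (p Phase.w k))) := by
  refine l2_le_two_mul (memLp_recF D _ 2 _) (memLp_recF D _ 2 _) fun x => ?_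
  rcases recF_cases D x with h | ⟨i, h⟩
  · simp [h]
  · simp only [h]; exact abs_pressure_le Q.Sf_sat _ _

theorem abs_capEnergy_le {S : ℝ → ℝ} (hS : IsSaturation S) (a c : ℝ) :
    |capEnergy S (a - c)| ≤ 2 * (|a| + |c|) := by
  rw [abs_of_nonneg (capEnergy_nonneg hS _)]
  have h3 := (capEnergy_le hS (a - c)).trans (abs_sub a c)
  linarith [abs_nonneg a, abs_nonneg c]

theorem l2_capM_le (k) : l2 Q.vol (D.recM (capM p k)) ≤
    2 * (l2 Q.vol (D.recM (p Phase.nw k)) + l2 Q.vol (D.recM (p Phase.w k))) := by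
  refine l2_le_two_mul (memLp_recM D _ 2 _) (memLp_recM D _ 2 _) fun x => ?_
  rcases recM_cases D x with h | ⟨i, h⟩
  · simp [h]
  · simp only [h]; exact abs_capEnergy_le Q.Sm_sat _ _

theorem l2_capF_le (k) : l2 Q.surf (D.recF (capF p k)) ≤
    2 * (l2 Q.surf (D.recF (p Phase.nw k)) + l2 Q.surf (D.recF (p Phase.w k))) := by
  refine l2_le_two_mul (memLp_recF D _ 2 _) (memLp_recF D _ 2 _) fun x => ?_
  rcases recF_cases D x with h | ⟨i, h⟩
  · simp [h]
  · simp only [h]; exact abs_capEnergy_le Q.Sf_sat _ _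

theorem recM_nonneg {v : D.X} (hv : ∀ i, 0 ≤ v i) (x : Vec d) : 0 ≤ D.recM v x := by
  rcases recM_cases D x with h | ⟨i, h⟩
  · simp [h]
  · rw [h]; exact hv i

theorem recF_nonneg {v : D.X} (hv : ∀ i, 0 ≤ v i) (x : Vec d) : 0 ≤ D.recF v x := by
  rcases recF_cases D x with h | ⟨i, h⟩
  · simp [h]
  · rw [h]; exact hv i

theorem nrm_nonneg (v : E.X) : 0 ≤ E.nrm v := l2_nonneg _

theorem integral_elastic_ge (v : E.X) :
    2 * Q.mu * E.nrm v ^ 2 ≤ ∫ x, inner ℝ (E.σ v x) (E.ε v x) ∂Q.vol := by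
  rw [MechGD.nrm, l2_sq (E.ε_mem v), ← integral_const_mul]
  refine integral_mono (((E.ε_mem v).integrable_norm_pow (by norm_num)).const_mul _)
    (integrable_inner (memLp_σ _) (E.ε_mem _)) fun x => ?_
  simp only [inner_σ, real_inner_self_eq_norm_sq]
  have := mul_nonneg Q.lam_pos.le (mul_self_nonneg (E.div v x))
  linarith

/-- Only the work of the body force can be negative. The elastic energy is at least μ times the
squared norm and absorbs it by Young's inequality. -/
theorem energy_ge {C : ℝ} (hC : ∀ v : E.X, l2 Q.vol (E.recon v) ≤ C * E.nrm v) (k)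
    (hpor : ∀ᵐ x ∂Q.vol, 0 ≤ porosity p u k x) (hap : ∀ᵐ x ∂Q.surf, 0 ≤ aperture u k x) :
    -((l2 Q.vol Q.f * C) ^ 2 / (4 * Q.mu)) ≤ energy p u k := by
  have hμ := Q.mu_pos
  have hM := Q.M_pos
  have h1 : 0 ≤ ∫ x, densF p u k x ∂Q.surf := by
    refine integral_nonneg_of_ae ?_
    filter_upwards [hap] with x hx
    exact mul_nonneg hx (recF_nonneg (fun i => capEnergy_nonneg Q.Sf_sat _) x)
  have h2 : ∫ x, (1 / 2 * inner ℝ (E.σ (u k) x) (E.ε (u k) x)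
      - inner ℝ (Q.f x) (E.recon (u k) x)) ∂Q.vol ≤ ∫ x, densM p u k x ∂Q.vol := by
    refine integral_mono_ae (((integrable_inner (memLp_σ _) (E.ε_mem _)).const_mul _).sub
      (integrable_inner Q.f_mem (E.recon_mem _))) (integrable_densM p u k) ?_
    filter_upwards [hpor] with x hx
    have h3 := mul_nonneg hx (recM_nonneg (fun i => capEnergy_nonneg Q.Sm_sat (pc p k i)) x)
    have h4 : 0 ≤ 1 / (2 * Q.M) * (D.recM (pEM p k) x * D.recM (pEM p k) x) :=
      mul_nonneg (by positivity) (mul_self_nonneg _)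
    simp only [densM]
    change 0 ≤ _ * D.recM (capM p k) x at h3
    linarith
  rw [integral_sub ((integrable_inner (memLp_σ _) (E.ε_mem _)).const_mul _)
    (integrable_inner Q.f_mem (E.recon_mem _)), integral_const_mul] at h2
  have h3 := integral_elastic_ge (u k)
  have h4 := (le_abs_self _).trans ((abs_integral_inner_le Q.f_mem (E.recon_mem (u k))).trans
    (mul_le_mul_of_nonneg_left (hC (u k)) (l2_nonneg _)))
  have h5 : (l2 Q.vol Q.f * C) * E.nrm (u k) ≤
      Q.mu * E.nrm (u k) ^ 2 + (l2 Q.vol Q.f * C) ^ 2 / (4 * Q.mu) := by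
    have h6 : 0 ≤ Q.mu * (E.nrm (u k) - (l2 Q.vol Q.f * C) / (2 * Q.mu)) ^ 2 := by positivity
    have e : Q.mu * (E.nrm (u k) - (l2 Q.vol Q.f * C) / (2 * Q.mu)) ^ 2 =
      Q.mu * E.nrm (u k) ^ 2 + (l2 Q.vol Q.f * C) ^ 2 / (4 * Q.mu)
        - (l2 Q.vol Q.f * C) * E.nrm (u k) := by field_simp; ring
    linarith
  simp only [energy]
  linarith

variable {p u}

/-- The initial energy is controlled by the initial data. -/
theorem energy_zero_le (h : InitialMechEquation p u) {C R : ℝ} (hC : 0 ≤ C)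
    (hE : ∀ v : E.X, l2 Q.vol (E.recon v) ≤ C * E.nrm v ∧ l2 Q.surf (E.jump v) ≤ C * E.nrm v)
    (hφ : l2 Q.vol (D.recM (D.interpM Q.φInit)) ≤ R)
    (hM : ∀ α, l2 Q.vol (D.recM (p α 0)) ≤ R) (hF : ∀ α, l2 Q.surf (D.recF (p α 0)) ≤ R) :
    energy p u 0 ≤ 4 * R ^ 2 + 1 / (2 * Q.M) * (4 * R) ^ 2
      + (4 * R * ‖idTens d‖ + 8 * R * C + 2 * (l2 Q.vol Q.f * C))
        * ((4 * R * ‖idTens d‖ + 4 * R * C + l2 Q.vol Q.f * C) / (2 * Q.mu)) := by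
  have hμ := Q.mu_pos
  have hMp := Q.M_pos
  have hb := Q.b_mem
  set F := l2 Q.vol Q.f with hFdef
  have hF0 : 0 ≤ F := l2_nonneg _
  set N := E.nrm (u 0) with hN
  have hN0 : 0 ≤ N := nrm_nonneg _
  have hR : 0 ≤ R := (l2_nonneg _).trans hφ
  set I := ‖idTens d‖ with hI
  have hI0 : 0 ≤ I := norm_nonneg _
  have hpM : l2 Q.vol (D.recM (pEM p 0)) ≤ 4 * R := by
    linarith [l2_pEM_le p 0, hM Phase.nw, hM Phase.w]
  have hpF : l2 Q.surf (D.recF (pEF p 0)) ≤ 4 * R := by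
    linarith [l2_pEF_le p 0, hF Phase.nw, hF Phase.w]
  have hcM : l2 Q.vol (D.recM (capM p 0)) ≤ 4 * R := by
    linarith [l2_capM_le p 0, hM Phase.nw, hM Phase.w]
  have hcF : l2 Q.surf (D.recF (capF p 0)) ≤ 4 * R := by
    linarith [l2_capF_le p 0, hF Phase.nw, hF Phase.w]
  have hfr : |∫ x, inner ℝ (Q.f x) (E.recon (u 0) x) ∂Q.vol| ≤ F * C * N := by
    refine (abs_integral_inner_le Q.f_mem (E.recon_mem (u 0))).trans ?_
    rw [mul_assoc]
    exact mul_le_mul_of_nonneg_left (hE (u 0)).1 hF0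
  have hdiv : |∫ x, Q.b * D.recM (pEM p 0) x * E.div (u 0) x ∂Q.vol| ≤ 4 * R * I * N := by
    simp_rw [mul_assoc]
    rw [integral_const_mul, abs_mul, abs_of_nonneg hb.1]
    have h1 := (abs_integral_mul_le (memLp_recM D (pEM p 0) 2 Q.vol) (memLp_div (u 0))).trans
      (mul_le_mul hpM (l2_div_le (u 0)) (l2_nonneg _) (by positivity))
    have h2 := mul_le_mul_of_nonneg_right hb.2 (abs_nonneg
      (∫ x, D.recM (pEM p 0) x * E.div (u 0) x ∂Q.vol))
    linarith
  have hjump : |∫ x, D.recF (pEF p 0) x * E.jump (u 0) x ∂Q.surf| ≤ 4 * R * C * N := by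
    rw [mul_assoc (4 * R)]
    exact (abs_integral_mul_le (memLp_recF D (pEF p 0) 2 Q.surf) (memLp_jump (u 0))).trans
      (mul_le_mul hpF (hE (u 0)).2 (l2_nonneg _) (by positivity))
  -- Testing with the initial displacement itself bounds its elastic energy by a multiple of its
  -- norm, and therefore bounds the norm.
  have hmech := h (u 0)
  have hsub := integral_sub (integrable_inner (memLp_σ (u 0)) (E.ε_mem (u 0)))
    (((memLp_recM D (pEM p 0) 2 Q.vol).const_mul Q.b).integrable_mul (memLp_div (u 0)))
  simp only [Pi.mul_apply] at hsub
  rw [hsub] at hmech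
  have hel := integral_elastic_ge (u 0)
  have helN : ∫ x, inner ℝ (E.σ (u 0) x) (E.ε (u 0) x) ∂Q.vol ≤
      (4 * R * I + 4 * R * C + F * C) * N := by
    linarith [neg_abs_le (∫ x, D.recF (pEF p 0) x * E.jump (u 0) x ∂Q.surf),
      le_abs_self (∫ x, Q.b * D.recM (pEM p 0) x * E.div (u 0) x ∂Q.vol),
      le_abs_self (∫ x, inner ℝ (Q.f x) (E.recon (u 0) x) ∂Q.vol)]
  have hNle : N ≤ (4 * R * I + 4 * R * C + F * C) / (2 * Q.mu) := by
    -- The quadratic bound 2μN² ≤ cN is divided by N, so N = 0 is treated apart.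
    rcases hN0.eq_or_lt with h0 | h0
    · rw [← h0]; positivity
    · rw [le_div_iff₀ (by positivity)]
      refine le_of_mul_le_mul_right ?_ h0
      linarith
  have hpor : porosity p u 0 = D.recM (D.interpM Q.φInit) := by
    ext x; simp [porosity, recM_zero, MechGD.div, tr]
  have hφU : ∫ x, porosity p u 0 x * D.recM (capM p 0) x ∂Q.vol ≤ R * (4 * R) := by
    rw [hpor]
    exact (le_abs_self _).trans ((abs_integral_mul_le (memLp_recM D _ 2 Q.vol)
      (memLp_recM D _ 2 Q.vol)).trans (mul_le_mul hφ hcM (l2_nonneg _) hR))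
  have hpp : ∫ x, D.recM (pEM p 0) x * D.recM (pEM p 0) x ∂Q.vol ≤ (4 * R) ^ 2 := by
    rw [pow_two]
    exact (le_abs_self _).trans ((abs_integral_mul_le (memLp_recM D _ 2 Q.vol)
      (memLp_recM D _ 2 Q.vol)).trans (mul_le_mul hpM hpM (l2_nonneg _) (by positivity)))
  have hdU : ∫ x, densF p u 0 x ∂Q.surf ≤ C * N * (4 * R) := by
    refine (le_abs_self _).trans ((abs_integral_mul_le (memLp_aperture u 0)
      (memLp_recF D _ 2 Q.surf)).trans (mul_le_mul ?_ hcF (l2_nonneg _) (by positivity)))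
    have e : aperture u 0 = (-1 : ℝ) • E.jump (u 0) := by ext x; simp [aperture]
    rw [e, l2_smul]
    simpa using (hE (u 0)).2
  have hsplit : ∫ x, densM p u 0 x ∂Q.vol = ∫ x, porosity p u 0 x * D.recM (capM p 0) x ∂Q.vol
      + 1 / (2 * Q.M) * (∫ x, D.recM (pEM p 0) x * D.recM (pEM p 0) x ∂Q.vol)
      + 1 / 2 * (∫ x, inner ℝ (E.σ (u 0) x) (E.ε (u 0) x) ∂Q.vol)
      - ∫ x, inner ℝ (Q.f x) (E.recon (u 0) x) ∂Q.vol := by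
    have i1 := (memLp_porosity_mul p u 0 (capM p 0)).integrable one_le_two
    have i2 := ((memLp_recM D (pEM p 0) 2 Q.vol).integrable_mul
      (memLp_recM D (pEM p 0) 2 Q.vol)).const_mul (1 / (2 * Q.M))
    have i3 := (integrable_inner (memLp_σ (u 0)) (E.ε_mem (u 0))).const_mul (1 / 2)
    have i4 := integrable_inner Q.f_mem (E.recon_mem (u 0))
    have h1 := integral_sub ((i1.add i2).add i3) i4
    have h2 := integral_add (i1.add i2) i3
    have h3 := integral_add i1 i2
    simp only [Pi.add_apply, Pi.mul_apply] at h1 h2 h3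
    rw [integral_const_mul] at h2 h3
    simp only [densM]
    rw [h1, h2, h3]
  rw [energy, hsplit]
  have h7 : 1 / (2 * Q.M) * (∫ x, D.recM (pEM p 0) x * D.recM (pEM p 0) x ∂Q.vol) ≤
      1 / (2 * Q.M) * (4 * R) ^ 2 := mul_le_mul_of_nonneg_left hpp (by positivity)
  have h8 : (4 * R * I + 8 * R * C + 2 * (F * C)) * N ≤
      (4 * R * I + 8 * R * C + 2 * (F * C)) * ((4 * R * I + 4 * R * C + F * C) / (2 * Q.mu)) :=
    mul_le_mul_of_nonneg_left hNle (by positivity)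
  have h9 : 0 ≤ 4 * R * I * N := by positivity
  have h10 : 0 ≤ F * C * N := by positivity
  have h11 : 0 ≤ R * C * N := by positivity
  linarith [neg_abs_le (∫ x, inner ℝ (Q.f x) (E.recon (u 0) x) ∂Q.vol)]

end Bounds

/-! ### Summation of the energy inequality -/

section Estimate

variable {d : ℕ} {Q : Model d}

/-- Young's inequality with a free weight c, to be chosen so that the first term is absorbed by the
dissipation. The √step of the source bound goes with the norm of v and restores a full factor step.
-/
theorem source_le_nrm {D : FlowGD Q} {C : ℝ}
    (hC : ∀ v : D.X, l2 Q.vol (D.recM v) + l2 Q.surf (D.recF v) ≤ C * D.nrm v) (α : Phase)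
    (n : Fin D.grid.N) (v : D.X) {c : ℝ} (hc : 0 < c) :
    source D α n v ≤ c * (step D.grid n * D.nrm v ^ 2)
      + C ^ 2 / (2 * c) * (sourceNormM D α n ^ 2 + sourceNormF D α n ^ 2) := by
  have h := (le_abs_self _).trans (abs_source_le (D := D) α n v)
  set r := √(step D.grid n)
  have hr : 0 ≤ r := Real.sqrt_nonneg _
  have hr2 : step D.grid n = r ^ 2 := (Real.sq_sqrt (step_pos D.grid n).le).symm
  set a := sourceNormM D α n
  set b := sourceNormF D α n
  have ha : 0 ≤ a := l2_nonneg _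
  have hb : 0 ≤ b := l2_nonneg _
  have hm : 0 ≤ l2 Q.vol (D.recM v) := l2_nonneg _
  have hf : 0 ≤ l2 Q.surf (D.recF v) := l2_nonneg _
  have h1 : r * a * l2 Q.vol (D.recM v) + r * b * l2 Q.surf (D.recF v) ≤
      r * (a + b) * (C * D.nrm v) := by
    have h2 := mul_le_mul_of_nonneg_left (hC v) (by positivity : 0 ≤ r * (a + b))
    have h3 : 0 ≤ r * a * l2 Q.surf (D.recF v) := by positivity
    have h4 : 0 ≤ r * b * l2 Q.vol (D.recM v) := by positivity
    linarith
  have h5 : r * (a + b) * (C * D.nrm v) ≤ c * (r ^ 2 * D.nrm v ^ 2)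
      + C ^ 2 / (4 * c) * (a + b) ^ 2 := by
    have h6 : 0 ≤ c * (r * D.nrm v - C * (a + b) / (2 * c)) ^ 2 := by positivity
    have e : c * (r * D.nrm v - C * (a + b) / (2 * c)) ^ 2 = c * (r ^ 2 * D.nrm v ^ 2)
      + C ^ 2 / (4 * c) * (a + b) ^ 2 - r * (a + b) * (C * D.nrm v) := by field_simp; ring
    linarith
  have h7 : C ^ 2 / (4 * c) * (a + b) ^ 2 ≤ C ^ 2 / (2 * c) * (a ^ 2 + b ^ 2) := by
    have e : C ^ 2 / (2 * c) = 2 * (C ^ 2 / (4 * c)) := by field_simp; ring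
    rw [e]
    have h8 : 0 ≤ C ^ 2 / (4 * c) * (a - b) ^ 2 := by positivity
    linarith
  rw [hr2]
  linarith

theorem exists_bound_of_tendsto_zero {f : ℕ → ℝ} (h : Tendsto f atTop (𝓝 0)) : ∃ C, ∀ l, f l ≤ C := by
  obtain ⟨C, hC⟩ := h.bddAbove_range
  exact ⟨C, fun l => hC (mem_range_self l)⟩

theorem l2_le_add_sub {X : Type*} [MeasurableSpace X] {μ : Measure X} {f g : X → ℝ}
    (hf : MemLp f 2 μ) (hg : MemLp g 2 μ) : l2 μ f ≤ l2 μ (f - g) + l2 μ g := by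
  simpa using l2_add_le (hf.sub hg) hg

/-- Along a consistent sequence, the reconstructed initial data are bounded. -/
theorem exists_initial_bound {D : ℕ → FlowGD Q} (hD : SpaceTimeConsistent D) :
    ∃ R : ℝ, ∀ l, l2 Q.vol ((D l).recM ((D l).interpM Q.φInit)) ≤ R ∧
      ∀ α, l2 Q.vol ((D l).recM ((D l).interpP (Q.pInit α))) ≤ R ∧
        l2 Q.surf ((D l).recF ((D l).interpP (Q.pInit α))) ≤ R := by
  obtain ⟨-, hP, hM⟩ := hD
  have hφ2 : MemLp Q.φInit 2 Q.vol := Q.φInit_bdd.mono_exponent le_top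
  have hp2 : ∀ α, MemLp (Q.pInit α) 2 Q.vol := fun α => (Q.pInit_bdd α).mono_exponent le_top
  have hg2 : ∀ α, MemLp (Q.γpInit α) 2 Q.surf := fun α => (Q.γpInit_bdd α).mono_exponent le_top
  obtain ⟨C0, hC0⟩ := exists_bound_of_tendsto_zero (hM _ hφ2)
  have hC : ∀ α, ∃ C : ℝ, ∀ l, l2 Q.vol ((D l).recM ((D l).interpP (Q.pInit α))) ≤ C ∧
        l2 Q.surf ((D l).recF ((D l).interpP (Q.pInit α))) ≤ C := by
    intro α
    obtain ⟨C, hC⟩ := exists_bound_of_tendsto_zero (hP _ _ (Q.pInit_V0 α))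
    refine ⟨C + l2 Q.vol (Q.pInit α) + l2 Q.surf (Q.γpInit α), fun l => ⟨?_, ?_⟩⟩
    · have h1 := l2_le_add_sub (memLp_recM (D l) ((D l).interpP (Q.pInit α)) 2 Q.vol) (hp2 α)
      linarith [hC l, l2_nonneg (μ := Q.surf) ((D l).recF ((D l).interpP (Q.pInit α)) - Q.γpInit α),
        l2_nonneg (μ := Q.surf) (Q.γpInit α)]
    · have h1 := l2_le_add_sub (memLp_recF (D l) ((D l).interpP (Q.pInit α)) 2 Q.surf) (hg2 α)
      linarith [hC l, l2_nonneg (μ := Q.vol) ((D l).recM ((D l).interpP (Q.pInit α)) - Q.pInit α),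
        l2_nonneg (μ := Q.vol) (Q.pInit α)]
  obtain ⟨C1, hC1⟩ := hC Phase.nw
  obtain ⟨C2, hC2⟩ := hC Phase.w
  refine ⟨max (C0 + l2 Q.vol Q.φInit) (max C1 C2), fun l => ⟨?_, fun α => ?_⟩⟩
  · have h1 := l2_le_add_sub (memLp_recM (D l) ((D l).interpM Q.φInit) 2 Q.vol) hφ2
    exact le_max_of_le_left (by linarith [hC0 l])
  · cases α
    · exact ⟨le_max_of_le_right (le_max_of_le_left (hC1 l).1),
        le_max_of_le_right (le_max_of_le_left (hC1 l).2)⟩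
    · exact ⟨le_max_of_le_right (le_max_of_le_right (hC2 l).1),
        le_max_of_le_right (le_max_of_le_right (hC2 l).2)⟩

theorem exists_mech_bound {E : ℕ → MechGD Q} (hE : MechCoercive E) : ∃ C : ℝ, 0 ≤ C ∧
    ∀ l (v : (E l).X), l2 Q.vol ((E l).recon v) ≤ C * (E l).nrm v ∧
      l2 Q.surf ((E l).jump v) ≤ C * (E l).nrm v := by
  obtain ⟨C, hC, h⟩ := hE
  set r := (Q.surf univ ^ (1 / 4 : ℝ)).toReal
  have hr : 0 ≤ r := ENNReal.toReal_nonneg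
  refine ⟨C + r * C, by positivity, fun l v => ?_⟩
  have h1 := h l v
  have h2 := l2_le_sqrt_mul_rpow_four ((E l).jump_mem v)
  have h3 : 0 ≤ (eLpNorm ((E l).jump v) 4 Q.surf).toReal := ENNReal.toReal_nonneg
  have h4 := l2_nonneg (μ := Q.vol) ((E l).recon v)
  have hN := nrm_nonneg v
  constructor
  · have : 0 ≤ r * C * (E l).nrm v := by positivity
    linarith
  · have h5 := mul_le_mul_of_nonneg_left
      (by linarith : (eLpNorm ((E l).jump v) 4 Q.surf).toReal ≤ C * (E l).nrm v) hr
    have : 0 ≤ C * (E l).nrm v := by positivity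
    linarith

/-- Summed over the steps, the energy telescopes. The final energy is bounded below, the initial one
above, and the source norms are square summable, so the dissipation that is left is bounded
independently of l. -/
theorem energy_estimate (D : ℕ → FlowGD Q) (E : ℕ → MechGD Q)
    (hD_coercive : FlowCoercive D) (hD_consistent : SpaceTimeConsistent D)
    (hE_coercive : MechCoercive E)
    (p : ∀ l, FlowUnknown (D l)) (u : ∀ l, MechUnknown (D l) (E l))
    (hsol : ∀ l, IsSolution (p l) (u l))
    (h_aperture : ∀ l n, ∀ᵐ x ∂Q.surf, Q.d₀ x ≤ aperture (u l) (Fin.succ n) x)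
    (h_aperture_nonneg : ∀ l k, ∀ᵐ x ∂Q.surf, 0 ≤ aperture (u l) k x)
    (h_porosity_nonneg : ∀ l k, ∀ᵐ x ∂Q.vol, 0 ≤ porosity (p l) (u l) k x) :
    ∃ C : ℝ, ∀ l, ∑ n, step (D l).grid n * ((D l).nrm (p l Phase.nw n.succ) ^ 2
      + (D l).nrm (p l Phase.w n.succ) ^ 2) ≤ C := by
  obtain ⟨C, -, hC⟩ := hD_coercive
  obtain ⟨R, hR⟩ := exists_initial_bound hD_consistent
  obtain ⟨B, hB0, hB⟩ := exists_mech_bound hE_coercive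
  obtain ⟨c, hc, hdiss⟩ := exists_dissipation_le Q
  obtain ⟨E0, hE0⟩ : ∃ E0 : ℝ, ∀ l, energy (p l) (u l) 0 ≤ E0 := ⟨_, fun l =>
    energy_zero_le (hsol l).init_mech hB0 (hB l) (hR l).1
      (fun α => by rw [(hsol l).init_pressure]; exact ((hR l).2 α).1)
      (fun α => by rw [(hsol l).init_pressure]; exact ((hR l).2 α).2)⟩
  set H : ℝ := (l2 (Q.time.prod Q.vol) (Q.hm Phase.nw) ^ 2
    + l2 (Q.time.prod Q.surf) (Q.hf Phase.nw) ^ 2) +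
    (l2 (Q.time.prod Q.vol) (Q.hm Phase.w) ^ 2 + l2 (Q.time.prod Q.surf) (Q.hf Phase.w) ^ 2)
  refine ⟨(E0 + (l2 Q.vol Q.f * B) ^ 2 / (4 * Q.mu) + C ^ 2 / (2 * (c / 2)) * H) / (c / 2),
    fun l => ?_⟩
  rw [le_div_iff₀ (by positivity)]
  set P : Fin (D l).grid.N → ℝ := fun n => step (D l).grid n * ((D l).nrm (p l Phase.nw n.succ) ^ 2
      + (D l).nrm (p l Phase.w n.succ) ^ 2) with hP
  have hstep : ∀ n, (energy (p l) (u l) n.succ - energy (p l) (u l) n.castSucc) + c / 2 * P n ≤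
      C ^ 2 / (2 * (c / 2)) * ((sourceNormM (D l) Phase.nw n ^ 2 + sourceNormF (D l) Phase.nw n ^ 2)
        + (sourceNormM (D l) Phase.w n ^ 2 + sourceNormF (D l) Phase.w n ^ 2)) := by
    intro n
    have h1 := energy_step (hsol l) n (h_porosity_nonneg l _) (h_aperture_nonneg l _)
    have h2 := hdiss (D l) (E l) (p l) (u l) Phase.nw n.succ (h_aperture l n)
    have h3 := hdiss (D l) (E l) (p l) (u l) Phase.w n.succ (h_aperture l n)
    -- Half of the dissipation constant is spent on absorbing the sources; the other half gives the
    -- estimate.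
    have h4 := source_le_nrm (hC l) Phase.nw n (p l Phase.nw n.succ) (half_pos hc)
    have h5 := source_le_nrm (hC l) Phase.w n (p l Phase.w n.succ) (half_pos hc)
    have h6 := mul_le_mul_of_nonneg_left (add_le_add h2 h3) (step_pos (D l).grid n).le
    simp only [hP]
    linarith
  have hsum := Finset.sum_le_sum fun n (_ : n ∈ Finset.univ) => hstep n
  rw [Finset.sum_add_distrib, sum_succ_sub_castSucc, ← Finset.mul_sum, ← Finset.mul_sum,
    Finset.sum_add_distrib, Finset.sum_add_distrib, Finset.sum_add_distrib] at hsum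
  have hN := energy_ge (p l) (u l) (fun v => (hB l v).1) (Fin.last _) (h_porosity_nonneg l _)
    (h_aperture_nonneg l _)
  have hH : (∑ n, sourceNormM (D l) Phase.nw n ^ 2 + ∑ n, sourceNormF (D l) Phase.nw n ^ 2)
      + (∑ n, sourceNormM (D l) Phase.w n ^ 2 + ∑ n, sourceNormF (D l) Phase.w n ^ 2) ≤ H :=
    add_le_add (add_le_add (sum_sq_sourceNormM_le _ _) (sum_sq_sourceNormF_le _ _))
      (add_le_add (sum_sq_sourceNormM_le _ _) (sum_sq_sourceNormF_le _ _))
  have hH' := mul_le_mul_of_nonneg_left hH (by positivity : 0 ≤ C ^ 2 / (2 * (c / 2)))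
  linarith [hE0 l]

end Estimate

/-! ### Differences of saturations at different times -/

/-- Triangle inequality along the steps n → n + 1 that lie between the indices j and k. -/
theorem abs_sub_le_sum_filter {m : ℕ} {G : Fin (m + 1) → ℝ} {b : Fin m → ℝ}
    (h : ∀ n, |G n.succ - G n.castSucc| ≤ b n) {j k : Fin (m + 1)} (hjk : j ≤ k) :
    |G k - G j| ≤ ∑ n with j ≤ n.castSucc ∧ n.succ ≤ k, b n := by
  have hb : ∀ n, 0 ≤ b n := fun n => (abs_nonneg _).trans (h n)
  induction k using Fin.induction with
  | zero =>
    rw [Fin.le_zero_iff.1 hjk, sub_self, abs_zero]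
    exact Finset.sum_nonneg fun n _ => hb n
  | succ i ih =>
    rcases hjk.eq_or_lt with rfl | hlt
    · simpa using Finset.sum_nonneg fun n _ => hb n
    · have hji : j ≤ i.castSucc := Fin.le_castSucc_iff.2 hlt
      have h1 := ih hji
      have hni : i ∉ Finset.univ.filter (fun n : Fin m => j ≤ n.castSucc ∧ n.succ ≤ i.castSucc) := by
        simp only [Finset.mem_filter, Finset.mem_univ, true_and, not_and, not_le]
        exact fun _ => Fin.castSucc_lt_succ
      have hsub : insert i (Finset.univ.filter (fun n : Fin m => j ≤ n.castSucc ∧ n.succ ≤ i.castSucc)) ⊆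
          Finset.univ.filter (fun n : Fin m => j ≤ n.castSucc ∧ n.succ ≤ i.succ) := by
        intro n hn
        rw [Finset.mem_insert, Finset.mem_filter] at hn
        rw [Finset.mem_filter]
        rcases hn with rfl | ⟨-, hn1, hn2⟩
        · exact ⟨Finset.mem_univ _, hji, le_rfl⟩
        · exact ⟨Finset.mem_univ _, hn1, hn2.trans Fin.castSucc_lt_succ.le⟩
      have h2 := Finset.sum_le_sum_of_subset_of_nonneg hsub fun n _ _ => hb n
      rw [Finset.sum_insert hni] at h2
      calc |G i.succ - G j| ≤ |G i.succ - G i.castSucc| + |G i.castSucc - G j| := abs_sub_le _ _ _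
        _ ≤ b i + _ := add_le_add (h i) h1
        _ ≤ _ := h2

section Translates

variable {d : ℕ} {Q : Model d}

theorem exists_flux_bound (Q : Model d) : ∃ κ : ℝ, 0 ≤ κ ∧ ∀ (D : FlowGD Q) (p : FlowUnknown D)
    (α : Phase) (k : Fin (D.grid.N + 1)) (v w : D.X),
    |∫ x, Q.ηm α (D.recM (sM p α k) x) * inner ℝ (Q.K x (D.gradM v x)) (D.gradM w x) ∂Q.vol| ≤
      κ * (l2 Q.vol (D.gradM v) * l2 Q.vol (D.gradM w)) := by
  obtain ⟨lo, hi, -, hhi, hK⟩ := exists_permeability_bounds Q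
  have hη : ∀ α, ∃ b : ℝ, 0 ≤ b ∧ ∀ s ∈ Icc (0 : ℝ) 1, |Q.ηm α s| ≤ b := fun α => by
    obtain ⟨-, -, a, b, ha, h⟩ := Q.ηm_mob α
    refine ⟨b, ?_, fun s hs => ?_⟩
    · have := h 0 ⟨le_rfl, zero_le_one⟩; linarith
    · rw [abs_of_nonneg (ha.le.trans (h s hs).1)]; exact (h s hs).2
  choose b hb0 hb using hη
  have hbα : ∀ α, b α ≤ b Phase.nw + b Phase.w := fun α => by
    cases α <;> linarith [hb0 Phase.nw, hb0 Phase.w]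
  refine ⟨(b Phase.nw + b Phase.w) * hi, mul_nonneg (add_nonneg (hb0 _) (hb0 _)) hhi,
    fun D p α k v w => integral_le_of_ae_le_norm_mul (mul_nonneg (add_nonneg (hb0 _) (hb0 _)) hhi)
      (memLp_gradM D v) (memLp_gradM D w) ?_⟩
  filter_upwards [hK] with x hx
  rw [abs_mul, mul_assoc]
  exact mul_le_mul ((hb α _ (recM_sM_mem p α k x)).trans (hbα α)) (hx.2 _ _) (abs_nonneg _)
    (add_nonneg (hb0 _) (hb0 _))

variable {D : FlowGD Q} {E : MechGD Q}

/-- The discrete unknown `ψ` is supported away from the fractures. -/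
def VanishesOnFractures (D : FlowGD Q) (ψ : D.X) : Prop :=
  ∀ v : D.X, (∀ᵐ x ∂Q.surf, D.recF (v * ψ) x = 0) ∧ ∀ᵐ x ∂Q.surf, D.gradF (v * ψ) x = 0

/-- The chain and product rules concern matrix gradients only; after multiplication by the cut-off,
nothing else is left in the energy norm. -/
theorem nrm_mul_eq {ψ : D.X} (hψ : VanishesOnFractures D ψ) (v : D.X) :
    D.nrm (v * ψ) = l2 Q.vol (D.gradM (v * ψ)) := by
  have h : l2 Q.surf (fun x => Q.d₀ x ^ (3 / 2 : ℝ) • D.gradF (v * ψ) x) = 0 := by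
    have h0 : (fun x => Q.d₀ x ^ (3 / 2 : ℝ) • D.gradF (v * ψ) x) =ᵐ[Q.surf] 0 := by
      filter_upwards [(hψ v).2] with x hx
      simp [hx]
    rw [l2, eLpNorm_congr_ae h0]
    simp
  rw [FlowGD.nrm, h, add_zero]

variable (p : FlowUnknown D) (u : MechUnknown D E)

/-- The size of the matrix data and pressure gradients on one time step. -/
def variationBound (n : Fin D.grid.N) : ℝ :=
  (√(step D.grid n) * sourceNormM D Phase.nw n
      + step D.grid n * l2 Q.vol (D.gradM (p Phase.nw n.succ)))
    + (√(step D.grid n) * sourceNormM D Phase.w n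
      + step D.grid n * l2 Q.vol (D.gradM (p Phase.w n.succ)))

theorem phase_bound_le (β : Phase) (n : Fin D.grid.N) :
    √(step D.grid n) * sourceNormM D β n + step D.grid n * l2 Q.vol (D.gradM (p β n.succ)) ≤
      variationBound p n := by
  have h : ∀ β, 0 ≤ √(step D.grid n) * sourceNormM D β n
      + step D.grid n * l2 Q.vol (D.gradM (p β n.succ)) := fun β =>
    add_nonneg (mul_nonneg (Real.sqrt_nonneg _) (l2_nonneg _))
      (mul_nonneg (step_pos _ _).le (l2_nonneg _))
  have h1 := h Phase.nw
  have h2 := h Phase.w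
  rw [variationBound]
  cases β <;> linarith

theorem variationBound_nonneg (n : Fin D.grid.N) : 0 ≤ variationBound p n :=
  (add_nonneg (mul_nonneg (Real.sqrt_nonneg _) (l2_nonneg _))
    (mul_nonneg (step_pos _ _).le (l2_nonneg _))).trans (phase_bound_le p Phase.nw n)

variable {p u}

/-- The flow equation is tested with the same vψ on every step between j and k, and the steps are
summed. The cut-off removes all fracture terms; sources and fluxes bound each increment of the mass.
-/
theorem abs_mass_difference_le {κ : ℝ} (hκ0 : 0 ≤ κ)
    (hκ : ∀ (α : Phase) (k : Fin (D.grid.N + 1)) (v w : D.X),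
      |∫ x, Q.ηm α (D.recM (sM p α k) x) * inner ℝ (Q.K x (D.gradM v x)) (D.gradM w x) ∂Q.vol| ≤
        κ * (l2 Q.vol (D.gradM v) * l2 Q.vol (D.gradM w)))
    {β : Phase} (hflow : FlowEquation p u β) {ψ : D.X} (hψ : VanishesOnFractures D ψ) (v : D.X)
    {j k : Fin (D.grid.N + 1)} (hjk : j ≤ k) :
    |∫ x, (porosity p u k x * D.recM (sM p β k) x - porosity p u j x * D.recM (sM p β j) x)
      * D.recM (v * ψ) x ∂Q.vol| ≤
    (l2 Q.vol (D.recM (v * ψ)) + κ * l2 Q.vol (D.gradM (v * ψ)))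
      * ∑ n with j ≤ n.castSucc ∧ n.succ ≤ k, variationBound p n := by
  set χ := v * ψ with hχ
  set G : Fin (D.grid.N + 1) → ℝ := fun k =>
    ∫ x, porosity p u k x * D.recM (sM p β k) x * D.recM χ x ∂Q.vol with hG
  have hGsub : ∀ k j, ∫ x, (porosity p u k x * D.recM (sM p β k) x
      - porosity p u j x * D.recM (sM p β j) x) * D.recM χ x ∂Q.vol = G k - G j := by
    intro k j
    have h := integral_sub ((memLp_porosity_mul p u k (sM p β k)).integrable_mul
      (memLp_recM D χ 2 Q.vol)) ((memLp_porosity_mul p u j (sM p β j)).integrable_mul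
      (memLp_recM D χ 2 Q.vol))
    simp only [hG, sub_mul]
    exact h
  rw [hGsub, Finset.mul_sum]
  refine abs_sub_le_sum_filter (fun n => ?_) hjk
  have h := flow_step hflow n χ
  have hF : l2 Q.surf (D.recF χ) = 0 := by
    have h0 : D.recF χ =ᵐ[Q.surf] 0 := (hψ v).1
    rw [l2, eLpNorm_congr_ae h0]
    simp
  have hz1 : ∫ x, (aperture u n.succ x * D.recF (sF p β n.succ) x
        - aperture u n.castSucc x * D.recF (sF p β n.castSucc) x) * D.recF χ x ∂Q.surf = 0 :=
    integral_eq_zero_of_ae ((hψ v).1.mono fun x hx => by simp [hχ, hx])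
  have hz2 : ∫ x, Q.ηf β (D.recF (sF p β n.succ) x) * (aperture u n.succ x ^ 3 / 12)
          * inner ℝ (D.gradF (p β n.succ) x) (D.gradF χ x) ∂Q.surf = 0 :=
    integral_eq_zero_of_ae ((hψ v).2.mono fun x hx => by simp [hχ, hx])
  rw [hz1, hz2, hGsub, mul_zero, add_zero, add_zero] at h
  have hs := abs_source_le (D := D) β n χ
  rw [hF, mul_zero, add_zero] at hs
  have hk := mul_le_mul_of_nonneg_left (hκ β n.succ (p β n.succ) χ) (step_pos D.grid n).le
  have h0 := step_pos D.grid n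
  have hm : 0 ≤ l2 Q.vol (D.recM χ) := l2_nonneg _
  have hg : 0 ≤ l2 Q.vol (D.gradM χ) := l2_nonneg _
  calc |G n.succ - G n.castSucc| = |source D β n χ - step D.grid n *
          ∫ x, Q.ηm β (D.recM (sM p β n.succ) x)
            * inner ℝ (Q.K x (D.gradM (p β n.succ) x)) (D.gradM χ x) ∂Q.vol| := by
        rw [← h]; congr 1; ring
    _ ≤ |source D β n χ| + step D.grid n * |∫ x, Q.ηm β (D.recM (sM p β n.succ) x)
            * inner ℝ (Q.K x (D.gradM (p β n.succ) x)) (D.gradM χ x) ∂Q.vol| := by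
        refine (abs_sub _ _).trans (le_of_eq ?_)
        rw [abs_mul, abs_of_pos h0]
    _ ≤ √(step D.grid n) * sourceNormM D β n * l2 Q.vol (D.recM χ) +
        step D.grid n * (κ * (l2 Q.vol (D.gradM (p β n.succ)) * l2 Q.vol (D.gradM χ))) :=
        add_le_add hs hk
    _ ≤ (l2 Q.vol (D.recM χ) + κ * l2 Q.vol (D.gradM χ)) *
        (√(step D.grid n) * sourceNormM D β n
          + step D.grid n * l2 Q.vol (D.gradM (p β n.succ))) := by
        have h1 : 0 ≤ √(step D.grid n) * sourceNormM D β n :=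
          mul_nonneg (Real.sqrt_nonneg _) (l2_nonneg _)
        have h2 : 0 ≤ step D.grid n * l2 Q.vol (D.gradM (p β n.succ)) :=
          mul_nonneg h0.le (l2_nonneg _)
        have h3 := mul_nonneg h1 (mul_nonneg hκ0 hg)
        have h4 := mul_nonneg h2 hm
        linarith
    _ ≤ _ := mul_le_mul_of_nonneg_left (phase_bound_le p β n) (by positivity)

variable (p) in
/-- The size of the pressure gradients in the matrix at one time. -/
def gradBound (k : Fin (D.grid.N + 1)) : ℝ :=
  l2 Q.vol (D.gradM (p Phase.nw k)) + l2 Q.vol (D.gradM (p Phase.w k))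

theorem gradBound_nonneg (k) : 0 ≤ gradBound p k := add_nonneg (l2_nonneg _) (l2_nonneg _)

theorem l2_gradM_pc_le (k) : l2 Q.vol (D.gradM (pc p k)) ≤ gradBound p k := by
  rw [pc, map_sub]
  exact l2_sub_le (memLp_gradM D _) (memLp_gradM D _)

theorem l2_gradM_add_le (v w : D.X) :
    l2 Q.vol (D.gradM (v + w)) ≤ l2 Q.vol (D.gradM v) + l2 Q.vol (D.gradM w) := by
  rw [map_add]
  exact l2_add_le (memLp_gradM D _) (memLp_gradM D _)

theorem l2_gradM_sub_le (v w : D.X) :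
    l2 Q.vol (D.gradM (v - w)) ≤ l2 Q.vol (D.gradM v) + l2 Q.vol (D.gradM w) := by
  rw [map_sub]
  exact l2_sub_le (memLp_gradM D _) (memLp_gradM D _)

theorem l2_gradM_smul (c : ℝ) (v : D.X) :
    l2 Q.vol (D.gradM (c • v)) = |c| * l2 Q.vol (D.gradM v) := by
  rw [map_smul, l2_smul]

/-- Gradient bounds for the products of saturations with a cut-off. -/
theorem cutoff_products (D : FlowGD Q) (p : FlowUnknown D) (α : Phase) {CF CP Cψ B : ℝ}
    (hCF0 : 0 ≤ CF) (hCP0 : 0 ≤ CP) (hCψ0 : 0 ≤ Cψ) (hB0 : 0 ≤ B)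
    (hCF : ∀ v : D.X, l2 Q.vol (D.gradM fun i => sat Q.Sm α (v i) - sat Q.Sm α 0) ≤
      CF * l2 Q.vol (D.gradM v))
    (hCP : ∀ v w : D.X, l2 Q.vol (D.gradM (v * w)) ≤
      CP * (‖v‖ * l2 Q.vol (D.gradM w) + ‖w‖ * l2 Q.vol (D.gradM v)))
    {ψ : D.X} (hψ : ‖ψ‖ ≤ B) (hψ' : l2 Q.vol (D.gradM ψ) ≤ Cψ) (j k : Fin (D.grid.N + 1)) :
    l2 Q.vol (D.gradM (sM p α k * ψ)) ≤
      (Cψ + CP * (Cψ + B * CF)) * (1 + gradBound p k) ∧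
    l2 Q.vol (D.gradM ((sM p α k - sM p α j) * ψ)) ≤
      CP * (Cψ + B * CF) * (1 + gradBound p k + gradBound p j) ∧
    l2 Q.vol (D.gradM (sM p α j * (sM p α k - sM p α j) * ψ)) ≤
      (CP * (Cψ + B * CF) + CP * (Cψ + B * (CP * (2 * CF))))
        * (1 + gradBound p k + gradBound p j) := by
  -- The chain rule requires a function vanishing at 0, and nothing bounds the discrete gradient of
  -- a constant. So s is split as c + y: the part y obeys the chain rule, and c only ever multiplies
  -- ψ or a difference times ψ.
  set c := sat Q.Sm α 0 with hc
  have hc01 : |c| ≤ 1 := by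
    have := sat_mem Q.Sm_sat α 0
    rw [abs_of_nonneg this.1]; exact this.2
  set y : Fin (D.grid.N + 1) → D.X := fun k i => sat Q.Sm α (pc p k i) - c with hy
  have hsy : ∀ k, sM p α k = (fun _ => c) + y k := fun k => by ext i; simp [hy, sM]
  have hy1 : ∀ k, ‖y k‖ ≤ 1 := fun k => by
    refine (pi_norm_le_iff_of_nonneg zero_le_one).2 fun i => ?_
    have h1 := sat_mem Q.Sm_sat α (pc p k i)
    have h2 := sat_mem Q.Sm_sat α 0
    rw [Real.norm_eq_abs, abs_le]
    simp only [mem_Icc, hy] at *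
    constructor <;> linarith
  have hd1 : ∀ k j, ‖y k - y j‖ ≤ 1 := fun k j => by
    refine (pi_norm_le_iff_of_nonneg zero_le_one).2 fun i => ?_
    have h1 := sat_mem Q.Sm_sat α (pc p k i)
    have h2 := sat_mem Q.Sm_sat α (pc p j i)
    rw [Real.norm_eq_abs, abs_le]
    simp only [mem_Icc, hy, Pi.sub_apply] at *
    constructor <;> linarith
  have hyg : ∀ k, l2 Q.vol (D.gradM (y k)) ≤ CF * gradBound p k := fun k =>
    (hCF (pc p k)).trans (mul_le_mul_of_nonneg_left (l2_gradM_pc_le k) hCF0)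
  have hw := gradBound_nonneg (p := p)
  have hprod : ∀ (v : D.X) {g : ℝ}, 0 ≤ g → ‖v‖ ≤ 1 → l2 Q.vol (D.gradM v) ≤ g →
      l2 Q.vol (D.gradM (v * ψ)) ≤ CP * (Cψ + B * g) := by
    intro v g hg hv hvg
    refine (hCP v ψ).trans (mul_le_mul_of_nonneg_left (add_le_add ?_ ?_) hCP0)
    · have := mul_le_mul hv hψ' (l2_nonneg _) zero_le_one
      rwa [one_mul] at this
    · exact mul_le_mul hψ hvg (l2_nonneg _) hB0
  have hdg : l2 Q.vol (D.gradM (y k - y j)) ≤ CF * (gradBound p k + gradBound p j) := by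
    rw [mul_add]
    exact (l2_gradM_sub_le _ _).trans (add_le_add (hyg k) (hyg j))
  have hdiff : sM p α k - sM p α j = y k - y j := by rw [hsy, hsy]; abel
  have hχ1 : l2 Q.vol (D.gradM ((y k - y j) * ψ)) ≤
      CP * (Cψ + B * CF) * (1 + gradBound p k + gradBound p j) := by
    have h1 := hprod _ (mul_nonneg hCF0 (add_nonneg (hw k) (hw j))) (hd1 k j) hdg
    have h2 : 0 ≤ CP * Cψ * (gradBound p k + gradBound p j) :=
      mul_nonneg (mul_nonneg hCP0 hCψ0) (add_nonneg (hw k) (hw j))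
    have h3 : 0 ≤ CP * (B * CF) := by positivity
    linarith
  refine ⟨?_, by rwa [hdiff], ?_⟩
  · have e : sM p α k * ψ = c • ψ + y k * ψ := by
      rw [hsy]; ext i; simp; ring
    rw [e]
    have h1 := hprod _ (mul_nonneg hCF0 (hw k)) (hy1 k) (hyg k)
    have h2 : |c| * l2 Q.vol (D.gradM ψ) ≤ 1 * Cψ :=
      mul_le_mul hc01 hψ' (l2_nonneg _) zero_le_one
    have h3 := l2_gradM_add_le (c • ψ) (y k * ψ)
    rw [l2_gradM_smul] at h3
    have h4 : 0 ≤ Cψ * gradBound p k := mul_nonneg hCψ0 (hw k)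
    have h5 : 0 ≤ CP * Cψ * gradBound p k := mul_nonneg (mul_nonneg hCP0 hCψ0) (hw k)
    have h6 : 0 ≤ CP * (B * CF) := by positivity
    linarith
  · have e : sM p α j * (sM p α k - sM p α j) * ψ =
        c • ((y k - y j) * ψ) + y j * (y k - y j) * ψ := by
      rw [hdiff, hsy]; ext i; simp; ring
    rw [e]
    have hyy : ‖y j * (y k - y j)‖ ≤ 1 :=
      (norm_mul_le _ _).trans (mul_le_one₀ (hy1 j) (norm_nonneg _) (hd1 k j))
    have hyyg : l2 Q.vol (D.gradM (y j * (y k - y j))) ≤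
        CP * (2 * CF) * (gradBound p k + gradBound p j) := by
      have h1 := hCP (y j) (y k - y j)
      have h2 : ‖y j‖ * l2 Q.vol (D.gradM (y k - y j)) ≤
          1 * (CF * (gradBound p k + gradBound p j)) :=
        mul_le_mul (hy1 j) hdg (l2_nonneg _) zero_le_one
      have h3 : ‖y k - y j‖ * l2 Q.vol (D.gradM (y j)) ≤ 1 * (CF * gradBound p j) :=
        mul_le_mul (hd1 k j) (hyg j) (l2_nonneg _) zero_le_one
      have h4 : 0 ≤ CF * gradBound p k := mul_nonneg hCF0 (hw k)
      have h5 := mul_le_mul_of_nonneg_left (add_le_add h2 h3) hCP0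
      have h6 : 0 ≤ CP * (CF * gradBound p k) := mul_nonneg hCP0 h4
      linarith
    have h1 := hprod _ (mul_nonneg (by positivity) (add_nonneg (hw k) (hw j))) hyy hyyg
    have h2 : |c| * l2 Q.vol (D.gradM ((y k - y j) * ψ)) ≤
        1 * (CP * (Cψ + B * CF) * (1 + gradBound p k + gradBound p j)) :=
      mul_le_mul hc01 hχ1 (l2_nonneg _) zero_le_one
    have h3 := l2_gradM_add_le (c • ((y k - y j) * ψ)) (y j * (y k - y j) * ψ)
    rw [l2_gradM_smul] at h3
    have h4 : 0 ≤ CP * Cψ * (gradBound p k + gradBound p j) :=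
      mul_nonneg (mul_nonneg hCP0 hCψ0) (add_nonneg (hw k) (hw j))
    have h5 : 0 ≤ CP * (B * (CP * (2 * CF))) := by positivity
    linarith

/-- Pointwise, φ_k (s_k − s_j)²ψ equals (φ_k s_k − φ_j s_j)(s_k − s_j)ψ − (φ_k − φ_j) s_j (s_k −
s_j)ψ. The porosity increment is the sum of the mass increments of the two phases, so no estimate on
the porosity in time is needed: three tested flow equations suffice, each contributing one Λ. -/
theorem weighted_difference_le (α : Phase) {φmin Λ κ : ℝ} (hκ0 : 0 ≤ κ)
    (hκ : ∀ (α : Phase) (k : Fin (D.grid.N + 1)) (v w : D.X),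
      |∫ x, Q.ηm α (D.recM (sM p α k) x) * inner ℝ (Q.K x (D.gradM v x)) (D.gradM w x) ∂Q.vol| ≤
        κ * (l2 Q.vol (D.gradM v) * l2 Q.vol (D.gradM w)))
    (hflow : ∀ α, FlowEquation p u α) {ψ : D.X} (hψ : VanishesOnFractures D ψ)
    (hψ0 : ∀ᵐ x ∂Q.vol, 0 ≤ D.recM ψ x) {j k : Fin (D.grid.N + 1)} (hjk : j ≤ k)
    (hpor : ∀ᵐ x ∂Q.vol, φmin ≤ porosity p u k x)
    (h1 : l2 Q.vol (D.recM ((sM p α k - sM p α j) * ψ))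
      + κ * l2 Q.vol (D.gradM ((sM p α k - sM p α j) * ψ)) ≤ Λ)
    (h2 : l2 Q.vol (D.recM (sM p α j * (sM p α k - sM p α j) * ψ))
      + κ * l2 Q.vol (D.gradM (sM p α j * (sM p α k - sM p α j) * ψ)) ≤ Λ) :
    φmin * ∫ x, D.recM ψ x * (D.recM (sM p α k) x - D.recM (sM p α j) x) ^ 2 ∂Q.vol ≤
      3 * Λ * ∑ n with j ≤ n.castSucc ∧ n.succ ≤ k, variationBound p n := by
  set S := ∑ n with j ≤ n.castSucc ∧ n.succ ≤ k, variationBound p n with hS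
  have hS0 : 0 ≤ S := Finset.sum_nonneg fun n _ => variationBound_nonneg p n
  have b1 := abs_mass_difference_le hκ0 hκ (hflow α) hψ (sM p α k - sM p α j) hjk
  have b2 := abs_mass_difference_le hκ0 hκ (hflow Phase.nw) hψ (sM p α j * (sM p α k - sM p α j)) hjk
  have b3 := abs_mass_difference_le hκ0 hκ (hflow Phase.w) hψ (sM p α j * (sM p α k - sM p α j)) hjk
  replace b1 := b1.trans (mul_le_mul_of_nonneg_right h1 hS0)
  replace b2 := b2.trans (mul_le_mul_of_nonneg_right h2 hS0)
  replace b3 := b3.trans (mul_le_mul_of_nonneg_right h2 hS0)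
  have i1 := integrable_porosity_test p u α k j ((sM p α k - sM p α j) * ψ)
  have i2 := integrable_porosity_test p u Phase.nw k j (sM p α j * (sM p α k - sM p α j) * ψ)
  have i3 := integrable_porosity_test p u Phase.w k j (sM p α j * (sM p α k - sM p α j) * ψ)
  have hint : Integrable (fun x => φmin * (D.recM ψ x
      * (D.recM (sM p α k) x - D.recM (sM p α j) x) ^ 2)) Q.vol := by
    have e : (fun x => φmin * (D.recM ψ x * (D.recM (sM p α k) x - D.recM (sM p α j) x) ^ 2)) =
        fun x => φmin * D.recM (ψ * (sM p α k - sM p α j) ^ 2) x := by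
      ext x
      rcases recM_cases D x with h | ⟨i, h⟩ <;> simp [h]
    rw [e]
    exact ((memLp_recM D _ 1 Q.vol).integrable le_rfl).const_mul _
  have hle : φmin * ∫ x, D.recM ψ x * (D.recM (sM p α k) x - D.recM (sM p α j) x) ^ 2 ∂Q.vol ≤
      ∫ x, ((porosity p u k x * D.recM (sM p α k) x - porosity p u j x * D.recM (sM p α j) x)
          * D.recM ((sM p α k - sM p α j) * ψ) x
        - (porosity p u k x * D.recM (sM p Phase.nw k) x
            - porosity p u j x * D.recM (sM p Phase.nw j) x)
          * D.recM (sM p α j * (sM p α k - sM p α j) * ψ) x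
        - (porosity p u k x * D.recM (sM p Phase.w k) x
            - porosity p u j x * D.recM (sM p Phase.w j) x)
          * D.recM (sM p α j * (sM p α k - sM p α j) * ψ) x) ∂Q.vol := by
    rw [← integral_const_mul]
    refine integral_mono_ae hint ((i1.sub i2).sub i3) ?_
    filter_upwards [hψ0, hpor] with x hx hφ
    rcases recM_cases D x with h | ⟨i, h⟩
    · simp [h]
    · simp only [h, Pi.mul_apply, Pi.sub_apply] at hx ⊢
      have h3 : 0 ≤ ψ i * (sM p α k i - sM p α j i) ^ 2 := mul_nonneg hx (sq_nonneg _)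
      have h4 := mul_le_mul_of_nonneg_right hφ h3
      -- Saturations summing to 1 turn the two subtracted terms into the porosity increment. This
      -- holds at coordinates; off the cells every term vanishes.
      have e1 : sM p Phase.w k i = 1 - sM p Phase.nw k i := rfl
      have e2 : sM p Phase.w j i = 1 - sM p Phase.nw j i := rfl
      rw [e1, e2]
      linarith
  have hsp1 := integral_sub (i1.sub i2) i3
  have hsp2 := integral_sub i1 i2
  simp only [Pi.sub_apply] at hsp1
  rw [hsp1, hsp2] at hle
  linarith [(abs_le.1 b1).2, (abs_le.1 b2).1, (abs_le.1 b3).1]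

end Translates

/-! ### Finite nets and relative compactness -/

section Nets

variable {X : Type*} [MeasurableSpace X]

/-- In a complete space, relative compactness is total boundedness; the finitely many terms not
reached by a net are added to it as their own centres. -/
theorem relCompactL2_of_finite_nets {μ : Measure X} {f : ℕ → X → ℝ} (hf : ∀ l, MemLp (f l) 2 μ)
    (h : ∀ ε : ℝ, 0 < ε → ∃ F : Set (X → ℝ), F.Finite ∧ (∀ g ∈ F, MemLp g 2 μ) ∧
      ∀ᶠ l in atTop, ∃ g ∈ F, l2 μ (f l - g) ≤ ε) : RelCompactL2 μ f := by
  classical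
  refine ⟨hf, TotallyBounded.isCompact_of_isClosed (TotallyBounded.closure ?_) isClosed_closure⟩
  rw [Metric.totallyBounded_iff]
  intro ε hε
  obtain ⟨F, hF, hFm, hev⟩ := h (ε / 2) (half_pos hε)
  obtain ⟨L, hL⟩ := eventually_atTop.1 hev
  refine ⟨(fun g : X → ℝ => if hg : MemLp g 2 μ then hg.toLp g else 0) '' F ∪
    (fun l => (hf l).toLp (f l)) '' Iio L, (hF.image _).union ((finite_Iio L).image _), ?_⟩
  rintro _ ⟨l, rfl⟩
  rw [mem_iUnion₂]
  by_cases hl : L ≤ l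
  · obtain ⟨g, hg, hd⟩ := hL l hl
    have hgm := hFm g hg
    refine ⟨hgm.toLp g, Or.inl ⟨g, hg, by simp [hgm]⟩, ?_⟩
    rw [Metric.mem_ball, dist_eq_norm]
    dsimp only
    rw [← MemLp.toLp_sub, ← l2_eq_norm]
    linarith
  · exact ⟨_, Or.inr ⟨l, not_le.1 hl, rfl⟩, Metric.mem_ball_self hε⟩

theorem l2_sub_sq_le {μ : Measure X} {f g h : X → ℝ} (hf : MemLp f 2 μ) (hg : MemLp g 2 μ)
    (hh : MemLp h 2 μ) : l2 μ (f - h) ^ 2 ≤ 2 * l2 μ (f - g) ^ 2 + 2 * l2 μ (g - h) ^ 2 := by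
  have h1 := l2_add_le (hf.sub hg) (hg.sub hh)
  rw [sub_add_sub_cancel] at h1
  have h2 := pow_le_pow_left₀ (l2_nonneg _) h1 2
  have h3 := sq_nonneg (l2 μ (f - g) - l2 μ (g - h))
  linarith

/-- An Aubin-Simon type criterion: time-dependent functions with controlled oscillations on short time
intervals, whose values lie in sets with finite nets, have finite nets in space-time. -/
theorem exists_spacetime_net {ν : Measure X} [IsFiniteMeasure ν] {T A C : ℝ} (hT : 0 < T)
    (hA : 0 ≤ A) {f : ℕ → ℝ → X → ℝ} {w : ℕ → ℝ → ℝ} {γ : ℕ → ℝ → ℝ → ℝ}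
    (hf : ∀ l, MemLp (fun z : ℝ × X => f l z.1 z.2) 2 ((volume.restrict (Ioc 0 T)).prod ν))
    (hft : ∀ l t, MemLp (f l t) 2 ν)
    (hw : ∀ l, MemLp (w l) 2 (volume.restrict (Ioc 0 T)))
    (hwC : ∀ l, l2 (volume.restrict (Ioc 0 T)) (w l) ≤ C)
    (hγ0 : ∀ l a b, 0 ≤ γ l a b)
    (hγC : ∀ l m h, 0 ≤ h → ∑ i ∈ Finset.range m, γ l (i * h) ((i + 1 : ℕ) * h) ≤ C)
    (hosc : ∀ᶠ l in atTop, ∀ a b, ∀ s ∈ Ioc 0 T, ∀ t ∈ Ioc 0 T, s ∈ Ioc a b → t ∈ Ioc a b →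
      l2 ν (f l t - f l s) ^ 2 ≤ A * (w l t + w l s) * γ l a b)
    (hnet : ∀ R ε : ℝ, 0 < ε → ∃ F : Set (X → ℝ), F.Finite ∧ (∀ g ∈ F, MemLp g 2 ν) ∧
      ∀ᶠ l in atTop, ∀ s ∈ Ioc 0 T, w l s ≤ R → ∃ g ∈ F, l2 ν (f l s - g) ≤ ε)
    {ε : ℝ} (hε : 0 < ε) :
    ∃ F : Set (ℝ × X → ℝ), F.Finite ∧
      (∀ g ∈ F, MemLp g 2 ((volume.restrict (Ioc 0 T)).prod ν)) ∧
      ∀ᶠ l in atTop, ∃ g ∈ F,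
        l2 ((volume.restrict (Ioc 0 T)).prod ν) ((fun z : ℝ × X => f l z.1 z.2) - g) ≤ ε := by
  have hC0 : 0 ≤ C := (l2_nonneg _).trans (hwC 0)
  -- With intervals of length h = T/m, the total squared oscillation will be at most 4AC²√h. It
  -- takes half of ε².
  obtain ⟨m, hm0, hm⟩ : ∃ m : ℕ, 0 < m ∧ 4 * A * C * C * √(T / m) ≤ ε ^ 2 / 2 := by
    have h1 : Tendsto (fun m : ℕ => 4 * A * C * C * √(T / m)) atTop (𝓝 (4 * A * C * C * √0)) :=
      ((tendsto_const_div_atTop_nhds_zero_nat T).sqrt).const_mul _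
    rw [Real.sqrt_zero, mul_zero] at h1
    have h2 := h1.eventually (gt_mem_nhds (by positivity : 0 < ε ^ 2 / 2))
    obtain ⟨m, h3, h4⟩ := (h2.and (eventually_gt_atTop 0)).exists
    exact ⟨m, h4, h3.le⟩
  have hm' : (0 : ℝ) < m := by exact_mod_cast hm0
  set h := T / m with hh
  have hh0 : 0 < h := by positivity
  have hmh : m * h = T := by rw [hh]; field_simp
  -- By Cauchy–Schwarz the integral of w over an interval of length h is at most C√h, so its mean is
  -- at most C√h/h. The tolerance η satisfies 2Tη² = ε²/2, the other half of ε².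
  obtain ⟨F, hFfin, hFm, hFev⟩ := hnet (C * √h / h) (ε / √(4 * T)) (by positivity)
  set J : ℕ → Set ℝ := fun i => Ioc (i * h) ((i + 1 : ℕ) * h) with hJ
  have hJlen : ∀ i : ℕ, ((i + 1 : ℕ) : ℝ) * h - i * h = h := fun i => by push_cast; ring
  have hJle : ∀ i : ℕ, (i : ℝ) * h ≤ ((i + 1 : ℕ) : ℝ) * h := fun i => by
    linarith [hJlen i]
  have hJsub : ∀ i < m, J i ⊆ Ioc 0 T := by
    intro i hi t ht
    refine ⟨lt_of_le_of_lt (by positivity) ht.1, ht.2.trans ?_⟩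
    rw [← hmh]
    exact mul_le_mul_of_nonneg_right (by exact_mod_cast hi) hh0.le
  have hJdisj : ∀ i j t, t ∈ J i → t ∈ J j → i = j := by
    have : ∀ i j t, t ∈ J i → t ∈ J j → i ≤ j := by
      intro i j t hi hj
      by_contra hlt
      have h1 : ((j + 1 : ℕ) : ℝ) * h ≤ i * h :=
        mul_le_mul_of_nonneg_right (by exact_mod_cast not_le.1 hlt) hh0.le
      exact absurd (hj.2.trans h1) (not_le.2 hi.1)
    exact fun i j t hi hj => le_antisymm (this i j t hi hj) (this j i t hj hi)
  -- The space-time net: functions constant in time on each interval with values in F. There are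
  -- finitely many, as m and F are fixed before l.
  set G : (Fin m → X → ℝ) → ℝ × X → ℝ := fun g z =>
    ∑ i : Fin m, (J i).indicator (fun _ => (1 : ℝ)) z.1 * g i z.2 with hG
  have hGt : ∀ g (i : Fin m) t, t ∈ J i → ∀ x, G g (t, x) = g i x := by
    intro g i t ht x
    simp only [hG]
    rw [Finset.sum_eq_single i]
    · simp [ht]
    · intro j _ hj
      rw [indicator_of_notMem fun hjt => hj (Fin.ext (hJdisj _ _ t hjt ht)), zero_mul]
    · simp
  have hGm : ∀ g : Fin m → X → ℝ, (∀ i, g i ∈ F) →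
      MemLp (G g) 2 ((volume.restrict (Ioc 0 T)).prod ν) := by
    intro g hg
    refine memLp_finsetSum _ fun i _ => ?_
    have h1 := memLp_comp_snd (τ := volume.restrict (Ioc 0 T)) (hFm _ (hg i))
    have h2 : MemLp (fun z : ℝ × X => (J i).indicator (fun _ => (1 : ℝ)) z.1) ∞
        ((volume.restrict (Ioc 0 T)).prod ν) := by
      refine MemLp.of_bound ((measurable_const.indicator measurableSet_Ioc).comp
        measurable_fst).aestronglyMeasurable 1 (ae_of_all _ fun z => ?_)
      exact (norm_indicator_le_norm_self _ _).trans (by simp)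
    exact h1.mul' h2
  refine ⟨G '' {g | ∀ i, g i ∈ F}, ?_, ?_, ?_⟩
  · refine Finite.image _ ?_
    have := Set.Finite.pi (ι := Fin m) (t := fun _ => F) fun _ => hFfin
    simpa [Set.pi] using this
  · rintro _ ⟨g, hg, rfl⟩
    exact hGm g hg
  filter_upwards [hosc, hFev] with l hosc hFev
  have hwi : ∀ i < m, IntervalIntegrable (w l) volume (i * h) ((i + 1 : ℕ) * h) := by
    intro i hi
    rw [intervalIntegrable_iff_integrableOn_Ioc_of_le (hJle i)]
    exact IntegrableOn.mono_set ((hw l).integrable one_le_two) (hJsub i hi)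
  have hω : ∀ i < m, ∫ t in (i * h)..((i + 1 : ℕ) * h), w l t ≤ C * √h := by
    intro i hi
    rw [intervalIntegral.integral_of_le (hJle i)]
    have hr : volume.restrict (J i) ≤ volume.restrict (Ioc 0 T) :=
      Measure.restrict_mono (hJsub i hi) le_rfl
    have h1 := abs_integral_mul_le ((hw l).mono_measure hr)
      (memLp_const (μ := volume.restrict (J i)) (1 : ℝ))
    simp only [mul_one] at h1
    refine (le_abs_self _).trans (h1.trans (mul_le_mul ?_ ?_ (l2_nonneg _) hC0))
    · exact (ENNReal.toReal_mono (hw l).2.ne (eLpNorm_mono_measure _ hr)).trans (hwC l)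
    · have h2 := l2_le_of_bound (μ := volume.restrict (J i)) (f := fun _ : ℝ => (1 : ℝ))
        zero_le_one (ae_of_all _ fun _ => by simp)
      rwa [one_mul, measureReal_restrict_apply_univ, Real.volume_real_Ioc_of_le (hJle i),
        hJlen] at h2
  -- Each interval contains a time at which w does not exceed its mean. The function is frozen
  -- there: its value has a finite net, and w at that time is again paid for by the integral of w.
  have hs : ∀ i : Fin m, ∃ s ∈ J i, w l s * h ≤ ∫ t in (i * h : ℝ)..((i + 1 : ℕ) * h), w l t := by
    intro i
    have hvol : volume (J i) ≠ 0 := by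
      rw [Real.volume_Ioc, hJlen]; simpa using hh0
    obtain ⟨s, hs, hle⟩ := exists_le_setAverage hvol measure_Ioc_lt_top.ne
      ((intervalIntegrable_iff_integrableOn_Ioc_of_le (hJle i)).1 (hwi i i.2))
    refine ⟨s, hs, ?_⟩
    rw [setAverage_eq, Real.volume_real_Ioc_of_le (hJle i), hJlen, smul_eq_mul, inv_mul_eq_div,
      le_div_iff₀ hh0] at hle
    rwa [intervalIntegral.integral_of_le (hJle i)]
  choose s hsJ hsw using hs
  have hg : ∀ i : Fin m, ∃ g ∈ F, l2 ν (f l (s i) - g) ≤ ε / √(4 * T) := fun i =>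
    hFev (s i) (hJsub i i.2 (hsJ i)) (by
      rw [le_div_iff₀ hh0]; exact (hsw i).trans (hω i i.2))
  choose g hgF hgd using hg
  refine ⟨G g, ⟨g, hgF, rfl⟩, ?_⟩
  set Φ : ℝ × X → ℝ := (fun z : ℝ × X => f l z.1 z.2) - G g with hΦ
  have hΦm : MemLp Φ 2 ((volume.restrict (Ioc 0 T)).prod ν) := (hf l).sub (hGm g hgF)
  have hΦi : Integrable (fun z => ‖Φ z‖ ^ 2) ((volume.restrict (Ioc 0 T)).prod ν) :=
    hΦm.integrable_norm_pow (by norm_num)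
  have hNi : IntegrableOn (fun t => ∫ x, ‖Φ (t, x)‖ ^ 2 ∂ν) (Ioc 0 T) := hΦi.integral_prod_left
  have hNii : ∀ i < m, IntervalIntegrable (fun t => ∫ x, ‖Φ (t, x)‖ ^ 2 ∂ν) volume
      (i * h) ((i + 1 : ℕ) * h) := by
    intro i hi
    rw [intervalIntegrable_iff_integrableOn_Ioc_of_le (hJle i)]
    exact hNi.mono_set (hJsub i hi)
  have hsum : l2 ((volume.restrict (Ioc 0 T)).prod ν) Φ ^ 2 =
      ∑ i ∈ Finset.range m, ∫ t in (i * h)..((i + 1 : ℕ) * h), ∫ x, ‖Φ (t, x)‖ ^ 2 ∂ν := by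
    rw [l2_sq hΦm, integral_prod _ hΦi, ← intervalIntegral.integral_of_le hT.le]
    have := intervalIntegral.sum_integral_adjacent_intervals (a := fun i : ℕ => (i : ℝ) * h) hNii
    simp only [Nat.cast_zero, zero_mul, hmh] at this
    exact this.symm
  have hpiece : ∀ i ∈ Finset.range m,
      ∫ t in (i * h)..((i + 1 : ℕ) * h), ∫ x, ‖Φ (t, x)‖ ^ 2 ∂ν ≤
        4 * A * (C * √h) * γ l (i * h) ((i + 1 : ℕ) * h) + ε ^ 2 / (2 * T) * h := by
    intro i hi
    rw [Finset.mem_range] at hi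
    set c := γ l (i * h) ((i + 1 : ℕ) * h) with hc
    have hc0 : 0 ≤ c := hγ0 _ _ _
    have hii : IntervalIntegrable (fun t => 2 * A * c * w l t
        + (2 * A * c * w l (s ⟨i, hi⟩) + ε ^ 2 / (2 * T))) volume (i * h) ((i + 1 : ℕ) * h) :=
      ((hwi i hi).const_mul _).add intervalIntegrable_const
    have hmono := intervalIntegral.integral_mono_on_of_le_Ioo (hJle i) (hNii i hi) hii (by
      intro t ht
      have htJ : t ∈ J i := Ioo_subset_Ioc_self ht
      have hN : ∫ x, ‖Φ (t, x)‖ ^ 2 ∂ν = l2 ν (f l t - g ⟨i, hi⟩) ^ 2 := by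
        rw [l2_sq ((hft l t).sub (hFm _ (hgF _)))]
        refine integral_congr_ae (ae_of_all _ fun x => ?_)
        have := hGt g ⟨i, hi⟩ t htJ x
        simp [hΦ, this]
      rw [hN]
      have h1 := l2_sub_sq_le (hft l t) (hft l (s ⟨i, hi⟩)) (hFm _ (hgF ⟨i, hi⟩))
      have h2 := hosc _ _ (s ⟨i, hi⟩) (hJsub i hi (hsJ ⟨i, hi⟩)) t (hJsub i hi htJ)
        (hsJ ⟨i, hi⟩) htJ
      have h3 := pow_le_pow_left₀ (l2_nonneg _) (hgd ⟨i, hi⟩) 2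
      rw [div_pow, Real.sq_sqrt (by positivity)] at h3
      have e : ε ^ 2 / (2 * T) = 2 * (ε ^ 2 / (4 * T)) := by field_simp; ring
      rw [e]
      linarith)
    refine hmono.trans ?_
    rw [intervalIntegral.integral_add ((hwi i hi).const_mul _) intervalIntegrable_const,
      intervalIntegral.integral_const_mul, intervalIntegral.integral_const, hJlen, smul_eq_mul]
    have hk : 0 ≤ 2 * A * c := by positivity
    have h1 := mul_le_mul_of_nonneg_left (hω i hi) hk
    have h2 := mul_le_mul_of_nonneg_left ((hsw ⟨i, hi⟩).trans (hω i hi)) hk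
    linarith
  have htot := Finset.sum_le_sum hpiece
  rw [← hsum, Finset.sum_add_distrib, ← Finset.mul_sum, Finset.sum_const, Finset.card_range,
    nsmul_eq_mul] at htot
  have h1 := mul_le_mul_of_nonneg_left (hγC l m h hh0.le)
    (by positivity : 0 ≤ 4 * A * (C * √h))
  have h2 : (m : ℝ) * (ε ^ 2 / (2 * T) * h) = ε ^ 2 / 2 := by
    rw [mul_left_comm, hmh]; field_simp
  refine le_of_sq_le_sq ?_ hε.le
  linarith

end Nets

/-! ### From local compactness of sequences to uniform nets -/

section LocalNets

variable {d : ℕ} {Q : Model d}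

/-- Local compactness yields finite nets that are uniform in the discretization. -/
theorem LocallyCompact.exists_net {D : ℕ → FlowGD Q} (hD : LocallyCompact D) {K : Set (Vec d)}
    (hK : IsCompact K) (hKΩ : K ⊆ Q.Ω) (R : ℝ) {ε : ℝ} (hε : 0 < ε) :
    ∃ F : Set (Vec d → ℝ), F.Finite ∧ (∀ g ∈ F, MemLp g 2 (volume.restrict K)) ∧
      ∀ᶠ l in atTop, ∀ v : (D l).X, (D l).nrm v ≤ R →
        ∃ g ∈ F, l2 (volume.restrict K) ((D l).recM v - g) ≤ ε := by
  classical
  have : IsFiniteMeasure (volume.restrict K) := ⟨by simpa using hK.measure_lt_top⟩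
  by_contra hcon
  push Not at hcon
  -- If no finite set works for all large l, then bounded discrete unknowns at increasing l can be
  -- picked one after another, each at distance more than ε from all earlier ones.
  obtain ⟨a, haP, har⟩ := exists_seq_of_forall_finset_exists (α := Σ l, (D l).X)
    (fun x => (D x.1).nrm x.2 ≤ R)
    (fun x y => x.1 < y.1 ∧ ε < l2 (volume.restrict K) ((D y.1).recM y.2 - (D x.1).recM x.2)) (by
      intro s hs
      have h1 := hcon ((fun x : Σ l, (D l).X => (D x.1).recM x.2) '' s)
        (s.finite_toSet.image _) (by
          rintro _ ⟨x, -, rfl⟩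
          exact memLp_recM (D x.1) x.2 2 _)
      obtain ⟨l, ⟨v, hv, hvs⟩, hl⟩ :=
        (h1.and_eventually (eventually_gt_atTop (s.sup fun x => x.1))).exists
      refine ⟨⟨l, v⟩, hv, fun x hx => ⟨?_, hvs _ ⟨x, hx, rfl⟩⟩⟩
      exact (Finset.le_sup (f := fun x : Σ l, (D l).X => x.1) hx).trans_lt hl)
  have hmono : StrictMono fun n => (a n).1 := fun m n hmn => (har m n hmn).1
  -- The picked unknowns only occupy a subsequence of the discretizations. The other indices receive
  -- 0, which keeps the energy norms bounded, and a convergent subsequence then contradicts the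
  -- separation.
  let v : ∀ l, (D l).X := fun l =>
    if h : ∃ n, (a n).1 = l then h.choose_spec ▸ (a h.choose).2 else 0
  have hv : ∀ n, v (a n).1 = (a n).2 := by
    intro n
    have hex : ∃ m, (a m).1 = (a n).1 := ⟨n, rfl⟩
    have key : ∀ m (e : (a m).1 = (a n).1), (e ▸ (a m).2 : (D (a n).1).X) = (a n).2 := by
      intro m e
      obtain rfl := hmono.injective e
      rfl
    simp only [v, dif_pos hex]
    exact key _ _
  have hvn : ∀ l, (D l).nrm (v l) ≤ max R 0 := by
    intro l
    by_cases hex : ∃ n, (a n).1 = l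
    · obtain ⟨n, rfl⟩ := hex
      rw [hv]
      exact (haP n).trans (le_max_left _ _)
    · simp only [v, dif_neg hex]
      refine le_trans (le_of_eq ?_) (le_max_right _ _)
      simp only [FlowGD.nrm, map_zero, Pi.zero_apply, smul_zero]
      simp [l2]
  obtain ⟨hmem, hcomp⟩ := (hD v ⟨_, hvn⟩).1 K hK hKΩ
  obtain ⟨b, -, φ, hφ, hlim⟩ := hcomp.tendsto_subseq
    (x := fun n => (hmem (a n).1).toLp _) fun n => subset_closure (mem_range_self _)
  obtain ⟨N, hN⟩ := Metric.cauchySeq_iff.1 hlim.cauchySeq ε hε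
  have h1 := hN (N + 1) (Nat.le_succ N) N le_rfl
  have h2 := (har _ _ (hφ (Nat.lt_succ_self N))).2
  rw [dist_eq_norm] at h1
  simp only [Function.comp_apply] at h1
  rw [← MemLp.toLp_sub, ← l2_eq_norm, hv, hv] at h1
  exact absurd h1 (not_lt.2 h2.le)

end LocalNets

/-! ### Compactness of the saturations -/

section Saturation

variable {d : ℕ} {Q : Model d}

/-- The intervals are disjoint, so each time step is attributed to at most one of them through the
point x n. -/
theorem sum_Ioc_le {m : ℕ} {b x : Fin m → ℝ} (hb : ∀ n, 0 ≤ b n) (k : ℕ) {h : ℝ} (hh : 0 ≤ h) :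
    ∑ i ∈ Finset.range k, ∑ n with x n ∈ Ioc (i * h) ((i + 1 : ℕ) * h), b n ≤ ∑ n, b n := by
  classical
  have hdisj := Monotone.pairwise_disjoint_on_Ioc_succ (f := fun i : ℕ => (i : ℝ) * h)
    fun i j hij => mul_le_mul_of_nonneg_right (by exact_mod_cast hij) hh
  rw [← Finset.sum_biUnion]
  · exact Finset.sum_le_sum_of_subset_of_nonneg (Finset.subset_univ _) fun n _ _ => hb n
  · intro i _ j _ hij
    refine Finset.disjoint_left.2 fun n hi hj => ?_
    exact disjoint_left.1 (hdisj hij) (Finset.mem_filter.1 hi).2 (Finset.mem_filter.1 hj).2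

/-- The data and the pressure gradients have uniformly bounded norms in space-time. -/
theorem exists_variation_bound {D : ℕ → FlowGD Q} {p : ∀ l, FlowUnknown (D l)} {C : ℝ}
    (hC : ∀ l, ∑ n, step (D l).grid n * ((D l).nrm (p l Phase.nw n.succ) ^ 2
      + (D l).nrm (p l Phase.w n.succ) ^ 2) ≤ C) :
    ∃ C' : ℝ, ∀ l, ∑ n, variationBound (p l) n ≤ C' ∧
      ∑ n, step (D l).grid n * (1 + gradBound (p l) n.succ) ^ 2 ≤ C' := by
  set H := l2 (Q.time.prod Q.vol) (Q.hm Phase.nw) ^ 2 + l2 (Q.time.prod Q.vol) (Q.hm Phase.w) ^ 2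
  -- The first bound comes from Young's inequality applied to each product in `variationBound`, the
  -- second from (1 + a + b)² ≤ 3 + 3(a² + b²); summing the steps produces T.
  refine ⟨max (2 * Q.T + H + C) (3 * Q.T + 3 * C), fun l => ⟨le_max_of_le_left ?_,
    le_max_of_le_right ?_⟩⟩
  · have h1 : ∀ n, variationBound (p l) n ≤ 2 * step (D l).grid n
        + (sourceNormM (D l) Phase.nw n ^ 2 + sourceNormM (D l) Phase.w n ^ 2)
        + step (D l).grid n * ((D l).nrm (p l Phase.nw n.succ) ^ 2
          + (D l).nrm (p l Phase.w n.succ) ^ 2) := by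
      intro n
      have hs := step_pos (D l).grid n
      have hβ : ∀ β, √(step (D l).grid n) * sourceNormM (D l) β n
          + step (D l).grid n * l2 Q.vol ((D l).gradM (p l β n.succ)) ≤
          step (D l).grid n + sourceNormM (D l) β n ^ 2
            + step (D l).grid n * (D l).nrm (p l β n.succ) ^ 2 := by
        intro β
        have e := Real.sq_sqrt hs.le
        have h1 := sq_nonneg (√(step (D l).grid n) - sourceNormM (D l) β n)
        have h2 : l2 Q.vol ((D l).gradM (p l β n.succ)) ≤ (D l).nrm (p l β n.succ) :=
          le_add_of_nonneg_right (l2_nonneg _)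
        have h3 : (D l).nrm (p l β n.succ) ≤ 1 / 2 + 1 / 2 * (D l).nrm (p l β n.succ) ^ 2 := by
          linarith [sq_nonneg ((D l).nrm (p l β n.succ) - 1)]
        have h4 := mul_le_mul_of_nonneg_left (h2.trans h3) hs.le
        have h5 : 0 ≤ step (D l).grid n * (D l).nrm (p l β n.succ) ^ 2 := by positivity
        have h6 := sq_nonneg (sourceNormM (D l) β n)
        linarith
      have h1 := hβ Phase.nw
      have h2 := hβ Phase.w
      rw [variationBound]
      linarith
    have h2 := Finset.sum_le_sum fun n (_ : n ∈ Finset.univ) => h1 n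
    rw [Finset.sum_add_distrib, Finset.sum_add_distrib, Finset.sum_add_distrib, ← Finset.mul_sum,
      sum_step] at h2
    linarith [hC l, sum_sq_sourceNormM_le (D l) Phase.nw, sum_sq_sourceNormM_le (D l) Phase.w]
  · have h1 : ∀ n, step (D l).grid n * (1 + gradBound (p l) n.succ) ^ 2 ≤
        3 * step (D l).grid n + 3 * (step (D l).grid n * ((D l).nrm (p l Phase.nw n.succ) ^ 2
          + (D l).nrm (p l Phase.w n.succ) ^ 2)) := by
      intro n
      have hs := step_pos (D l).grid n
      set a := (D l).nrm (p l Phase.nw n.succ)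
      set b := (D l).nrm (p l Phase.w n.succ)
      have h2 : gradBound (p l) n.succ ≤ a + b :=
        add_le_add (le_add_of_nonneg_right (l2_nonneg _)) (le_add_of_nonneg_right (l2_nonneg _))
      have h3 := pow_le_pow_left₀ (add_nonneg zero_le_one (gradBound_nonneg (p := p l) n.succ))
        (add_le_add_right h2 1) 2
      have h4 : (1 + (a + b)) ^ 2 ≤ 3 + 3 * (a ^ 2 + b ^ 2) := by
        linarith [sq_nonneg (1 - a), sq_nonneg (1 - b), sq_nonneg (a - b)]
      have h5 := mul_le_mul_of_nonneg_left (h3.trans h4) hs.le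
      linarith
    have h2 := Finset.sum_le_sum fun n (_ : n ∈ Finset.univ) => h1 n
    rw [Finset.sum_add_distrib, ← Finset.mul_sum, ← Finset.mul_sum, sum_step] at h2
    linarith [hC l]

/-- Collects what the cut-off gives on a fixed compact set, with one constant A: sψ is bounded in
energy norm, for compactness in space, and s has controlled oscillation, because ψ is 1 on K and
nonnegative elsewhere. The lower porosity bound is used at the later index only. -/
theorem exists_oscillation_bound {D : ℕ → FlowGD Q} {E : ℕ → MechGD Q} (hD_chain : ChainRule D)
    (hD_product : ProductRule D) (hD_cutoff : CutOff D) {φmin : ℝ} (hφmin : 0 < φmin)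
    {p : ∀ l, FlowUnknown (D l)} {u : ∀ l, MechUnknown (D l) (E l)}
    (hflow : ∀ l α, FlowEquation (p l) (u l) α) (α : Phase) {K : Set (Vec d)} (hK : IsCompact K)
    (hKΓ : K ⊆ Q.Ω \ closure Q.Γ) :
    ∃ A : ℝ, 0 ≤ A ∧ ∃ ψ : ∀ l, (D l).X, ∀ᶠ l in atTop,
      (∀ᵐ x ∂volume.restrict K, (D l).recM (ψ l) x = 1) ∧
      (∀ k, (D l).nrm (sM (p l) α k * ψ l) ≤ A * (1 + gradBound (p l) k)) ∧
      ∀ j k, j ≤ k → (∀ᵐ x ∂Q.vol, φmin ≤ porosity (p l) (u l) k x) →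
        l2 (volume.restrict K) ((D l).recM (sM (p l) α k) - (D l).recM (sM (p l) α j)) ^ 2 ≤
          A * (1 + gradBound (p l) k + gradBound (p l) j)
            * ∑ n with j ≤ n.castSucc ∧ n.succ ≤ k, variationBound (p l) n := by
  have : IsFiniteMeasure (volume.restrict K) := ⟨by simpa using hK.measure_lt_top⟩
  obtain ⟨κ, hκ0, hκ⟩ := exists_flux_bound Q
  obtain ⟨CF, hCF0, hCF⟩ := hD_chain (fun q => sat Q.Sm α q - sat Q.Sm α 0) (by
    obtain ⟨L, hL⟩ := lipschitz_sat Q.Sm_sat α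
    refine ⟨L, LipschitzWith.of_dist_le_mul fun x y => ?_⟩
    simpa using hL.dist_le_mul x y) (by simp)
  obtain ⟨CP, hCP⟩ := hD_product
  obtain ⟨Cψ, hCψ0, ψ, ⟨B, hB⟩, hev⟩ := hD_cutoff K hK hKΓ
  have hB0 : 0 ≤ B := (norm_nonneg _).trans (hB 0)
  have hCP' : ∀ l (v w : (D l).X), l2 Q.vol ((D l).gradM (v * w)) ≤
      |CP| * (‖v‖ * l2 Q.vol ((D l).gradM w) + ‖w‖ * l2 Q.vol ((D l).gradM v)) := fun l v w =>
    (hCP l v w).trans (mul_le_mul_of_nonneg_right (le_abs_self _)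
      (add_nonneg (mul_nonneg (norm_nonneg _) (l2_nonneg _))
        (mul_nonneg (norm_nonneg _) (l2_nonneg _))))
  set A0 := Cψ + |CP| * (Cψ + B * CF)
  set A1 := |CP| * (Cψ + B * CF)
  set A2 := |CP| * (Cψ + B * CF) + |CP| * (Cψ + B * (|CP| * (2 * CF)))
  have hA0 : 0 ≤ A0 := by positivity
  have hA1 : 0 ≤ A1 := by positivity
  have hA2 : 0 ≤ A2 := by positivity
  set V := √(Q.vol.real univ)
  set Λ := B * V + κ * (A1 + A2)
  have hΛ : 0 ≤ Λ := by positivity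
  -- A0 serves the energy norm of sψ. The second summand serves the oscillation: three tested
  -- equations, divided by the porosity bound.
  refine ⟨A0 + 3 * Λ / φmin, by positivity, ψ, ?_⟩
  filter_upwards [hev] with l ⟨hψ0, hψ1, hψg, hψΓ⟩
  have hcut := fun j k => cutoff_products (D l) (p l) α hCF0 (abs_nonneg CP) hCψ0 hB0 (hCF l)
    (hCP' l) (hB l) hψg j k
  have hgb := gradBound_nonneg (p := p l)
  refine ⟨hψ1, fun k => ?_, fun j k hjk hpor => ?_⟩
  · rw [nrm_mul_eq hψΓ]
    refine (hcut k k).1.trans (mul_le_mul_of_nonneg_right ?_ (by linarith [hgb k]))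
    have : 0 ≤ 3 * Λ / φmin := by positivity
    linarith
  · set W := 1 + gradBound (p l) k + gradBound (p l) j with hW
    have hW1 : 1 ≤ W := by linarith [hgb k, hgb j]
    set S := ∑ n with j ≤ n.castSucc ∧ n.succ ≤ k, variationBound (p l) n
    have hS0 : 0 ≤ S := Finset.sum_nonneg fun n _ => variationBound_nonneg (p l) n
    have hd1 : ‖sM (p l) α k - sM (p l) α j‖ ≤ 1 := by
      refine (pi_norm_le_iff_of_nonneg zero_le_one).2 fun i => ?_
      have h1 := sM_mem (p l) α k i
      have h2 := sM_mem (p l) α j i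
      rw [Real.norm_eq_abs, abs_le]
      simp only [mem_Icc, Pi.sub_apply] at *
      constructor <;> linarith
    have hs1 : ‖sM (p l) α j‖ ≤ 1 := by
      refine (pi_norm_le_iff_of_nonneg zero_le_one).2 fun i => ?_
      have h2 := sM_mem (p l) α j i
      rw [Real.norm_of_nonneg h2.1]
      exact h2.2
    have hrec : ∀ v : (D l).X, ‖v‖ ≤ 1 → l2 Q.vol ((D l).recM (v * ψ l)) ≤ B * V := by
      intro v hv
      refine l2_le_of_bound hB0 (ae_of_all _ fun x => ((abs_recM_le (D l) _ x).trans
        ((norm_mul_le _ _).trans ?_)))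
      have := mul_le_mul hv (hB l) (norm_nonneg _) zero_le_one
      rwa [one_mul] at this
    have hBV : B * V ≤ B * V * W := le_mul_of_one_le_right (by positivity) hW1
    have hk1 : 0 ≤ κ * A1 * W := by positivity
    have hk2 : 0 ≤ κ * A2 * W := by positivity
    have hmain := weighted_difference_le (D := D l) (p := p l) (u := u l) (φmin := φmin)
      (Λ := Λ * W) α hκ0 (hκ (D l) (p l)) (hflow l) hψΓ hψ0 hjk hpor
      (by
        have h1 := hrec _ hd1
        have h2 := mul_le_mul_of_nonneg_left (hcut j k).2.1 hκ0
        linarith)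
      (by
        have h1 := hrec (sM (p l) α j * (sM (p l) α k - sM (p l) α j))
          ((norm_mul_le _ _).trans (mul_le_one₀ hs1 (norm_nonneg _) hd1))
        have h2 := mul_le_mul_of_nonneg_left (hcut j k).2.2 hκ0
        linarith)
    have hle : volume.restrict K ≤ Q.vol :=
      Measure.restrict_mono (hKΓ.trans sdiff_subset) le_rfl
    have hint : Integrable (fun x => (D l).recM (ψ l) x
        * ((D l).recM (sM (p l) α k) x - (D l).recM (sM (p l) α j) x) ^ 2) Q.vol := by
      have e : (fun x => (D l).recM (ψ l) x
          * ((D l).recM (sM (p l) α k) x - (D l).recM (sM (p l) α j) x) ^ 2) =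
          (D l).recM (ψ l * (sM (p l) α k - sM (p l) α j) ^ 2) := by
        ext x
        rcases recM_cases (D l) x with h | ⟨i, h⟩ <;> simp [h]
      rw [e]
      exact (memLp_recM (D l) _ 1 Q.vol).integrable le_rfl
    have hlocal : l2 (volume.restrict K)
        ((D l).recM (sM (p l) α k) - (D l).recM (sM (p l) α j)) ^ 2 ≤
        ∫ x, (D l).recM (ψ l) x
          * ((D l).recM (sM (p l) α k) x - (D l).recM (sM (p l) α j) x) ^ 2 ∂Q.vol := by
      rw [l2_sq ((memLp_recM (D l) _ 2 _).sub (memLp_recM (D l) _ 2 _))]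
      calc _ = ∫ x in K, (D l).recM (ψ l) x
          * ((D l).recM (sM (p l) α k) x - (D l).recM (sM (p l) α j) x) ^ 2 := by
            refine integral_congr_ae ?_
            filter_upwards [hψ1] with x hx
            simp [hx]
        _ ≤ _ := integral_mono_measure hle
            (hψ0.mono fun x hx => mul_nonneg hx (sq_nonneg _)) hint
    refine hlocal.trans ?_
    rw [← le_div_iff₀' hφmin] at hmain
    refine hmain.trans ?_
    have h1 : 3 * (Λ * W) * S / φmin = 3 * Λ / φmin * W * S := by ring
    rw [h1]
    have h2 : 0 ≤ A0 * W * S := by positivity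
    linarith

theorem satRecon_mem {D : FlowGD Q} (p : FlowUnknown D) (α : Phase) (z : ℝ × Vec d) :
    satRecon p α z ∈ Icc (0 : ℝ) 1 := recM_sM_mem p α _ _

theorem measurable_satRecon {D : FlowGD Q} (p : FlowUnknown D) (α : Phase) :
    Measurable (satRecon p α) := by
  unfold satRecon FlowGD.recM
  refine Finset.measurable_sum _ fun i _ => ?_
  have h1 : Measurable fun z : ℝ × Vec d => sM p α (D.grid.idx z.1) i :=
    (measurable_of_finite fun k => sM p α k i).comp ((measurable_idx D.grid).comp measurable_fst)
  exact h1.indicator (measurable_snd (D.cellM_meas i))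

theorem memLp_satRecon {D : FlowGD Q} (p : FlowUnknown D) (α : Phase) (μ : Measure (ℝ × Vec d))
    [IsFiniteMeasure μ] : MemLp (satRecon p α) 2 μ :=
  MemLp.of_bound (measurable_satRecon p α).aestronglyMeasurable 1 (ae_of_all _ fun z => by
    have h := satRecon_mem p α z
    rw [Real.norm_of_nonneg h.1]
    exact h.2)

/-- Relative compactness in space-time follows from finite nets on compact sets away from the
fractures. -/
theorem relCompactL2_of_local_nets (hd : 0 < d) {D : ℕ → FlowGD Q} (p : ∀ l, FlowUnknown (D l))
    (α : Phase)
    (h : ∀ K : Set (Vec d), IsCompact K → K ⊆ Q.Ω \ closure Q.Γ → ∀ ε : ℝ, 0 < ε →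
      ∃ F : Set (ℝ × Vec d → ℝ), F.Finite ∧
        (∀ g ∈ F, MemLp g 2 (Q.time.prod (volume.restrict K))) ∧
        ∀ᶠ l in atTop, ∃ g ∈ F, l2 (Q.time.prod (volume.restrict K)) (satRecon (p l) α - g) ≤ ε) :
    RelCompactL2 (Q.time.prod Q.vol) fun l => satRecon (p l) α := by
  refine relCompactL2_of_finite_nets (fun l => memLp_satRecon (p l) α _) fun ε hε => ?_
  have hT := Q.T_pos
  set U := Q.Ω \ closure Q.Γ with hU
  have hUo : IsOpen U := Q.polytopal.1.sdiff isClosed_closure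
  have hUfin : volume U ≠ ⊤ :=
    ((measure_mono sdiff_subset).trans_lt Q.polytopal.2.2.1.measure_lt_top).ne
  -- Saturations are at most 1, so what happens outside K has L² norm at most the square root of T
  -- times the measure left out, that is ε/2.
  obtain ⟨K, hKU, hK, hKlt⟩ := hUo.measurableSet.exists_isCompact_sdiff_lt hUfin
    (ε := ENNReal.ofReal (ε ^ 2 / (4 * Q.T))) (by simp; positivity)
  have : IsFiniteMeasure (volume.restrict K) := ⟨by simpa using hK.measure_lt_top⟩
  have hKΩ : K ⊆ Q.Ω := hKU.trans sdiff_subset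
  have hrK : Q.vol.restrict K = volume.restrict K := by
    rw [FracturedDomain.vol, Measure.restrict_restrict hK.measurableSet, inter_eq_left.2 hKΩ]
  have hprodK : (Q.time.prod Q.vol).restrict (univ ×ˢ K) = Q.time.prod (volume.restrict K) := by
    rw [← Measure.prod_restrict, Measure.restrict_univ, hrK]
  have hmeas : MeasurableSet ((univ : Set ℝ) ×ˢ K) := MeasurableSet.univ.prod hK.measurableSet
  have hout : Q.vol.real Kᶜ ≤ ε ^ 2 / (4 * Q.T) := by
    have h1 : Q.vol Kᶜ ≤ volume (U \ K) := by
      rw [FracturedDomain.vol, Measure.restrict_apply hK.measurableSet.compl]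
      refine (measure_mono (t := (U \ K) ∪ closure Q.Γ) fun x hx => ?_).trans
        ((measure_union_le _ _).trans_eq ?_)
      · by_cases hxΓ : x ∈ closure Q.Γ
        · exact Or.inr hxΓ
        · exact Or.inl ⟨⟨hx.2, hxΓ⟩, hx.1⟩
      · rw [volume_closure_Gamma Q.toFracturedDomain hd, add_zero]
    rw [measureReal_def]
    exact ENNReal.toReal_le_of_le_ofReal (by positivity) (h1.trans hKlt.le)
  obtain ⟨F, hF, hFm, hev⟩ := h K hK hKU (ε / 2) (half_pos hε)
  refine ⟨(fun g => (univ ×ˢ K).indicator g) '' F, hF.image _, ?_, ?_⟩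
  · rintro _ ⟨g, hg, rfl⟩
    rw [memLp_indicator_iff_restrict hmeas, hprodK]
    exact hFm g hg
  filter_upwards [hev] with l ⟨g, hg, hgd⟩
  refine ⟨_, ⟨g, hg, rfl⟩, ?_⟩
  have hfm := memLp_satRecon (p l) α (Q.time.prod Q.vol)
  have hsplit : satRecon (p l) α - (univ ×ˢ K).indicator g =
      (univ ×ˢ K).indicator (satRecon (p l) α - g) + (univ ×ˢ K)ᶜ.indicator (satRecon (p l) α) := by
    ext z
    by_cases hz : z ∈ (univ : Set ℝ) ×ˢ K
    · simp only [Pi.sub_apply, Pi.add_apply, indicator_of_mem hz,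
        indicator_of_notMem (notMem_compl_iff.2 hz), add_zero]
    · simp only [Pi.sub_apply, Pi.add_apply, indicator_of_notMem hz,
        indicator_of_mem (mem_compl hz), sub_zero, zero_add]
  have hm1 : MemLp ((univ ×ˢ K).indicator (satRecon (p l) α - g)) 2 (Q.time.prod Q.vol) := by
    rw [memLp_indicator_iff_restrict hmeas, hprodK]
    exact (memLp_satRecon (p l) α _).sub (hFm g hg)
  have hm2 := hfm.indicator hmeas.compl
  have h1 : l2 (Q.time.prod Q.vol) ((univ ×ˢ K).indicator (satRecon (p l) α - g)) ≤ ε / 2 := by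
    rw [l2, eLpNorm_indicator_eq_eLpNorm_restrict hmeas, hprodK]
    exact hgd
  have h2 : l2 (Q.time.prod Q.vol) ((univ ×ˢ K)ᶜ.indicator (satRecon (p l) α)) ≤ ε / 2 := by
    rw [l2, eLpNorm_indicator_eq_eLpNorm_restrict hmeas.compl]
    refine (l2_le_of_bound (μ := (Q.time.prod Q.vol).restrict (univ ×ˢ K)ᶜ) zero_le_one
      (ae_of_all _ fun z => ?_)).trans ?_
    · have h := satRecon_mem (p l) α z
      rw [Real.norm_of_nonneg h.1]
      exact h.2
    · rw [one_mul, measureReal_restrict_apply_univ]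
      have e : ((univ : Set ℝ) ×ˢ K)ᶜ = univ ×ˢ Kᶜ := by
        ext z; simp
      have ht : Q.time.real univ = Q.T := by
        rw [Model.time, measureReal_restrict_apply_univ, Real.volume_real_Ioo_of_le hT.le, sub_zero]
      rw [e, measureReal_prod_prod, ht]
      refine Real.sqrt_le_iff.2 ⟨by positivity, ?_⟩
      refine (mul_le_mul_of_nonneg_left hout hT.le).trans (le_of_eq ?_)
      field_simp
      norm_num
  rw [hsplit]
  exact (l2_add_le hm1 hm2).trans (by linarith)

end Saturation

/-! ### Space-time nets for the saturations -/

section Main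

variable {d : ℕ} {Q : Model d}

theorem time_eq (Q : Model d) : Q.time = volume.restrict (Ioc 0 Q.T) :=
  Measure.restrict_congr_set Ioo_ae_eq_Ioc

/-- The Aubin–Simon criterion with w = 1 + the pressure gradients, bounded in L²(0,T), and with γ
counting the variation of the time steps in an interval. -/
theorem exists_local_spacetime_net {D : ℕ → FlowGD Q} {p : ∀ l, FlowUnknown (D l)} {α : Phase}
    (hD_compact : LocallyCompact D) {K : Set (Vec d)} (hK : IsCompact K) (hKΩ : K ⊆ Q.Ω)
    {A C : ℝ} (hA : 0 ≤ A)
    (hC : ∀ l, ∑ n, variationBound (p l) n ≤ C ∧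
      ∑ n, step (D l).grid n * (1 + gradBound (p l) n.succ) ^ 2 ≤ C)
    {ψ : ∀ l, (D l).X}
    (hψ : ∀ᶠ l in atTop,
      (∀ᵐ x ∂volume.restrict K, (D l).recM (ψ l) x = 1) ∧
      (∀ k, (D l).nrm (sM (p l) α k * ψ l) ≤ A * (1 + gradBound (p l) k)) ∧
      ∀ j k, j ≤ k → k ≠ 0 →
        l2 (volume.restrict K) ((D l).recM (sM (p l) α k) - (D l).recM (sM (p l) α j)) ^ 2 ≤
          A * (1 + gradBound (p l) k + gradBound (p l) j)
            * ∑ n with j ≤ n.castSucc ∧ n.succ ≤ k, variationBound (p l) n)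
    {ε : ℝ} (hε : 0 < ε) :
    ∃ F : Set (ℝ × Vec d → ℝ), F.Finite ∧
      (∀ g ∈ F, MemLp g 2 (Q.time.prod (volume.restrict K))) ∧
      ∀ᶠ l in atTop, ∃ g ∈ F, l2 (Q.time.prod (volume.restrict K)) (satRecon (p l) α - g) ≤ ε := by
  have : IsFiniteMeasure (volume.restrict K) := ⟨by simpa using hK.measure_lt_top⟩
  have hT := Q.T_pos
  have hgb := fun l => gradBound_nonneg (p := p l)
  have hw : ∀ l, MemLp (fun s => 1 + gradBound (p l) ((D l).grid.idx s)) 2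
      (volume.restrict (Ioc 0 Q.T)) := by
    intro l
    refine MemLp.of_bound ((measurable_of_finite fun k => 1 + gradBound (p l) k).comp
      (measurable_idx (D l).grid)).aestronglyMeasurable
      (∑ k, (1 + gradBound (p l) k)) (ae_of_all _ fun s => ?_)
    have h1 : ∀ k, 0 ≤ 1 + gradBound (p l) k := fun k => by linarith [hgb l k]
    rw [Real.norm_of_nonneg (h1 _)]
    exact Finset.single_le_sum (f := fun k => 1 + gradBound (p l) k) (fun k _ => h1 k)
      (Finset.mem_univ _)
  rw [time_eq]
  -- In γ a step counts for the interval containing its left endpoint. This makes γ summable over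
  -- disjoint intervals whatever their position relative to the grid. In the constant, √C bounds the
  -- L² norm of w and C the total variation.
  refine exists_spacetime_net (ν := volume.restrict K) (A := A) (C := max C √C)
    (f := fun l s => (D l).recM (sM (p l) α ((D l).grid.idx s)))
    (w := fun l s => 1 + gradBound (p l) ((D l).grid.idx s))
    (γ := fun l a b => ∑ n with (D l).grid.t (Fin.castSucc n) ∈ Ioc a b, variationBound (p l) n)
    hT hA (fun l => memLp_satRecon (p l) α _) (fun l t => memLp_recM (D l) _ 2 _) hw ?_ ?_ ?_ ?_ ?_ hε
  · intro l
    refine le_max_of_le_right (Real.le_sqrt_of_sq_le ?_)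
    have h1 := integral_idx (D l).grid fun k => ‖1 + gradBound (p l) k‖ ^ 2
    rw [integral_Ioc_eq_integral_Ioo.symm] at h1
    rw [l2_sq (hw l), h1]
    simpa only [Real.norm_eq_abs, sq_abs] using (hC l).2
  · exact fun l a b => Finset.sum_nonneg fun n _ => variationBound_nonneg (p l) n
  · exact fun l m h hh => le_max_of_le_left
      ((sum_Ioc_le (variationBound_nonneg (p l)) m hh).trans (hC l).1)
  · filter_upwards [hψ] with l ⟨_, _, hosc⟩
    have key : ∀ a b, ∀ s ∈ Ioc 0 Q.T, ∀ t ∈ Ioc 0 Q.T, s ∈ Ioc a b → t ∈ Ioc a b → s ≤ t →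
        l2 (volume.restrict K) ((D l).recM (sM (p l) α ((D l).grid.idx t))
          - (D l).recM (sM (p l) α ((D l).grid.idx s))) ^ 2 ≤
        A * ((1 + gradBound (p l) ((D l).grid.idx t)) + (1 + gradBound (p l) ((D l).grid.idx s)))
          * ∑ n with (D l).grid.t (Fin.castSucc n) ∈ Ioc a b, variationBound (p l) n := by
      intro a b s hs t ht hsa hta hst
      have ht0 : (D l).grid.idx t ≠ 0 := fun h => by
        have h1 := le_t_idx (D l).grid ht.2
        rw [h, (D l).grid.t_zero] at h1
        exact ht.1.not_ge h1
      refine (hosc _ _ (idx_mono _ hst) ht0).trans (mul_le_mul ?_ ?_ ?_ ?_)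
      · exact mul_le_mul_of_nonneg_left (by linarith) hA
      · refine Finset.sum_le_sum_of_subset_of_nonneg (fun n hn => ?_)
          fun n _ _ => variationBound_nonneg (p l) n
        rw [Finset.mem_filter] at hn ⊢
        refine ⟨hn.1, ?_, ?_⟩
        -- A step n between the indices of s and t has s ≤ tₙ < t, so its left endpoint lies in
        -- every interval (a,b] that contains s and t.
        · exact hsa.1.trans_le ((le_t_idx _ hs.2).trans ((D l).grid.t_strictMono.monotone hn.2.1))
        · exact (t_lt_of_lt_idx _ (Fin.castSucc_lt_succ.trans_le hn.2.2)).le.trans hta.2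
      · exact Finset.sum_nonneg fun n _ => variationBound_nonneg (p l) n
      · have h1 := hgb l ((D l).grid.idx t)
        have h2 := hgb l ((D l).grid.idx s)
        positivity
    intro a b s hs t ht hsa hta
    rcases le_total s t with hst | hst
    · exact key a b s hs t ht hsa hta hst
    · have h1 := key a b t ht s hs hta hsa hst
      have e : l2 (volume.restrict K) ((D l).recM (sM (p l) α ((D l).grid.idx t))
          - (D l).recM (sM (p l) α ((D l).grid.idx s))) =
          l2 (volume.restrict K) ((D l).recM (sM (p l) α ((D l).grid.idx s))
            - (D l).recM (sM (p l) α ((D l).grid.idx t))) := by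
        rw [l2, l2, eLpNorm_sub_comm]
      rw [e, add_comm (1 + gradBound (p l) ((D l).grid.idx t))]
      exact h1
  · intro R ε' hε'
    obtain ⟨F, hF, hFm, hFev⟩ := hD_compact.exists_net hK hKΩ (A * R) hε'
    refine ⟨F, hF, hFm, ?_⟩
    filter_upwards [hψ, hFev] with l ⟨hψ1, hnrm, _⟩ hnet s hs hwR
    obtain ⟨g, hg, hgd⟩ := hnet (sM (p l) α ((D l).grid.idx s) * ψ l)
      ((hnrm _).trans (mul_le_mul_of_nonneg_left hwR hA))
    refine ⟨g, hg, (le_of_eq ?_).trans hgd⟩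
    -- Local compactness applies to sψ, whose energy norm is under control; on K it reconstructs the
    -- same function as s.
    have hae : (D l).recM (sM (p l) α ((D l).grid.idx s)) - g =ᵐ[volume.restrict K]
        (D l).recM (sM (p l) α ((D l).grid.idx s) * ψ l) - g := by
      filter_upwards [hψ1] with x hx
      rcases recM_cases (D l) x with h | ⟨i, h⟩
      · simp [h]
      · simp only [h, Pi.sub_apply, Pi.mul_apply] at hx ⊢
        rw [hx, mul_one]
    rw [l2, l2, eLpNorm_congr_ae hae]

end Main

end PoroGDM

end

theorem proposition4p6 {d : ℕ} (hd : d = 2 ∨ d = 3) (Q : Model d)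
    (D : ℕ → FlowGD Q) (E : ℕ → MechGD Q)
    (hD_coercive : FlowCoercive D) (hD_consistent : SpaceTimeConsistent D)
    (hD_compact : LocallyCompact D) (hD_chain : ChainRule D) (hD_product : ProductRule D)
    (hD_cutoff : CutOff D) (hE_coercive : MechCoercive E)
    (φmin : ℝ) (hφmin : 0 < φmin)
    (p : ∀ l, FlowUnknown (D l)) (u : ∀ l, MechUnknown (D l) (E l))
    (hsol : ∀ l, IsSolution (p l) (u l))
    (h_aperture : ∀ l, ∀ᵐ z ∂Q.time.prod Q.surf,
      Q.d₀ z.2 ≤ aperture (u l) ((D l).grid.idx z.1) z.2)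
    (h_porosity : ∀ l, ∀ᵐ z ∂Q.time.prod Q.vol,
      φmin ≤ porosity (p l) (u l) ((D l).grid.idx z.1) z.2)
    (h_aperture_init : ∀ l, ∀ᵐ x ∂Q.surf, 0 ≤ aperture (u l) 0 x)
    (h_porosity_init : ∀ l, ∀ᵐ x ∂Q.vol, 0 ≤ porosity (p l) (u l) 0 x)
    (α : Phase) :
    RelCompactL2 (Q.time.prod Q.vol) fun l => satRecon (p l) α := by
  have hap : ∀ l n, ∀ᵐ x ∂Q.surf, Q.d₀ x ≤ aperture (u l) (Fin.succ n) x := fun l n =>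
    ae_of_ae_prod_idx (D l).grid (P := fun k x => Q.d₀ x ≤ aperture (u l) k x) (h_aperture l) n
  have hpor : ∀ l n, ∀ᵐ x ∂Q.vol, φmin ≤ porosity (p l) (u l) (Fin.succ n) x := fun l n =>
    ae_of_ae_prod_idx (D l).grid (P := fun k x => φmin ≤ porosity (p l) (u l) k x) (h_porosity l) n
  -- The energy inequality of the first step has the initial state as its old state, so
  -- nonnegativity is needed at index 0 too, where the bound by d₀ is not available.
  have hap0 : ∀ l k, ∀ᵐ x ∂Q.surf, 0 ≤ aperture (u l) k x := by
    intro l k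
    refine Fin.cases (h_aperture_init l) (fun n => ?_) k
    have hΓ : ∀ᵐ x ∂Q.surf, x ∈ Q.Γ := ae_restrict_mem (measurableSet_Gamma Q.toFracturedDomain)
    filter_upwards [hap l n, hΓ] with x hx hxΓ
    exact (Q.d₀_pos x hxΓ).le.trans hx
  have hpor0 : ∀ l k, ∀ᵐ x ∂Q.vol, 0 ≤ porosity (p l) (u l) k x := by
    intro l k
    refine Fin.cases (h_porosity_init l) (fun n => ?_) k
    filter_upwards [hpor l n] with x hx
    exact hφmin.le.trans hx
  obtain ⟨C, hC⟩ := energy_estimate D E hD_coercive hD_consistent hE_coercive p u hsol hap hap0 hpor0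
  obtain ⟨C', hC'⟩ := exists_variation_bound hC
  refine relCompactL2_of_local_nets (by omega) p α fun K hK hKU ε hε => ?_
  obtain ⟨A, hA, ψ, hψ⟩ := exists_oscillation_bound hD_chain hD_product hD_cutoff hφmin
    (fun l => (hsol l).flow) α hK hKU
  refine exists_local_spacetime_net hD_compact hK (hKU.trans sdiff_subset) hA hC' (ψ := ψ) ?_ hε
  filter_upwards [hψ] with l ⟨h1, h2, h3⟩
  -- The bound φ_min is known at positive indices only, hence the restriction to a nonzero later
  -- index; times in (0,T] never have index 0.
  refine ⟨h1, h2, fun j k hjk hk => h3 j k hjk ?_⟩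
  obtain ⟨n, rfl⟩ := Fin.exists_succ_eq.2 hk
  exact hpor l n
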